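/- An instance of \textsc{Edge-Disjoint Paths} (EDP) is a triple $(G,\mathcal X,k)$, where $G$ is a finite simple undirected graph and $\mathcal X=\{(s_1,t_1),\ldots,(s_k,t_k)\}$ is an ordered multiset of $k$ pairs of distinct vertices of $G$ (the terminal pairs); it is a Yes-instance if $G$ has $k$ pairwise edge-disjoint paths $P_1,\ldots,P_k$ such that $P_i$ connects $s_i$ with $t_i$ for all $i$. A block of $G$ is a maximal connected subgraph of $G$ that has no cut vertex of its own. A clique path is a connected graph $G$ in which the vertex set of every block is a clique and every block contains at most two cut vertices of $G$. Theorem 5. EDP on clique paths, parameterized by $k$, admits a kernel with at most $2k+1$ vertices. That is, there is an algorithm which, given an instance $(G,\mathcal X,k)$ of EDP in which $G$ is a clique path, computes in time polynomial in the size of $(G,\mathcal X)$ and $k$ an instance $(G',\mathcal X',k')$ of EDP such that $G'$ is a clique path, $|V(G')|\le 2k+1$, $k'\le k$, and $(G',\mathcal X',k')$ is a Yes-instance if and only if $(G,\mathcal X,k)$ is a Yes-instance. -/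

import Mathlib

/-! ### Graph classes -/

namespace SimpleGraph

variable {V : Type*}

/-- A cut vertex: deleting it increases the number of connected components. -/
def IsCutVertex (G : SimpleGraph V) (v : V) : Prop :=
  ENat.card G.ConnectedComponent < ENat.card (G.induce {v}ᶜ).ConnectedComponent

/-- A block: a maximal connected subgraph without cut vertices (of its own). -/
def IsBlock (G : SimpleGraph V) (B : G.Subgraph) : Prop :=
  Maximal (fun H : G.Subgraph => H.Connected ∧ ∀ v : H.verts, ¬ H.coe.IsCutVertex v) B

/-- A block graph: the vertex set of every block is a clique. -/
def IsBlockGraph (G : SimpleGraph V) : Prop :=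
  ∀ B : G.Subgraph, G.IsBlock B → G.IsClique B.verts

/-- A clique path: a connected block graph in which every block contains at most two
cut vertices of the graph. -/
def IsCliquePath (G : SimpleGraph V) : Prop :=
  G.Connected ∧ G.IsBlockGraph ∧
    ∀ B : G.Subgraph, G.IsBlock B → {v ∈ B.verts | G.IsCutVertex v}.encard ≤ 2

end SimpleGraph

/-! ### Edge-Disjoint Paths -/

/-- An instance of Edge-Disjoint Paths: a graph on the vertices `0, …, n - 1` and an ordered
multiset (an indexed family) of `k` terminal pairs `(s i, t i)` of distinct vertices. -/
structure EDPInstance where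
  /-- number of vertices -/
  n : ℕ
  /-- the graph -/
  G : SimpleGraph (Fin n)
  /-- number of terminal pairs, the parameter -/
  k : ℕ
  /-- first terminals -/
  s : Fin k → Fin n
  /-- second terminals -/
  t : Fin k → Fin n
  /-- the two terminals of a pair are distinct -/
  s_ne_t : ∀ i, s i ≠ t i

namespace EDPInstance

/-- Yes-instances: there are pairwise edge-disjoint paths, the `i`-th one from `s i` to `t i`. -/
def IsYes (I : EDPInstance) : Prop :=
  ∃ P : ∀ i, I.G.Walk (I.s i) (I.t i),
    (∀ i, (P i).IsPath) ∧ ∀ i j, i ≠ j → (P i).edges.Disjoint (P j).edges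

open Classical in
/-- The encoding of an instance: `n`, `k`, the adjacency matrix row by row, and the list of
terminal pairs. It is a word of length `2 + n ^ 2 + 2 * k` over the natural numbers, all entries
being at most `max n k` or `1`; the first two entries determine the length. -/
noncomputable def word (I : EDPInstance) : List ℕ :=
  [I.n, I.k] ++
    (List.finRange I.n).flatMap (fun u =>
      (List.finRange I.n).map fun v => if I.G.Adj u v then 1 else 0) ++
    (List.finRange I.k).flatMap (fun i => [(I.s i : ℕ), (I.t i : ℕ)])

end EDPInstance

/-! ### Random access machines

The memory consists of arrays `0, 1, 2, …` of cells that hold natural numbers. The elementary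
operations are indirect reads and writes, addition, truncated subtraction and comparison. There is
no multiplication, so that in `T` steps only numbers of `O(T)` more bits than the input can be
formed, and counting every elementary operation as one step yields the usual notion of
polynomial time. -/

namespace RAM

/-- The contents of the memory: `m a i` is cell `i` of array `a`. -/
abbrev Memory := ℕ → ℕ → ℕ

/-- Expressions. -/
inductive Expr
  | const (c : ℕ)
  | read (a : ℕ) (i : Expr)
  | add (e₁ e₂ : Expr)
  | sub (e₁ e₂ : Expr)
  | eq (e₁ e₂ : Expr)
  | lt (e₁ e₂ : Expr)

/-- The value of an expression; a comparison has value `1` if it holds and `0` otherwise. -/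
def Expr.eval (m : Memory) : Expr → ℕ
  | .const c => c
  | .read a i => m a (i.eval m)
  | .add e₁ e₂ => e₁.eval m + e₂.eval m
  | .sub e₁ e₂ => e₁.eval m - e₂.eval m
  | .eq e₁ e₂ => if e₁.eval m = e₂.eval m then 1 else 0
  | .lt e₁ e₂ => if e₁.eval m < e₂.eval m then 1 else 0

/-- The number of elementary operations in the evaluation of an expression. -/
def Expr.cost : Expr → ℕ
  | .const _ => 1
  | .read _ i => i.cost + 1
  | .add e₁ e₂ => e₁.cost + e₂.cost + 1
  | .sub e₁ e₂ => e₁.cost + e₂.cost + 1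
  | .eq e₁ e₂ => e₁.cost + e₂.cost + 1
  | .lt e₁ e₂ => e₁.cost + e₂.cost + 1

/-- Programs. A condition counts as true if its value is nonzero. -/
inductive Program
  | skip
  | write (a : ℕ) (i e : Expr)
  | seq (p q : Program)
  | ite (e : Expr) (p q : Program)
  | loop (e : Expr) (p : Program)

/-- Replace the contents of cell `i` of array `a` by `x`. -/
def Memory.set (m : Memory) (a i x : ℕ) : Memory :=
  fun b j => if b = a ∧ j = i then x else m b j

/-- `Exec p m m' T`: the program `p`, started with memory `m`, halts after exactly `T` elementary
steps with memory `m'`. -/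
inductive Exec : Program → Memory → Memory → ℕ → Prop
  | skip (m : Memory) : Exec .skip m m 1
  | write (m : Memory) (a : ℕ) (i e : Expr) :
      Exec (.write a i e) m (m.set a (i.eval m) (e.eval m)) (i.cost + e.cost + 1)
  | seq {p q : Program} {m m' m'' : Memory} {T T' : ℕ} :
      Exec p m m' T → Exec q m' m'' T' → Exec (.seq p q) m m'' (T + T')
  | ite_true {e : Expr} {p q : Program} {m m' : Memory} {T : ℕ} :
      e.eval m ≠ 0 → Exec p m m' T → Exec (.ite e p q) m m' (e.cost + 1 + T)
  | ite_false {e : Expr} {p q : Program} {m m' : Memory} {T : ℕ} :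
      e.eval m = 0 → Exec q m m' T → Exec (.ite e p q) m m' (e.cost + 1 + T)
  | loop_true {e : Expr} {p : Program} {m m' m'' : Memory} {T T' : ℕ} :
      e.eval m ≠ 0 → Exec p m m' T → Exec (.loop e p) m' m'' T' →
        Exec (.loop e p) m m'' (e.cost + 1 + T + T')
  | loop_false {e : Expr} {p : Program} {m : Memory} :
      e.eval m = 0 → Exec (.loop e p) m m (e.cost + 1)

/-- The initial memory: the input word is in array `0`, and all other cells are `0`. -/
def input (w : List ℕ) : Memory :=
  fun a i => if a = 0 then w.getD i 0 else 0

/-- On input `w`, the program halts after at most `T` steps, and then the first cells of array `1`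
hold the word `w'`. -/
def OutputsWithin (p : Program) (w w' : List ℕ) (T : ℕ) : Prop :=
  ∃ (m : Memory) (T' : ℕ), Exec p (input w) m T' ∧ T' ≤ T ∧
    ∀ (i : ℕ) (hi : i < w'.length), m 1 i = w'[i]

end RAM

/-! ### Kernels -/

/-- Edge-Disjoint Paths on the graph class `𝒞`, parameterized by the number `k` of terminal
pairs, admits a kernel with at most `f k` vertices: there is an algorithm that, given an instance
`I` with graph in `𝒞`, computes in time polynomial in the size of `I` and `k` an equivalent instance
`J` with graph in `𝒞`, at most `f k` vertices, and at most `k` terminal pairs. -/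
def EDPAdmitsVertexKernel (𝒞 : ∀ n : ℕ, SimpleGraph (Fin n) → Prop) (f : ℕ → ℕ) : Prop :=
  ∃ (A : RAM.Program) (τ : Polynomial ℕ), ∀ I : EDPInstance, 𝒞 I.n I.G →
    ∃ J : EDPInstance, 𝒞 J.n J.G ∧ (I.IsYes ↔ J.IsYes) ∧ J.n ≤ f I.k ∧ J.k ≤ I.k ∧
      RAM.OutputsWithin A I.word J.word (τ.eval (I.word.length + I.k))

/-! In a block graph every block `B` is a clique, and each vertex `x` has a unique nearest vertex in
`B`, its gate. An edge outside `B` has the same gate at both ends. Hence an edge-disjoint routing of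
`G` amounts to independent edge-disjoint routings, one in each clique `B`, between the gates of the
terminals (`IsContraction.routable_iff`).

Let the demand of `w` in `B` be the number of pairs with exactly one gate at `w`. A demand above
`|B| - 1` exceeds the degree of `w` in `B`, so the answer is No (`Overloaded.not_routable`).
Otherwise `B` can be routed as soon as it has two vertices `c`, `c'` such that the demands of the
other `|B| - 2` vertices add up to at most `|B| - 2` (`exists_clique_routing`): these vertices then
suffice as intermediate stops that are distinct up to harmless coincidences. Such blocks impose no
condition and are contracted; pairs whose ends are merged are dropped.

It remains to count. In a clique path `c` and `c'` can be chosen to include all cut vertices of `B`.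
If `B` survives, the total demand of its other vertices is at least `|B| - 1`. These are not cut
vertices, so each is the gate of itself only. Thus `B` has at least `|B| - 1` terminals, with
multiplicity, at non-cut vertices, and those lie in no other block. Every vertex of the contraction
except a root is charged to a vertex of a surviving block other than the gate of the root, which
gives at most `1 + ∑ (|B| - 1) ≤ 2k + 1` vertices (`IsContraction.card_le`). Contraction preserves
clique paths because these have a description by adjacency and linkage alone (`isCliquePath_iff`).

For the running time, gates, demands and merged vertices are expressed through distances and through
sums over vertices and pairs. A small language whose only loops run over vertices or pairs is
compiled to the machine, and each of its programs is automatically polynomial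
(`Command.exists_program`). -/

namespace RAM

/-! ### A language of bounded loops -/

/-- The two admissible ranges of a bounded loop: below the first or below the second number of the
input. -/
inductive Range
  | vertices
  | pairs

/-- The cell of the input that holds the bound of a range. -/
def Range.cell : Range → ℕ
  | .vertices => 0
  | .pairs => 1

/-- Terms with variables and bounded sums. -/
inductive Term
  | const (c : ℕ)
  | var (x : ℕ)
  | input (i : Term)
  | read (a : ℕ) (i : Term)
  | add (s t : Term)
  | sub (s t : Term)
  | eq (s t : Term)
  | lt (s t : Term)
  | ite (c s t : Term)
  | sum (x : ℕ) (r : Range) (t : Term)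

/-- The value of a term. -/
def Term.eval (m : Memory) : Term → (ℕ → ℕ) → ℕ
  | .const c, _ => c
  | .var x, v => v x
  | .input i, v => m 0 (i.eval m v)
  | .read a i, v => m (a + 6) (i.eval m v)
  | .add s t, v => s.eval m v + t.eval m v
  | .sub s t, v => s.eval m v - t.eval m v
  | .eq s t, v => if s.eval m v = t.eval m v then 1 else 0
  | .lt s t, v => if s.eval m v < t.eval m v then 1 else 0
  | .ite c s t, v => if c.eval m v ≠ 0 then s.eval m v else t.eval m v
  | .sum x r t, v => ∑ j ∈ Finset.range (m 0 r.cell), t.eval m (Function.update v x j)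

/-- Cell `d` of array `a`, as an expression. -/
abbrev cell (a d : ℕ) : Expr := .read a (.const d)

/-- Code that writes the value of a term to cell `d` of array `3`. Variables are kept in array `2`,
counters in array `4`, saved values of variables in array `5`. -/
def Term.code : Term → ℕ → Program
  | .const c, d => .write 3 (.const d) (.const c)
  | .var x, d => .write 3 (.const d) (cell 2 x)
  | .input i, d => .seq (i.code d) (.write 3 (.const d) (.read 0 (cell 3 d)))
  | .read a i, d => .seq (i.code d) (.write 3 (.const d) (.read (a + 6) (cell 3 d)))
  | .add s t, d => .seq (s.code d) (.seq (t.code (d + 1))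
      (.write 3 (.const d) (.add (cell 3 d) (cell 3 (d + 1)))))
  | .sub s t, d => .seq (s.code d) (.seq (t.code (d + 1))
      (.write 3 (.const d) (.sub (cell 3 d) (cell 3 (d + 1)))))
  | .eq s t, d => .seq (s.code d) (.seq (t.code (d + 1))
      (.write 3 (.const d) (.eq (cell 3 d) (cell 3 (d + 1)))))
  | .lt s t, d => .seq (s.code d) (.seq (t.code (d + 1))
      (.write 3 (.const d) (.lt (cell 3 d) (cell 3 (d + 1)))))
  | .ite c s t, d => .seq (c.code d) (.ite (cell 3 d) (s.code d) (t.code d))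
  | .sum x r t, d =>
    .seq (.write 5 (.const d) (cell 2 x)) <| .seq (.write 4 (.const d) (.const 0)) <|
    .seq (.write 3 (.const d) (.const 0)) <|
    .seq (.loop (.lt (cell 4 d) (cell 0 r.cell)) <|
      .seq (.write 2 (.const x) (cell 4 d)) <| .seq (t.code (d + 1)) <|
      .seq (.write 3 (.const d) (.add (cell 3 d) (cell 3 (d + 1))))
        (.write 4 (.const d) (.add (cell 4 d) (.const 1)))) <|
    .write 2 (.const x) (cell 5 d)

/-- Two memories agree except on the scratch cells from `d` on. -/
def Agree (d : ℕ) (m m' : Memory) : Prop :=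
  ∀ a j, (a = 3 ∨ a = 4 ∨ a = 5 → j < d) → m' a j = m a j

theorem Agree.trans {d : ℕ} {m₁ m₂ m₃ : Memory} (h : Agree d m₁ m₂) (h' : Agree d m₂ m₃) :
    Agree d m₁ m₃ := fun a j hj => (h' a j hj).trans (h a j hj)

theorem Agree.mono {d d' : ℕ} {m m' : Memory} (h : Agree d' m m') (hd : d ≤ d') :
    Agree d m m' := fun a j hj => h a j fun ha => (hj ha).trans_le hd

theorem Agree.array {d a : ℕ} {m m' : Memory} (h : Agree d m m')
    (ha : a ≠ 3 ∧ a ≠ 4 ∧ a ≠ 5) : m' a = m a :=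
  funext fun j => h a j (by omega)

theorem agree_set {d a i x : ℕ} (m : Memory) (ha : a = 3 ∨ a = 4 ∨ a = 5) (hi : d ≤ i) :
    Agree d m (m.set a i x) := by
  intro b j hj
  simp only [Memory.set]
  grind

/-- Terms read only array `0` and the arrays from `6` on, which compiled terms never touch. -/
theorem Term.eval_congr {m m' : Memory} (h0 : m' 0 = m 0) (h6 : ∀ a, m' (a + 6) = m (a + 6))
    (t : Term) (v : ℕ → ℕ) : t.eval m' v = t.eval m v := by
  induction t generalizing v <;> simp_all [Term.eval]

theorem Agree.eval {d : ℕ} {m m' : Memory} (h : Agree d m m') (t : Term) (v : ℕ → ℕ) :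
    t.eval m' v = t.eval m v :=
  t.eval_congr (h.array (by omega)) (fun a => h.array (by omega)) v

/-- Total correctness of a loop with an invariant indexed by the number of iterations. -/
theorem exec_loop {e : Expr} {p : Program} (I : ℕ → Memory → Prop) (B c : ℕ)
    (hstep : ∀ j < B, ∀ m, I j m → e.eval m ≠ 0 ∧ ∃ m' T, Exec p m m' T ∧ T ≤ c ∧ I (j + 1) m')
    (hend : ∀ m, I B m → e.eval m = 0) {m : Memory} (h0 : I 0 m) :
    ∃ m' T, Exec (.loop e p) m m' T ∧ T ≤ (B + 1) * (e.cost + 1 + c) ∧ I B m' := by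
  suffices h : ∀ r j, j + r = B → ∀ m, I j m →
      ∃ m' T, Exec (.loop e p) m m' T ∧ T ≤ (r + 1) * (e.cost + 1 + c) ∧ I B m' from
    h B 0 (by omega) m h0
  intro r
  induction r with
  | zero =>
    intro j hj m hm
    obtain rfl : j = B := by omega
    exact ⟨m, _, .loop_false (hend m hm), by omega, hm⟩
  | succ r ih =>
    intro j hj m hm
    obtain ⟨he, m', T, hx, hT, hm'⟩ := hstep j (by omega) m hm
    obtain ⟨m'', T', hx', hT', hm''⟩ := ih (j + 1) (by omega) m' hm'
    refine ⟨m'', _, .loop_true he hx hx', ?_, hm''⟩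
    have : (r + 1 + 1) * (e.cost + 1 + c) = (r + 1) * (e.cost + 1 + c) + (e.cost + 1 + c) := by
      ring
    omega

/-- What the code of a term achieves, within time `P N`. -/
def Term.Spec (t : Term) (P : Polynomial ℕ) : Prop :=
  ∀ (d N : ℕ) (m : Memory), m 0 0 ≤ N → m 0 1 ≤ N → ∃ m' T, Exec (t.code d) m m' T ∧
    T ≤ P.eval N ∧ Agree d m m' ∧ m' 3 d = t.eval m (m 2)

theorem Range.cell_le {r : Range} {m : Memory} {N : ℕ} (h0 : m 0 0 ≤ N) (h1 : m 0 1 ≤ N) :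
    m 0 r.cell ≤ N := by
  cases r <;> assumption

/-- The second operand is compiled one level deeper, so its code leaves the value of the first in
cell `d` of array `3` intact. -/
theorem Term.spec_binary {s t : Term} {P Q : Polynomial ℕ} (hs : s.Spec P) (ht : t.Spec Q)
    (d N : ℕ) (m : Memory) (h0 : m 0 0 ≤ N) (h1 : m 0 1 ≤ N) :
    ∃ m₁ m₂ T₁ T₂, Exec (s.code d) m m₁ T₁ ∧ Exec (t.code (d + 1)) m₁ m₂ T₂ ∧
      T₁ + T₂ ≤ (P + Q).eval N ∧ Agree d m m₂ ∧ m₂ 3 d = s.eval m (m 2) ∧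
      m₂ 3 (d + 1) = t.eval m (m 2) := by
  obtain ⟨m₁, T₁, hx₁, hT₁, ha₁, hv₁⟩ := hs d N m h0 h1
  have e0 := ha₁.array (a := 0) (by omega)
  have e2 := ha₁.array (a := 2) (by omega)
  obtain ⟨m₂, T₂, hx₂, hT₂, ha₂, hv₂⟩ := ht (d + 1) N m₁ (by rwa [e0]) (by rwa [e0])
  refine ⟨m₁, m₂, T₁, T₂, hx₁, hx₂, ?_, ha₁.trans (ha₂.mono (by omega)), ?_, ?_⟩
  · simp only [Polynomial.eval_add]; omega
  · rw [ha₂ 3 d (by omega), hv₁]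
  · rw [hv₂, ha₁.eval, e2]

/-- Induction on the term. The bounds in array `0` are never overwritten, so a loop makes at most
`N` rounds, and each nested sum costs one more factor `N + 1`. -/
theorem Term.exists_spec (t : Term) : ∃ P, t.Spec P := by
  induction t with
  | const c =>
    refine ⟨3, fun d N m _ _ => ⟨_, _, .write m 3 _ _, ?_, agree_set m (by simp) le_rfl, ?_⟩⟩
    · simp [Expr.cost]
    · simp [Memory.set, Expr.eval, Term.eval]
  | var x =>
    refine ⟨4, fun d N m _ _ => ⟨_, _, .write m 3 _ _, ?_, agree_set m (by simp) le_rfl, ?_⟩⟩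
    · simp [Expr.cost]
    · simp [Memory.set, Expr.eval, Term.eval]
  | input i ih =>
    obtain ⟨P, hP⟩ := ih
    refine ⟨P + 5, fun d N m h0 h1 => ?_⟩
    obtain ⟨m', T, hx, hT, ha, hv⟩ := hP d N m h0 h1
    refine ⟨_, _, .seq hx (.write m' 3 _ _), ?_, ha.trans (agree_set m' (by simp) le_rfl), ?_⟩
    · simp [Expr.cost]; omega
    · simp [Memory.set, Expr.eval, Term.eval, hv, ha.array (a := 0) (by omega)]
  | read a i ih =>
    obtain ⟨P, hP⟩ := ih
    refine ⟨P + 5, fun d N m h0 h1 => ?_⟩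
    obtain ⟨m', T, hx, hT, ha, hv⟩ := hP d N m h0 h1
    refine ⟨_, _, .seq hx (.write m' 3 _ _), ?_, ha.trans (agree_set m' (by simp) le_rfl), ?_⟩
    · simp [Expr.cost]; omega
    · simp [Memory.set, Expr.eval, Term.eval, hv, ha.array (a := a + 6) (by omega)]
  | add s t hs ht | sub s t hs ht | eq s t hs ht | lt s t hs ht =>
    obtain ⟨P, hP⟩ := hs
    obtain ⟨Q, hQ⟩ := ht
    refine ⟨P + Q + 7, fun d N m h0 h1 => ?_⟩
    obtain ⟨m₁, m₂, T₁, T₂, hx₁, hx₂, hT, ha, hs, ht⟩ := Term.spec_binary hP hQ d N m h0 h1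
    refine ⟨_, _, .seq hx₁ (.seq hx₂ (.write m₂ 3 _ _)), ?_,
      ha.trans (agree_set m₂ (by simp) le_rfl), ?_⟩
    · simp only [Polynomial.eval_add, Expr.cost, Polynomial.eval_ofNat] at hT ⊢; omega
    · simp [Memory.set, Expr.eval, Term.eval, hs, ht]
  | ite c s t hc hs ht =>
    obtain ⟨P, hP⟩ := hc
    obtain ⟨Q, hQ⟩ := hs
    obtain ⟨R, hR⟩ := ht
    refine ⟨P + Q + R + 3, fun d N m h0 h1 => ?_⟩
    obtain ⟨m₁, T₁, hx₁, hT₁, ha₁, hv₁⟩ := hP d N m h0 h1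
    have e0 := ha₁.array (a := 0) (by omega)
    have e2 := ha₁.array (a := 2) (by omega)
    by_cases hc : c.eval m (m 2) = 0
    · obtain ⟨m₂, T₂, hx₂, hT₂, ha₂, hv₂⟩ := hR d N m₁ (by rwa [e0]) (by rwa [e0])
      refine ⟨m₂, _, .seq hx₁ (.ite_false (by simp [Expr.eval, hv₁, hc]) hx₂), ?_,
        ha₁.trans ha₂, ?_⟩
      · simp [Expr.cost]; omega
      · simp [Term.eval, hc, hv₂, ha₁.eval, e2]
    · obtain ⟨m₂, T₂, hx₂, hT₂, ha₂, hv₂⟩ := hQ d N m₁ (by rwa [e0]) (by rwa [e0])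
      refine ⟨m₂, _, .seq hx₁ (.ite_true (by simp [Expr.eval, hv₁, hc]) hx₂), ?_,
        ha₁.trans ha₂, ?_⟩
      · simp [Expr.cost]; omega
      · simp [Term.eval, hc, hv₂, ha₁.eval, e2]
  | sum x r t ih =>
    obtain ⟨P, hP⟩ := ih
    -- At most `N + 1` tests of the loop condition, each with at most one run of the body; `40` and
    -- `20` generously cover the bookkeeping.
    refine ⟨(Polynomial.X + 1) * (P + 40) + 20, fun d N m h0 h1 => ?_⟩
    have hr : m 0 r.cell ≤ N := Range.cell_le h0 h1
    set m₁ := ((m.set 5 d (m 2 x)).set 4 d 0).set 3 d 0 with hm₁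
    -- Besides scratch cells from `d` on, only the loop variable may change; its old value waits in
    -- cell `d` of array `5` and is restored after the loop.
    let I : ℕ → Memory → Prop := fun j μ =>
      (∀ a i, (a = 3 ∨ a = 4 ∨ a = 5 → i < d) → (a = 2 → i ≠ x) → μ a i = m a i) ∧
      μ 5 d = m 2 x ∧ μ 4 d = j ∧
      μ 3 d = ∑ j ∈ Finset.range j, t.eval m (Function.update (m 2) x j)
    have hI0 : I 0 m₁ := by
      refine ⟨fun a i h h' => ?_, ?_, ?_, ?_⟩
      · simp only [hm₁, Memory.set]; grind
      all_goals simp [hm₁, Memory.set]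
    obtain ⟨m₂, T, hx, hT, hI⟩ := exec_loop (e := .lt (cell 4 d) (cell 0 r.cell))
      (p := .seq (.write 2 (.const x) (cell 4 d)) <| .seq (t.code (d + 1)) <|
        .seq (.write 3 (.const d) (.add (cell 3 d) (cell 3 (d + 1))))
          (.write 4 (.const d) (.add (cell 4 d) (.const 1)))) I (m 0 r.cell) (P.eval N + 30)
      (by
        rintro j hj μ ⟨hA, h5, h4, h3⟩
        refine ⟨by simp [Expr.eval, h4, hA 0 r.cell, hj], ?_⟩
        have hμ0 : ∀ i, μ.set 2 x j 0 i = m 0 i := fun i => by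
          simp [Memory.set, hA 0 i]
        obtain ⟨μ', T, hx, hT, hA', hv⟩ := hP (d + 1) N (μ.set 2 x j)
          (by rwa [hμ0]) (by rwa [hμ0])
        refine ⟨_, _, .seq (.write μ 2 _ _) (.seq (m' := μ') (T := T) ?_ (.seq (.write μ' 3 _ _)
          (.write _ 4 _ _))), ?_, ?_⟩
        · simpa [Expr.eval, h4] using hx
        · simp [Expr.cost]; omega
        · have hev : (μ.set 2 x j) 2 = Function.update (m 2) x j := by
            funext i
            by_cases hi : i = x
            · simp [hi, Memory.set]
            · simp [hi, Memory.set, Function.update, hA 2 i (by omega) (fun _ => hi)]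
          have hv' : μ' 3 (d + 1) = t.eval m (Function.update (m 2) x j) := by
            rw [hv, hev]
            exact t.eval_congr (funext hμ0) (fun a => funext fun i => by
              simp [Memory.set, hA (a + 6) i]) _
          have k5 : μ' 5 d = m 2 x := by
            rw [hA' 5 d (by omega), ← h5]; simp [Memory.set]
          have k4 : μ' 4 d = j := by
            rw [hA' 4 d (by omega), ← h4]; simp [Memory.set]
          have k3 : μ' 3 d = ∑ j ∈ Finset.range j, t.eval m (Function.update (m 2) x j) := by
            rw [hA' 3 d (by omega), ← h3]; simp [Memory.set]
          refine ⟨fun a i h h' => ?_, ?_, ?_, ?_⟩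
          · have h1 : μ' a i = m a i := by
              rw [hA' a i (by omega), ← hA a i h h']
              simp only [Memory.set]; grind
            simp only [Memory.set, Expr.eval]
            grind
          · simp [Memory.set, k5]
          · simp [Memory.set, Expr.eval, k4]
          · simp [Memory.set, Expr.eval, k3, hv', Finset.sum_range_succ])
      (by
        rintro μ ⟨hA, h5, h4, h3⟩
        simp [Expr.eval, h4, hA 0 r.cell]) hI0
    obtain ⟨hA, h5, h4, h3⟩ := hI
    refine ⟨m₂.set 2 x (m 2 x), _, .seq (.write m 5 _ _) (.seq (.write _ 4 _ _)
      (.seq (.write _ 3 _ _) (.seq (m' := m₂) (T := T) (T' := 4) ?_ ?_))), ?_, ?_, ?_⟩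
    · simpa [Expr.eval, hm₁] using hx
    · have := Exec.write m₂ 2 (.const x) (cell 5 d)
      simp only [Expr.eval, h5, Expr.cost] at this
      exact this
    · have hT' : T ≤ (N + 1) * (P.eval N + 40) :=
        hT.trans (Nat.mul_le_mul (by omega) (by simp [Expr.cost]; omega))
      simp [Expr.cost]
      omega
    · intro a i h
      simp only [Memory.set]
      split_ifs with h'
      · rw [h'.1, h'.2]
      · exact hA a i h (by tauto)
    · simp [Memory.set, h3, Term.eval]

/-! ### Commands and their compilation -/

/-- Commands. Array `1` is the output, and the arrays from `6` on are work arrays. -/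
inductive Command
  | output (i e : Term)
  | write (a : ℕ) (i e : Term)
  | seq (p q : Command)
  | ite (c : Term) (p q : Command)
  | loop (x : ℕ) (r : Range) (p : Command)

/-- The effect of a command. -/
def Command.run : Command → (ℕ → ℕ) → Memory → Memory
  | .output i e, v, m => m.set 1 (i.eval m v) (e.eval m v)
  | .write a i e, v, m => m.set (a + 6) (i.eval m v) (e.eval m v)
  | .seq p q, v, m => q.run v (p.run v m)
  | .ite c p q, v, m => if c.eval m v ≠ 0 then p.run v m else q.run v m
  | .loop x r p, v, m =>
    (List.range (m 0 r.cell)).foldl (fun m j => p.run (Function.update v x j) m) m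

/-- The code of a command. -/
def Command.code : Command → ℕ → Program
  | .output i e, d => .seq (i.code d) (.seq (e.code (d + 1))
      (.write 1 (cell 3 d) (cell 3 (d + 1))))
  | .write a i e, d => .seq (i.code d) (.seq (e.code (d + 1))
      (.write (a + 6) (cell 3 d) (cell 3 (d + 1))))
  | .seq p q, d => .seq (p.code d) (q.code d)
  | .ite c p q, d => .seq (c.code d) (.ite (cell 3 d) (p.code d) (q.code d))
  | .loop x r p, d =>
    .seq (.write 5 (.const d) (cell 2 x)) <| .seq (.write 4 (.const d) (.const 0)) <|
    .seq (.loop (.lt (cell 4 d) (cell 0 r.cell)) <|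
      .seq (.write 2 (.const x) (cell 4 d)) <| .seq (p.code (d + 1)) <|
        (.write 4 (.const d) (.add (cell 4 d) (.const 1)))) <|
    .write 2 (.const x) (cell 5 d)

/-- Invariants of loops. -/
theorem foldl_range_induction {α : Type*} (f : α → ℕ → α) (B : ℕ) (I : ℕ → α → Prop) {m : α}
    (h0 : I 0 m) (hstep : ∀ j < B, ∀ m, I j m → I (j + 1) (f m j)) :
    I B ((List.range B).foldl f m) := by
  induction B with
  | zero => simpa
  | succ B ih =>
    rw [List.range_succ, List.foldl_append]
    exact hstep B (by omega) _ (ih fun j hj => hstep j (by omega))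

/-- Commands write only to array `1` and to arrays from `6` on, so all loop bounds stay fixed during
a run. -/
theorem Command.run_zero (p : Command) (v : ℕ → ℕ) (m : Memory) : p.run v m 0 = m 0 := by
  induction p generalizing v m with
  | output i e => funext j; simp [run, Memory.set]
  | write a i e => funext j; simp [run, Memory.set]
  | seq p q hp hq => simp [run, hp, hq]
  | ite c p q hp hq => simp only [run]; split_ifs <;> simp [hp, hq]
  | loop x r p hp =>
    refine foldl_range_induction _ _ (fun _ (m' : Memory) => m' 0 = m 0) rfl fun j _ m' h => ?_
    rw [hp, h]

/-- The memory `m` of the machine represents the abstract memory `M`. -/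
def Models (m M : Memory) : Prop := ∀ a, a < 2 ∨ 6 ≤ a → m a = M a

theorem Models.eval {m M : Memory} (h : Models m M) (t : Term) (v : ℕ → ℕ) :
    t.eval m v = t.eval M v :=
  t.eval_congr (h 0 (by omega)) (fun a => h _ (by omega)) v

theorem Models.agree {m m' M : Memory} {d : ℕ} (h : Models m M) (h' : Agree d m m') :
    Models m' M := fun a ha => (h'.array (by omega)).trans (h a ha)

theorem Models.set {m M : Memory} (h : Models m M) (a i x : ℕ) :
    Models (m.set a i x) (M.set a i x) := by
  intro b hb
  funext j
  simp only [Memory.set, h b hb]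

/-- What the code of a command achieves, within time `P N`. -/
def Command.Spec (p : Command) (P : Polynomial ℕ) : Prop :=
  ∀ (d N : ℕ) (m M : Memory), Models m M → m 0 0 ≤ N → m 0 1 ≤ N →
    ∃ m' T, Exec (p.code d) m m' T ∧ T ≤ P.eval N ∧ Models m' (p.run (m 2) M) ∧ m' 2 = m 2 ∧
      ∀ a j, a = 3 ∨ a = 4 ∨ a = 5 → j < d → m' a j = m a j

/-- As for terms, every loop multiplies the time by at most `N + 1`, and the nesting depth is a
constant of the command. Counters and saved variables are indexed by the depth `d`, so inner loops
do not disturb outer ones. -/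
theorem Command.exists_spec (p : Command) : ∃ P, p.Spec P := by
  induction p with
  | output i e | write a i e =>
    obtain ⟨P, hP⟩ := i.exists_spec
    obtain ⟨Q, hQ⟩ := e.exists_spec
    refine ⟨P + Q + 5, fun d N m M hM h0 h1 => ?_⟩
    obtain ⟨m₁, m₂, T₁, T₂, hx₁, hx₂, hT, ha, hs, ht⟩ := Term.spec_binary hP hQ d N m h0 h1
    refine ⟨_, _, .seq hx₁ (.seq hx₂ (.write m₂ _ _ _)), ?_, ?_, ?_, ?_⟩
    · simp only [Polynomial.eval_add, Expr.cost, Polynomial.eval_ofNat] at hT ⊢; omega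
    · simp only [Command.run, Expr.eval, hs, ht, hM.eval]
      exact (hM.agree ha).set _ _ _
    · funext j
      simp [Memory.set, ha.array (a := 2) (by omega)]
    · intro b j hb hj
      simp only [Memory.set, ← ha b j (fun _ => hj)]
      grind
  | seq p q hp hq =>
    obtain ⟨P, hP⟩ := hp
    obtain ⟨Q, hQ⟩ := hq
    refine ⟨P + Q, fun d N m M hM h0 h1 => ?_⟩
    obtain ⟨m₁, T₁, hx₁, hT₁, hM₁, h2, hd₁⟩ := hP d N m M hM h0 h1
    have e0 : m₁ 0 = m 0 := by
      rw [hM₁ 0 (by omega), Command.run_zero, hM 0 (by omega)]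
    obtain ⟨m₂, T₂, hx₂, hT₂, hM₂, h2', hd₂⟩ := hQ d N m₁ _ hM₁ (by rwa [e0]) (by rwa [e0])
    refine ⟨m₂, _, .seq hx₁ hx₂, ?_, ?_, h2'.trans h2,
      fun a j ha hj => (hd₂ a j ha hj).trans (hd₁ a j ha hj)⟩
    · simp only [Polynomial.eval_add]; omega
    · rw [h2] at hM₂; exact hM₂
  | ite c p q hp hq =>
    obtain ⟨R, hR⟩ := c.exists_spec
    obtain ⟨P, hP⟩ := hp
    obtain ⟨Q, hQ⟩ := hq
    refine ⟨R + P + Q + 3, fun d N m M hM h0 h1 => ?_⟩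
    obtain ⟨m₁, T₁, hx₁, hT₁, ha₁, hv₁⟩ := hR d N m h0 h1
    have e0 := ha₁.array (a := 0) (by omega)
    have e2 := ha₁.array (a := 2) (by omega)
    by_cases hc : c.eval m (m 2) = 0
    · obtain ⟨m₂, T₂, hx₂, hT₂, hM₂, h2, hd₂⟩ :=
        hQ d N m₁ M (hM.agree ha₁) (by rwa [e0]) (by rwa [e0])
      refine ⟨m₂, _, .seq hx₁ (.ite_false (by simp [Expr.eval, hv₁, hc]) hx₂), ?_, ?_,
        h2.trans e2, fun a j ha hj => (hd₂ a j ha hj).trans (ha₁ a j fun _ => hj)⟩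
      · simp [Expr.cost]; omega
      · simpa [Command.run, ← hM.eval, hc, e2] using hM₂
    · obtain ⟨m₂, T₂, hx₂, hT₂, hM₂, h2, hd₂⟩ :=
        hP d N m₁ M (hM.agree ha₁) (by rwa [e0]) (by rwa [e0])
      refine ⟨m₂, _, .seq hx₁ (.ite_true (by simp [Expr.eval, hv₁, hc]) hx₂), ?_, ?_,
        h2.trans e2, fun a j ha hj => (hd₂ a j ha hj).trans (ha₁ a j fun _ => hj)⟩
      · simp [Expr.cost]; omega
      · simpa [Command.run, ← hM.eval, hc, e2] using hM₂
  | loop x r p ih =>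
    obtain ⟨P, hP⟩ := ih
    refine ⟨(Polynomial.X + 1) * (P + 40) + 20, fun d N m M hM h0 h1 => ?_⟩
    have hr : m 0 r.cell ≤ N := Range.cell_le h0 h1
    have hr' : m 0 r.cell = M 0 r.cell := by rw [hM 0 (by omega)]
    set m₁ := ((m.set 5 d (m 2 x)).set 4 d 0) with hm₁
    let I : ℕ → Memory → Prop := fun j μ =>
      (∀ a i, a = 3 ∨ a = 4 ∨ a = 5 → i < d → μ a i = m a i) ∧
      (∀ i, i ≠ x → μ 2 i = m 2 i) ∧
      μ 5 d = m 2 x ∧ μ 4 d = j ∧ μ 0 = m 0 ∧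
      Models μ ((List.range j).foldl (fun M j => p.run (Function.update (m 2) x j) M) M)
    have hI0 : I 0 m₁ := by
      refine ⟨fun a i h h' => ?_, fun i hi => ?_, ?_, ?_, ?_, ?_⟩
      · simp only [hm₁, Memory.set]; grind
      · simp [hm₁, Memory.set]
      · simp [hm₁, Memory.set]
      · simp [hm₁, Memory.set]
      · funext i; simp [hm₁, Memory.set]
      · intro a ha
        rw [List.range_zero, List.foldl_nil, ← hM a ha]
        funext i
        simp only [hm₁, Memory.set]; grind
    obtain ⟨m₂, T, hx, hT, hI⟩ := exec_loop (e := .lt (cell 4 d) (cell 0 r.cell))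
      (p := .seq (.write 2 (.const x) (cell 4 d)) <| .seq (p.code (d + 1)) <|
          (.write 4 (.const d) (.add (cell 4 d) (.const 1)))) I (m 0 r.cell) (P.eval N + 30)
      (by
        rintro j hj μ ⟨hs, h2, h5, h4, hz, hMo⟩
        refine ⟨by simp [Expr.eval, h4, hz, hj], ?_⟩
        have hμ0 : ∀ i, μ.set 2 x j 0 i = m 0 i := fun i => by
          simp [Memory.set, hz]
        have hev : (μ.set 2 x j) 2 = Function.update (m 2) x j := by
          funext i
          by_cases hi : i = x
          · simp [hi, Memory.set]
          · simp [hi, Memory.set, Function.update, h2 i hi]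
        obtain ⟨μ', T, hx, hT, hM', h2', hs'⟩ := hP (d + 1) N (μ.set 2 x j) _
          (fun a ha => (by funext i; simp only [Memory.set]; grind :
            (μ.set 2 x j) a = μ a).trans (hMo a ha)) (by rwa [hμ0]) (by rwa [hμ0])
        refine ⟨_, _, .seq (.write μ 2 _ _) (.seq (m' := μ') (T := T) ?_ (.write μ' 4 _ _)), ?_, ?_⟩
        · simpa [Expr.eval, h4] using hx
        · simp [Expr.cost]; omega
        · have k5 : μ' 5 d = m 2 x := by
            rw [hs' 5 d (by omega) (by omega), ← h5]; simp [Memory.set]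
          have k4 : μ' 4 d = j := by
            rw [hs' 4 d (by omega) (by omega), ← h4]; simp [Memory.set]
          refine ⟨fun a i h h' => ?_, fun i hi => ?_, ?_, ?_, ?_, ?_⟩
          · have h1 : μ' a i = m a i := by
              rw [hs' a i h (by omega), ← hs a i h h']
              simp only [Memory.set]; grind
            simp only [Memory.set, Expr.eval]
            grind
          · simp [Memory.set, h2', h2 i hi, hi]
          · simp [Memory.set, k5]
          · simp [Memory.set, Expr.eval, k4]
          · have : μ' 0 = m 0 := by
              rw [hM' 0 (by omega), Command.run_zero, ← hMo 0 (by omega), hz]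
            funext i
            simp [Memory.set, this]
          · rw [List.range_succ, List.foldl_append, List.foldl_cons, List.foldl_nil, ← hev]
            intro a ha
            rw [← hM' a ha]
            funext i
            simp only [Memory.set]; grind)
      (by
        rintro μ ⟨hs, h2, h5, h4, hz, hMo⟩
        simp [Expr.eval, h4, hz]) hI0
    obtain ⟨hs, h2, h5, h4, hz, hMo⟩ := hI
    refine ⟨m₂.set 2 x (m 2 x), _, .seq (.write m 5 _ _) (.seq (.write _ 4 _ _)
      (.seq (m' := m₂) (T := T) (T' := 4) ?_ ?_)), ?_, ?_, ?_, ?_⟩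
    · simpa [Expr.eval, hm₁] using hx
    · have := Exec.write m₂ 2 (.const x) (cell 5 d)
      simp only [Expr.eval, h5, Expr.cost] at this
      exact this
    · have hT' : T ≤ (N + 1) * (P.eval N + 40) :=
        hT.trans (Nat.mul_le_mul (by omega) (by simp [Expr.cost]; omega))
      simp [Expr.cost]
      omega
    · intro a ha
      rw [Command.run, ← hr', ← hMo a ha]
      funext i
      simp only [Memory.set]; grind
    · funext i
      simp only [Memory.set]
      split_ifs with h'
      · rw [h'.2]
      · exact h2 i (by tauto)
    · intro a i h h'
      simp only [Memory.set]
      rw [if_neg (by omega)]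
      exact hs a i h h'

/-- Every command yields a polynomial-time program. -/
theorem Command.exists_program (p : Command) : ∃ (A : Program) (P : Polynomial ℕ),
    ∀ (w w' : List ℕ) (N : ℕ), w.getD 0 0 ≤ N → w.getD 1 0 ≤ N →
      (∀ (i : ℕ) (hi : i < w'.length), p.run (fun _ => 0) (RAM.input w) 1 i = w'[i]) →
      OutputsWithin A w w' (P.eval N) := by
  obtain ⟨P, hP⟩ := p.exists_spec
  refine ⟨p.code 0, P, fun w w' N h0 h1 h => ?_⟩
  obtain ⟨m', T, hx, hT, hM, -, -⟩ := hP 0 N (RAM.input w) (RAM.input w) (fun _ _ => rfl)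
    (by simpa [RAM.input] using h0) (by simpa [RAM.input] using h1)
  refine ⟨m', T, hx, hT, fun i hi => ?_⟩
  rw [hM 1 (by omega), ← h i hi]
  rfl

end RAM

/-! ### Routing in a complete graph -/

section CliqueRouting

open Finset

/-- An injection between finsets that need not be total outside. -/
theorem Finset.exists_injOn_mapsTo {α β : Type*} [Nonempty β] {s : Finset α} {t : Finset β}
    (h : s.card ≤ t.card) : ∃ f : α → β, (∀ x ∈ s, f x ∈ t) ∧ Set.InjOn f s := by
  classical
  have hc : Fintype.card s ≤ Fintype.card t := by simpa using h
  obtain ⟨f⟩ := Function.Embedding.nonempty_of_card_le hc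
  refine ⟨fun x => if hx : x ∈ s then f ⟨x, hx⟩ else Classical.arbitrary β, fun x hx => ?_, ?_⟩
  · simp [hx]
  · intro x hx y hy hxy
    simp only [Finset.mem_coe] at hx hy
    simpa [hx, hy] using hxy

/-- Simultaneous injections into two finsets that agree as often as possible. -/
theorem Finset.exists_two_injOn {α β : Type*} [Nonempty β] [DecidableEq β] {s : Finset α}
    {t t' : Finset β} (h : s.card ≤ t.card) (h' : s.card ≤ t'.card) :
    ∃ u u' : α → β, (∀ x ∈ s, u x ∈ t) ∧ (∀ x ∈ s, u' x ∈ t') ∧ Set.InjOn u s ∧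
      Set.InjOn u' s ∧ ∀ x ∈ s, u x = u' x ∨ u x ∉ t' ∧ u' x ∉ t := by
  classical
  -- If the intersection has room for all of `s`, a single injection serves as both.
  rcases le_total s.card (t ∩ t').card with hs | hs
  · obtain ⟨f, hf, hi⟩ := exists_injOn_mapsTo hs
    exact ⟨f, f, fun x hx => (mem_inter.1 (hf x hx)).1, fun x hx => (mem_inter.1 (hf x hx)).2,
      hi, hi, fun _ _ => .inl rfl⟩
  -- Otherwise a part `s₁` fills the intersection under both maps, and the rest goes to the two
  -- differences, which are large enough because `s` fits into `t` and into `t'`.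
  · obtain ⟨s₁, hs₁, hc⟩ := exists_subset_card_eq hs
    have h1 := card_sdiff_add_card_inter t t'
    have h2 := card_sdiff_add_card_inter t' t
    rw [inter_comm] at h2
    have h3 := card_sdiff_add_card_eq_card hs₁
    obtain ⟨f, hf, hfi⟩ := exists_injOn_mapsTo hc.le
    obtain ⟨g, hg, hgi⟩ := exists_injOn_mapsTo (s := s \ s₁) (t := t \ t') (by omega)
    obtain ⟨g', hg', hgi'⟩ := exists_injOn_mapsTo (s := s \ s₁) (t := t' \ t) (by omega)
    simp only [mem_inter, mem_sdiff] at hf hg hg'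
    refine ⟨fun x => if x ∈ s₁ then f x else g x, fun x => if x ∈ s₁ then f x else g' x,
      ?_, ?_, ?_, ?_, ?_⟩
    · intro x hx; grind
    · intro x hx; grind
    · intro x hx y hy hxy
      simp only [Set.InjOn, mem_coe, mem_sdiff] at *
      grind
    · intro x hx y hy hxy
      simp only [Set.InjOn, mem_coe, mem_sdiff] at *
      grind
    · intro x hx; grind

/-- Representatives of slots. Every slot has a home in `Q`; there are two distinguished kinds `A`
and `B` of slots. Slots with the same representative are of different kinds and represented by their
common home. -/
theorem exists_representatives {S V : Type*} [DecidableEq S] [DecidableEq V] (T A B : Finset S)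
    (Q : Finset V) (h : S → V) (hA : A ⊆ T) (hB : B ⊆ T)
    (hQ : ∀ σ ∈ T, h σ ∈ Q) (hc : T.card ≤ Q.card) :
    ∃ r : S → V, (∀ σ ∈ T, r σ ∈ Q) ∧
      (∀ σ ∈ T, ∀ τ ∈ T, r σ = r τ → σ = τ ∨ r σ = h σ ∧ r σ = h τ ∧
        (σ ∈ A ∧ τ ∈ B ∨ σ ∈ B ∧ τ ∈ A)) ∧
      (∀ σ ∈ T, r σ ≠ h σ → ∀ τ ∈ T, r σ ≠ h τ) ∧
      (∀ σ ∈ A, ∀ τ ∈ B, h σ = h τ → r σ = h σ → ∃ τ' ∈ B, r τ' = h σ) ∧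
      ∀ σ ∈ A, ∀ τ ∈ B, h σ = h τ → r τ = h τ → ∃ σ' ∈ A, r σ' = h τ := by
  classical
  rcases T.eq_empty_or_nonempty with rfl | ⟨σ₀, hσ₀⟩
  · obtain rfl := subset_empty.1 hA
    exact ⟨h, by simp⟩
  have : Nonempty V := ⟨h σ₀⟩
  -- The function selects one slot of `K` at every home of a slot of `K`.
  have choice : ∀ K : Finset S, ∃ f : V → S, ∀ σ ∈ K, f (h σ) ∈ K ∧ h (f (h σ)) = h σ := by
    intro K
    refine ⟨fun x => if hx : ∃ σ ∈ K, h σ = x then hx.choose else σ₀, fun σ hσ => ?_⟩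
    have hx : ∃ τ ∈ K, h τ = h σ := ⟨σ, hσ, rfl⟩
    simp only [hx, dif_pos]
    exact hx.choose_spec
  obtain ⟨fA, hfA⟩ := choice A
  obtain ⟨fB, hfB⟩ := choice B
  obtain ⟨fT, hfT⟩ := choice T
  -- The slots that stay at home: at each home the selected slot of `A` and the selected slot of
  -- `B`, or one arbitrary slot if neither kind occurs there.
  set M : Finset S := T.filter fun σ => (σ ∈ A ∧ σ = fA (h σ)) ∨ (σ ∈ B ∧ σ = fB (h σ)) ∨
    (σ = fT (h σ) ∧ ∀ τ ∈ T, h τ = h σ → τ ∉ A ∧ τ ∉ B) with hM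
  have hMT : M ⊆ T := filter_subset _ _
  have hhome : T.image h ⊆ M.image h := by
    intro x hx
    obtain ⟨σ, hσ, rfl⟩ := mem_image.1 hx
    rw [mem_image]
    by_cases h1 : ∃ τ ∈ A, h τ = h σ
    · obtain ⟨τ, hτ, e⟩ := h1
      refine ⟨fA (h τ), ?_, by rw [(hfA τ hτ).2, e]⟩
      rw [hM, mem_filter]
      exact ⟨hA (hfA τ hτ).1, .inl ⟨(hfA τ hτ).1, by rw [(hfA τ hτ).2]⟩⟩
    by_cases h2 : ∃ τ ∈ B, h τ = h σ
    · obtain ⟨τ, hτ, e⟩ := h2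
      refine ⟨fB (h τ), ?_, by rw [(hfB τ hτ).2, e]⟩
      rw [hM, mem_filter]
      exact ⟨hB (hfB τ hτ).1, .inr (.inl ⟨(hfB τ hτ).1, by rw [(hfB τ hτ).2]⟩)⟩
    refine ⟨fT (h σ), ?_, (hfT σ hσ).2⟩
    rw [hM, mem_filter]
    refine ⟨(hfT σ hσ).1, .inr (.inr ⟨by rw [(hfT σ hσ).2], fun τ hτ e => ?_⟩)⟩
    rw [(hfT σ hσ).2] at e
    exact ⟨fun hτ => h1 ⟨τ, hτ, e⟩, fun hτ => h2 ⟨τ, hτ, e⟩⟩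
  have hhQ : T.image h ⊆ Q := image_subset_iff.2 hQ
  have c1 : (T.image h).card ≤ M.card := (card_le_card hhome).trans card_image_le
  have c2 := card_sdiff_add_card_eq_card hMT
  have c3 := card_sdiff_add_card_eq_card hhQ
  -- Every home keeps a slot, so `T.card ≤ Q.card` leaves enough vertices of `Q` that are nobody's
  -- home for the slots that move.
  obtain ⟨f, hf, hfi⟩ := exists_injOn_mapsTo (s := T \ M) (t := Q \ T.image h) (by omega)
  have hMmem : ∀ σ, σ ∈ M ↔ σ ∈ T ∧ ((σ ∈ A ∧ σ = fA (h σ)) ∨ (σ ∈ B ∧ σ = fB (h σ)) ∨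
    (σ = fT (h σ) ∧ ∀ τ ∈ T, h τ = h σ → τ ∉ A ∧ τ ∉ B)) := fun σ => by rw [hM, mem_filter]
  have hf1 : ∀ σ ∈ T, σ ∉ M → f σ ∈ Q ∧ ∀ τ ∈ T, f σ ≠ h τ := by
    intro σ hσ hσM
    have := hf σ (mem_sdiff.2 ⟨hσ, hσM⟩)
    rw [mem_sdiff] at this
    exact ⟨this.1, fun τ hτ e => this.2 (e ▸ mem_image_of_mem h hτ)⟩
  have hf2 : ∀ σ ∈ T, σ ∉ M → ∀ τ ∈ T, τ ∉ M → f σ = f τ → σ = τ :=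
    fun σ hσ hσM τ hτ hτM e => hfi (mem_coe.2 (mem_sdiff.2 ⟨hσ, hσM⟩))
      (mem_coe.2 (mem_sdiff.2 ⟨hτ, hτM⟩)) e
  clear_value M
  clear hM hhome c1 c2 c3 hf hfi
  refine ⟨fun σ => if σ ∈ M then h σ else f σ, ?_, ?_, ?_, ?_, ?_⟩
  · intro σ hσ
    beta_reduce
    split_ifs with h1
    · exact hQ σ hσ
    · exact (hf1 σ hσ h1).1
  · intro σ hσ τ hτ e
    beta_reduce at e ⊢
    by_cases h1 : σ ∈ M <;> by_cases h2 : τ ∈ M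
    · simp only [h1, h2, if_true] at e ⊢
      rcases ((hMmem σ).1 h1).2 with a | a | a <;> rcases ((hMmem τ).1 h2).2 with b | b | b
      · left; rw [a.2, b.2, e]
      · exact .inr ⟨trivial, e, .inl ⟨a.1, b.1⟩⟩
      · exact absurd a.1 (b.2 σ hσ e).1
      · exact .inr ⟨trivial, e, .inr ⟨a.1, b.1⟩⟩
      · left; rw [a.2, b.2, e]
      · exact absurd a.1 (b.2 σ hσ e).2
      · exact absurd b.1 (a.2 τ hτ e.symm).1
      · exact absurd b.1 (a.2 τ hτ e.symm).2
      · left; rw [a.1, b.1, e]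
    · simp only [h1, h2, if_true, if_false] at e
      exact absurd e.symm ((hf1 τ hτ h2).2 σ hσ)
    · simp only [h1, h2, if_true, if_false] at e
      exact absurd e ((hf1 σ hσ h1).2 τ hτ)
    · simp only [h1, h2, if_false] at e
      exact .inl (hf2 σ hσ h1 τ hτ h2 e)
  · intro σ hσ
    beta_reduce
    split_ifs with h1
    · exact fun h => absurd rfl h
    · exact fun _ => (hf1 σ hσ h1).2
  · intro σ hσ τ hτ e _
    have h1 := hfB τ hτ
    refine ⟨fB (h τ), h1.1, ?_⟩
    beta_reduce
    rw [if_pos, h1.2, e]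
    exact (hMmem _).2 ⟨hB h1.1, .inr (.inl ⟨h1.1, by rw [h1.2]⟩)⟩
  · intro σ hσ τ hτ e _
    have h1 := hfA σ hσ
    refine ⟨fA (h σ), h1.1, ?_⟩
    beta_reduce
    rw [if_pos, h1.2, e]
    exact (hMmem _).2 ⟨hA h1.1, .inl ⟨h1.1, by rw [h1.2]⟩⟩

set_option maxHeartbeats 1000000 in
/-- Routing in a complete graph on `insert c (insert c' Q)`. If at most `Q.card` terminals that have
to be connected to another vertex lie in `Q`, then the obvious necessary condition at `c` and `c'`
suffices. -/
theorem exists_clique_routing {ι V : Type*} [Fintype ι] [DecidableEq V] (Q : Finset V) (c c' : V)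
    (hcc : c ≠ c') (hcQ : c ∉ Q) (hcQ' : c' ∉ Q) (g : ι → Bool → V)
    (hg : ∀ i b, g i b = c ∨ g i b = c' ∨ g i b ∈ Q)
    (hQ : (univ.filter fun σ : ι × Bool => g σ.1 σ.2 ∈ Q ∧ g σ.1 σ.2 ≠ g σ.1 (!σ.2)).card ≤ Q.card)
    (hc : (univ.filter fun i => ¬ (g i false = c ↔ g i true = c)).card ≤ Q.card + 1)
    (hc' : (univ.filter fun i => ¬ (g i false = c' ↔ g i true = c')).card ≤ Q.card + 1) :
    ∃ F : ι → SimpleGraph V,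
      (∀ i x y, (F i).Adj x y → x ∈ insert c (insert c' Q) ∧ y ∈ insert c (insert c' Q)) ∧
      (∀ i j x y, (F i).Adj x y → (F j).Adj x y → i = j) ∧
      ∀ i, (F i).Reachable (g i false) (g i true) := by
  classical
  -- A slot is an end in `Q` of a pair with distinct ends. Its route goes from its home to its
  -- representative, and from there to `c` (kind `A`), to `c'` (kind `B`), or to the representative
  -- of the other slot of the pair.
  set S := univ.filter fun σ : ι × Bool => g σ.1 σ.2 ∈ Q ∧ g σ.1 σ.2 ≠ g σ.1 (!σ.2) with hS
  set A := S.filter fun σ => g σ.1 (!σ.2) = c with hA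
  set B := S.filter fun σ => g σ.1 (!σ.2) = c' with hB
  have mS : ∀ σ, σ ∈ S ↔ g σ.1 σ.2 ∈ Q ∧ g σ.1 σ.2 ≠ g σ.1 (!σ.2) := by simp [hS]
  have mA : ∀ σ, σ ∈ A ↔ g σ.1 σ.2 ∈ Q ∧ g σ.1 (!σ.2) = c := by
    intro σ
    simp only [hA, mem_filter, mS]
    constructor
    · rintro ⟨⟨h, -⟩, h'⟩; exact ⟨h, h'⟩
    · rintro ⟨h, h'⟩; exact ⟨⟨h, fun e => hcQ (h' ▸ e ▸ h)⟩, h'⟩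
  have mB : ∀ σ, σ ∈ B ↔ g σ.1 σ.2 ∈ Q ∧ g σ.1 (!σ.2) = c' := by
    intro σ
    simp only [hB, mem_filter, mS]
    constructor
    · rintro ⟨⟨h, -⟩, h'⟩; exact ⟨h, h'⟩
    · rintro ⟨h, h'⟩; exact ⟨⟨h, fun e => hcQ' (h' ▸ e ▸ h)⟩, h'⟩
  have hAS : A ⊆ S := filter_subset _ _
  have hBS : B ⊆ S := filter_subset _ _
  set P := univ.filter fun i => g i false = c ∧ g i true = c' ∨ g i false = c' ∧ g i true = c with hP
  have mP : ∀ i, i ∈ P ↔ g i false = c ∧ g i true = c' ∨ g i false = c' ∧ g i true = c := by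
    simp [hP]
  -- A pair has exactly one end at `d` if it joins `d` to `Q` or to `d'`. The former pairs
  -- correspond to the slots of `K`, the latter form `P`.
  have count : ∀ (d d' : V) (K : Finset (ι × Bool)), d ≠ d' → d ∉ Q → d' ∉ Q →
      (∀ σ, σ ∈ K ↔ g σ.1 σ.2 ∈ Q ∧ g σ.1 (!σ.2) = d) →
      (∀ i, i ∈ P ↔ g i false = d ∧ g i true = d' ∨ g i false = d' ∧ g i true = d) →
      (univ.filter fun i => ¬ (g i false = d ↔ g i true = d)).card ≤ Q.card + 1 →
      K.card + P.card ≤ Q.card + 1 := by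
    intro d d' K hd hdQ hdQ' mK mP' hcard
    have hinj : Set.InjOn Prod.fst (K : Set (ι × Bool)) := by
      rintro ⟨i, b⟩ hσ ⟨j, b'⟩ hτ e
      obtain rfl : i = j := e
      rw [mem_coe, mK] at hσ hτ
      cases b <;> cases b' <;> grind
    rw [← card_image_of_injOn hinj, ← card_union_of_disjoint]
    · refine (card_le_card fun i hi => ?_).trans hcard
      rw [mem_union] at hi
      rw [mem_filter]
      refine ⟨mem_univ _, ?_⟩
      rcases hi with hi | hi
      · obtain ⟨⟨j, b⟩, hσ, rfl⟩ := mem_image.1 hi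
        rw [mK] at hσ
        cases b <;> grind
      · rw [mP'] at hi; grind
    · rw [Finset.disjoint_left]
      intro i hi hi'
      obtain ⟨⟨j, b⟩, hσ, rfl⟩ := mem_image.1 hi
      rw [mK] at hσ
      rw [mP'] at hi'
      cases b <;> grind
  have cA := count c c' A hcc hcQ hcQ' mA mP hc
  have cB := count c' c B hcc.symm hcQ' hcQ mB (fun i => (mP i).trans (by tauto)) hc'
  obtain ⟨r, rQ, r1, r2, r3, r4⟩ := exists_representatives S A B Q (fun σ => g σ.1 σ.2) hAS hBS
    (fun σ h => ((mS σ).1 h).1) hQ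
  -- One pair of `P` takes the edge between `c` and `c'`. This absorbs the `+ 1` in `count`, so the
  -- others find free vertices of `Q`.
  obtain ⟨P', hP'P, hP1, hP2⟩ : ∃ P' ⊆ P, P'.card = P.card - 1 ∧
      ∀ i ∈ P, ∀ j ∈ P, i ∉ P' → j ∉ P' → i = j := by
    rcases P.eq_empty_or_nonempty with h | ⟨i₀, hi₀⟩
    · exact ⟨∅, by simp [h]⟩
    · exact ⟨P.erase i₀, erase_subset _ _, card_erase_of_mem hi₀, by grind⟩
  have imA : A.image r ⊆ Q := image_subset_iff.2 fun σ h => rQ σ (hAS h)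
  have imB : B.image r ⊆ Q := image_subset_iff.2 fun σ h => rQ σ (hBS h)
  have k1 := card_sdiff_add_card_eq_card imA
  have k2 := card_sdiff_add_card_eq_card imB
  have k3 : (A.image r).card ≤ A.card := card_image_le
  have k4 : (B.image r).card ≤ B.card := card_image_le
  have : Nonempty V := ⟨c⟩
  have kA : A.card ≤ Q.card := (card_le_card hAS).trans hQ
  have kB : B.card ≤ Q.card := (card_le_card hBS).trans hQ
  -- A pair of `P'` travels through `c`, `u i`, `u' i`, `c'`. Since `u` and `u'` agree where
  -- possible, an edge from `u i` to `u' i` is needed only if `u i` represents a slot of `B` and `u'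
  -- i` a slot of `A`.
  obtain ⟨u, u', hu, hu', ui, ui', huu⟩ := exists_two_injOn (s := P') (t := Q \ A.image r)
    (t' := Q \ B.image r) (by omega) (by omega)
  have hu1 : ∀ i ∈ P', u i ∈ Q ∧ ∀ σ ∈ A, r σ ≠ u i := fun i hi => by
    have := hu i hi
    rw [mem_sdiff] at this
    exact ⟨this.1, fun σ hσ e => this.2 (e ▸ mem_image_of_mem r hσ)⟩
  have hu1' : ∀ i ∈ P', u' i ∈ Q ∧ ∀ σ ∈ B, r σ ≠ u' i := fun i hi => by
    have := hu' i hi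
    rw [mem_sdiff] at this
    exact ⟨this.1, fun σ hσ e => this.2 (e ▸ mem_image_of_mem r hσ)⟩
  have huB : ∀ i ∈ P', u i ≠ u' i → (∃ σ ∈ B, r σ = u i) ∧ ∃ σ ∈ A, r σ = u' i := by
    intro i hi hne
    obtain ⟨h1, h2⟩ := (huu i hi).resolve_left hne
    rw [mem_sdiff, not_and, not_not] at h1 h2
    exact ⟨mem_image.1 (h1 (hu1 i hi).1), mem_image.1 (h2 (hu1' i hi).1)⟩
  clear_value S A B P
  clear hS hA hB hP count hu hu' huu k1 k2 k3 k4 kA kB cA cB imA imB hQ hc hc' hP1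
  -- edges at `c`, edges at `c'`, and edges inside `Q` of the route of a pair
  let OC : ι → V → Prop := fun i z => (∃ σ ∈ A, σ.1 = i ∧ r σ = z) ∨ i ∈ P' ∧ u i = z
  let OC' : ι → V → Prop := fun i z => (∃ σ ∈ B, σ.1 = i ∧ r σ = z) ∨ i ∈ P' ∧ u' i = z
  let OH : ι → V → V → Prop := fun i x y => ∃ σ ∈ S, σ.1 = i ∧ g σ.1 σ.2 = x ∧ r σ = y
  let OD : ι → V → V → Prop := fun i x y =>
    ∃ b, (i, b) ∈ S ∧ (i, !b) ∈ S ∧ r (i, b) = x ∧ r (i, !b) = y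
  let OU : ι → V → V → Prop := fun i x y => i ∈ P' ∧ u i = x ∧ u' i = y
  let O : ι → V → V → Prop := fun i x y => OH i x y ∨ OD i x y ∨ OU i x y
  have OC_unique : ∀ i j z, OC i z → OC j z → i = j := by
    rintro i j z (⟨σ, hσ, rfl, rfl⟩ | ⟨hi, rfl⟩) (⟨τ, hτ, rfl, e⟩ | ⟨hj, e⟩)
    · rcases r1 σ (hAS hσ) τ (hAS hτ) e.symm with h | h
      · rw [h]
      · have := mA σ; have := mA τ; have := mB σ; have := mB τ; grind
    · exact absurd e.symm ((hu1 j hj).2 σ hσ)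
    · exact absurd e ((hu1 i hi).2 τ hτ)
    · exact ui hi hj e.symm
  have OC'_unique : ∀ i j z, OC' i z → OC' j z → i = j := by
    rintro i j z (⟨σ, hσ, rfl, rfl⟩ | ⟨hi, rfl⟩) (⟨τ, hτ, rfl, e⟩ | ⟨hj, e⟩)
    · rcases r1 σ (hBS hσ) τ (hBS hτ) e.symm with h | h
      · rw [h]
      · have := mA σ; have := mA τ; have := mB σ; have := mB τ; grind
    · exact absurd e.symm ((hu1' j hj).2 σ hσ)
    · exact absurd e ((hu1' i hi).2 τ hτ)
    · exact ui' hi hj e.symm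
  -- a slot whose representative is not its home is the only one with this representative
  have rne : ∀ σ ∈ S, ∀ τ ∈ S, r σ ≠ g σ.1 σ.2 → r τ = r σ → σ = τ := by
    intro σ hσ τ hτ hne e
    rcases r1 σ hσ τ hτ e.symm with h | h
    · exact h
    · exact absurd h.1 hne
  -- Slots that share a representative are of kinds `A` and `B`, but a slot whose partner lies in
  -- `Q` is of neither kind.
  have dne : ∀ i b, (i, b) ∈ S → (i, !b) ∈ S → ∀ τ ∈ S, r τ = r (i, b) → τ = (i, b) := by
    intro i b hb hb' τ hτ e
    rcases r1 τ hτ _ hb e with h | ⟨-, -, ⟨-, h⟩ | ⟨-, h⟩⟩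
    · exact h
    · have h1 := (mB _).1 h
      have h2 := (mS _).1 hb'
      exact absurd (h1.2 ▸ h2.1) hcQ'
    · have h1 := (mA _).1 h
      have h2 := (mS _).1 hb'
      exact absurd (h1.2 ▸ h2.1) hcQ
  have HH : ∀ i j x y, x ≠ y → OH i x y → OH j x y ∨ OH j y x → i = j := by
    rintro i j x y hxy ⟨σ, hσ, rfl, rfl, rfl⟩ (⟨τ, hτ, rfl, e, e'⟩ | ⟨τ, hτ, rfl, e, e'⟩)
    · rw [rne σ hσ τ hτ hxy.symm e']
    · exact absurd e.symm (r2 σ hσ hxy.symm τ hτ)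
  have HD : ∀ i j x y, x ≠ y → OH i x y → OD j x y ∨ OD j y x → i = j := by
    have main : ∀ i j x y, x ≠ y → OH i x y → OD j y x → i = j := by
      rintro i j x y hxy ⟨σ, hσ, rfl, rfl, rfl⟩ ⟨b, hb, hb', e, e'⟩
      rw [dne j b hb hb' σ hσ e.symm]
    rintro i j x y hxy h (⟨b, hb, hb', e, e'⟩ | h')
    · exact main i j x y hxy h ⟨!b, hb', by simpa using hb, e', by simpa using e⟩
    · exact main i j x y hxy h h'
  have HU : ∀ i j x y, x ≠ y → OH i x y → OU j x y ∨ OU j y x → i = j := by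
    rintro i j x y hxy ⟨σ, hσ, rfl, rfl, rfl⟩ (⟨hj, e, e'⟩ | ⟨hj, e, e'⟩)
    -- The vertex `u' j` is nobody's home, so `α` is `σ`, while `β` stays at `u j`, the home of `σ`.
    -- By `r4` some slot of `A` is then also represented by `u j`, contrary to the choice of `u`.
    · obtain ⟨⟨β, hβ, eβ⟩, α, hα, eα⟩ := huB j hj (by rw [e, e']; exact hxy)
      obtain rfl := rne σ hσ α (hAS hα) hxy.symm (by rw [eα, e'])
      have : r β = g β.1 β.2 := by
        by_contra hne
        exact r2 β (hBS hβ) hne σ hσ (by rw [eβ, e])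
      obtain ⟨α', hα', h'⟩ := r4 σ hα β hβ (by rw [← this, eβ, e]) this
      exact absurd (h'.trans (this.symm.trans eβ)) ((hu1 j hj).2 α' hα')
    · obtain ⟨⟨β, hβ, eβ⟩, α, hα, eα⟩ := huB j hj (by rw [e, e']; exact hxy.symm)
      obtain rfl := rne σ hσ β (hBS hβ) hxy.symm (by rw [eβ, e])
      have : r α = g α.1 α.2 := by
        by_contra hne
        exact r2 α (hAS hα) hne σ hσ (by rw [eα, e'])
      obtain ⟨β', hβ', h'⟩ := r3 α hα σ hβ (by rw [← this, eα, e']) this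
      exact absurd (h'.trans (this.symm.trans eα)) ((hu1' j hj).2 β' hβ')
  have DD : ∀ i j x y, OD i x y → OD j x y ∨ OD j y x → i = j := by
    rintro i j x y ⟨b, hb, hb', rfl, rfl⟩ (⟨d, hd, hd', e, e'⟩ | ⟨d, hd, hd', e, e'⟩)
    · exact (congrArg Prod.fst (dne i b hb hb' _ hd e)).symm
    · exact (congrArg Prod.fst (dne i b hb hb' _ hd' e')).symm
  have DU : ∀ i j x y, x ≠ y → OD i x y → OU j x y ∨ OU j y x → i = j := by
    have main : ∀ i j x y, x ≠ y → OD i x y → OU j x y → i = j := by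
      rintro i j x y hxy ⟨b, hb, hb', rfl, rfl⟩ ⟨hj, e, e'⟩
      obtain ⟨⟨β, hβ, eβ⟩, -⟩ := huB j hj (by rw [e, e']; exact hxy)
      obtain rfl := dne i b hb hb' β (hBS hβ) (by rw [eβ, e])
      have h1 := (mB _).1 hβ
      have h2 := (mS _).1 hb'
      exact absurd (h1.2 ▸ h2.1) hcQ'
    rintro i j x y hxy h (h' | h')
    · exact main i j x y hxy h h'
    · obtain ⟨b, hb, hb', e, e'⟩ := h
      exact main i j y x hxy.symm ⟨!b, hb', by simpa using hb, e', by simpa using e⟩ h'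
  have UU : ∀ i j x y, x ≠ y → OU i x y → OU j x y ∨ OU j y x → i = j := by
    rintro i j x y hxy ⟨hi, rfl, rfl⟩ (⟨hj, e, e'⟩ | ⟨hj, e, e'⟩)
    · exact ui hi hj e.symm
    · obtain ⟨-, α, hα, eα⟩ := huB j hj (by rw [e, e']; exact hxy.symm)
      exact absurd (eα.trans e') ((hu1 i hi).2 α hα)
  have O_unique : ∀ i j x y, x ≠ y → O i x y → O j x y ∨ O j y x → i = j := by
    rintro i j x y hxy (h | h | h) h'
    · rcases h' with (h' | h' | h') | (h' | h' | h')
      · exact HH i j x y hxy h (.inl h')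
      · exact HD i j x y hxy h (.inl h')
      · exact HU i j x y hxy h (.inl h')
      · exact HH i j x y hxy h (.inr h')
      · exact HD i j x y hxy h (.inr h')
      · exact HU i j x y hxy h (.inr h')
    · rcases h' with (h' | h' | h') | (h' | h' | h')
      · exact (HD j i x y hxy h' (.inl h)).symm
      · exact DD i j x y h (.inl h')
      · exact DU i j x y hxy h (.inl h')
      · exact (HD j i y x hxy.symm h' (.inr h)).symm
      · exact DD i j x y h (.inr h')
      · exact DU i j x y hxy h (.inr h')
    · rcases h' with (h' | h' | h') | (h' | h' | h')
      · exact (HU j i x y hxy h' (.inl h)).symm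
      · exact (DU j i x y hxy h' (.inl h)).symm
      · exact UU i j x y hxy h (.inl h')
      · exact (HU j i y x hxy.symm h' (.inr h)).symm
      · exact (DU j i y x hxy.symm h' (.inr h)).symm
      · exact UU i j x y hxy h (.inr h')
  let R : ι → V → V → Prop := fun i x y => (x = c ∧ y ∈ Q ∧ OC i y) ∨ (x = c' ∧ y ∈ Q ∧ OC' i y) ∨
    (x = c ∧ y = c' ∧ i ∈ P ∧ i ∉ P') ∨ (x ∈ Q ∧ y ∈ Q ∧ O i x y)
  have R_unique : ∀ i j x y, x ≠ y → R i x y → R j x y ∨ R j y x → i = j := by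
    rintro i j x y hxy (⟨rfl, hy, h⟩ | ⟨rfl, hy, h⟩ | ⟨rfl, rfl, h⟩ | ⟨hx, hy, h⟩)
      ((⟨e, h1, h'⟩ | ⟨e, h1, h'⟩ | ⟨e, h1, h'⟩ | ⟨e, h1, h'⟩) |
        (⟨e, h1, h'⟩ | ⟨e, h1, h'⟩ | ⟨e, h1, h'⟩ | ⟨e, h1, h'⟩))
    all_goals first
      | exact OC_unique _ _ _ h h'
      | exact OC'_unique _ _ _ h h'
      | exact O_unique i j x y hxy h (.inl h')
      | exact O_unique i j x y hxy h (.inr h')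
      | exact hP2 i h.1 j h'.1 h.2 h'.2
      | (exfalso; subst e; first | exact hcQ ‹_› | exact hcQ' ‹_› | exact hcc rfl)
      | (exfalso; subst h1; first | exact hcQ ‹_› | exact hcQ' ‹_›)
      | (exfalso; first | exact hcQ ‹_› | exact hcQ' ‹_›)
  refine ⟨fun i => SimpleGraph.fromRel (R i), ?_, ?_, ?_⟩
  · intro i x y h
    have hR : ∀ x y, R i x y → x ∈ insert c (insert c' Q) ∧ y ∈ insert c (insert c' Q) := by
      rintro x y (⟨rfl, hy, -⟩ | ⟨rfl, hy, -⟩ | ⟨rfl, rfl, -⟩ | ⟨hx, hy, -⟩) <;> simp [*]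
    rcases ((SimpleGraph.fromRel_adj _ _ _).1 h).2 with h | h
    · exact hR x y h
    · exact (hR y x h).symm
  · intro i j x y h h'
    obtain ⟨hxy, h⟩ := (SimpleGraph.fromRel_adj _ _ _).1 h
    obtain ⟨-, h'⟩ := (SimpleGraph.fromRel_adj _ _ _).1 h'
    rcases h with h | h
    · exact R_unique i j x y hxy h h'
    · exact R_unique i j y x hxy.symm h h'.symm
  · intro i
    set G := SimpleGraph.fromRel (R i) with hG
    have step : ∀ x y, R i x y → G.Reachable x y := by
      intro x y h
      by_cases hxy : x = y
      · exact hxy ▸ .refl x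
      · exact SimpleGraph.Adj.reachable ((SimpleGraph.fromRel_adj _ _ _).2 ⟨hxy, .inl h⟩)
    have home : ∀ b, (i, b) ∈ S → G.Reachable (g i b) (r (i, b)) := fun b hb =>
      step _ _ (.inr (.inr (.inr ⟨((mS _).1 hb).1, rQ _ hb, .inl ⟨_, hb, rfl, rfl, rfl⟩⟩)))
    have key : ∀ b, G.Reachable (g i b) (g i (!b)) := by
      intro b
      by_cases hne : g i b = g i (!b)
      · exact hne ▸ .refl _
      have inA : ∀ b, g i b ∈ Q → g i (!b) = c → G.Reachable (g i b) c := by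
        intro b h1 h2
        have hσ := (mA (i, b)).2 ⟨h1, h2⟩
        exact (home b (hAS hσ)).trans
          (step c _ (.inl ⟨rfl, rQ _ (hAS hσ), .inl ⟨_, hσ, rfl, rfl⟩⟩)).symm
      have inB : ∀ b, g i b ∈ Q → g i (!b) = c' → G.Reachable (g i b) c' := by
        intro b h1 h2
        have hσ := (mB (i, b)).2 ⟨h1, h2⟩
        exact (home b (hBS hσ)).trans
          (step c' _ (.inr (.inl ⟨rfl, rQ _ (hBS hσ), .inl ⟨_, hσ, rfl, rfl⟩⟩))).symm
      have inP : i ∈ P → G.Reachable c c' := by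
        intro hi
        by_cases hi' : i ∈ P'
        · have h1 : G.Reachable c (u i) := step _ _ (.inl ⟨rfl, (hu1 i hi').1, .inr ⟨hi', rfl⟩⟩)
          have h2 : G.Reachable (u i) (u' i) := step _ _ (.inr (.inr (.inr
            ⟨(hu1 i hi').1, (hu1' i hi').1, .inr (.inr ⟨hi', rfl, rfl⟩)⟩)))
          have h3 : G.Reachable c' (u' i) :=
            step _ _ (.inr (.inl ⟨rfl, (hu1' i hi').1, .inr ⟨hi', rfl⟩⟩))
          exact (h1.trans h2).trans h3.symm
        · exact step _ _ (.inr (.inr (.inl ⟨rfl, rfl, hi, hi'⟩)))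
      rcases hg i b with e | e | e <;> rcases hg i (!b) with e' | e' | e'
      · exact absurd (e.trans e'.symm) hne
      · rw [e, e']; exact inP ((mP i).2 (by cases b; exacts [.inl ⟨e, e'⟩, .inr ⟨e', e⟩]))
      · rw [e]; exact (inA (!b) e' (by simpa using e)).symm
      · rw [e, e']; exact (inP ((mP i).2 (by cases b; exacts [.inr ⟨e, e'⟩, .inl ⟨e', e⟩]))).symm
      · exact absurd (e.trans e'.symm) hne
      · rw [e]; exact (inB (!b) e' (by simpa using e)).symm
      · rw [e']; exact inA b e e'
      · rw [e']; exact inB b e e'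
      · have h1 := (mS (i, b)).2 ⟨e, hne⟩
        have h2 := (mS (i, !b)).2 ⟨e', by simpa using Ne.symm hne⟩
        have h3 : G.Reachable (r (i, b)) (r (i, !b)) := step _ _ (.inr (.inr (.inr
          ⟨rQ _ h1, rQ _ h2, .inr (.inl ⟨b, h1, h2, rfl, rfl⟩)⟩)))
        exact ((home b h1).trans h3).trans (home (!b) h2).symm
    exact key false

end CliqueRouting

/-! ### A local characterization of clique paths -/

namespace SimpleGraph

variable {V : Type*} {G : SimpleGraph V}

/-- Two vertices are linked in `T` if there is a walk between them all of whose vertices lie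
in `T`. -/
def Linked (G : SimpleGraph V) (T : Set V) (a b : V) : Prop :=
  ∃ p : G.Walk a b, ∀ x ∈ p.support, x ∈ T

theorem Linked.refl {T : Set V} {a : V} (h : a ∈ T) : G.Linked T a a :=
  ⟨.nil, by simpa using h⟩

theorem Linked.symm {T : Set V} {a b : V} (h : G.Linked T a b) : G.Linked T b a := by
  obtain ⟨p, hp⟩ := h
  exact ⟨p.reverse, by simpa using hp⟩

theorem Linked.trans {T : Set V} {a b c : V} (h : G.Linked T a b) (h' : G.Linked T b c) :
    G.Linked T a c := by
  obtain ⟨p, hp⟩ := h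
  obtain ⟨q, hq⟩ := h'
  refine ⟨p.append q, fun x hx => ?_⟩
  rcases (Walk.mem_support_append_iff _ _).1 hx with hx | hx
  exacts [hp x hx, hq x hx]

theorem Linked.mono {T T' : Set V} {a b : V} (h : G.Linked T a b) (hT : T ⊆ T') :
    G.Linked T' a b := by
  obtain ⟨p, hp⟩ := h
  exact ⟨p, fun x hx => hT (hp x hx)⟩

theorem Adj.linked {T : Set V} {a b : V} (h : G.Adj a b) (ha : a ∈ T) (hb : b ∈ T) :
    G.Linked T a b :=
  ⟨.cons h .nil, by simp [ha, hb]⟩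

/-- Induction along a walk inside `T`, from its end. -/
theorem Linked.induction {T : Set V} {a b : V} (h : G.Linked T a b) {P : V → Prop} (ha : P a)
    (step : ∀ x y, x ∈ T → y ∈ T → G.Adj x y → P x → P y) : P b := by
  obtain ⟨p, hp⟩ := h
  induction p with
  | nil => exact ha
  | cons h p ih =>
    simp only [Walk.support_cons, List.mem_cons, forall_eq_or_imp] at hp
    exact ih (step _ _ hp.1 (hp.2 _ p.start_mem_support) h ha) hp.2

theorem Linked.map {W : Type*} {H : SimpleGraph W} (f : G →g H) {T : Set V} {a b : V}
    (h : G.Linked T a b) : H.Linked (f '' T) (f a) (f b) := by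
  obtain ⟨p, hp⟩ := h
  refine ⟨p.map f, fun x hx => ?_⟩
  rw [Walk.support_map, List.mem_map] at hx
  obtain ⟨y, hy, rfl⟩ := hx
  exact ⟨y, hp y hy, rfl⟩

theorem linked_iff_reachable_induce {T : Set V} (a b : T) :
    G.Linked T a b ↔ (G.induce T).Reachable a b := by
  constructor
  · rintro h
    have := h.induction (P := fun y => ∀ hy : y ∈ T, (G.induce T).Reachable a ⟨y, hy⟩)
      (fun _ => .refl _) (fun x y hx hy hxy ih _ => (ih hx).trans (Adj.reachable (by simpa)))
    exact this b.2
  · rintro ⟨p⟩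
    refine (Linked.map (Embedding.induce T).toHom (T := Set.univ) ⟨p, by simp⟩).mono ?_
    rintro _ ⟨y, -, rfl⟩
    exact y.2

/-- A vertex of a connected graph is a cut vertex if and only if it separates two vertices. -/
theorem Connected.isCutVertex_iff (hG : G.Connected) (w : V) :
    G.IsCutVertex w ↔ ∃ a b, a ≠ w ∧ b ≠ w ∧ ¬ G.Linked {w}ᶜ a b := by
  have h1 : ENat.card G.ConnectedComponent = 1 := by
    have := hG.preconnected.subsingleton_connectedComponent
    have := hG.nonempty
    rw [ENat.card_eq_one_iff_unique]
    exact ⟨_root_.uniqueOfSubsingleton (G.connectedComponentMk this.some)⟩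
  rw [IsCutVertex, h1, ENat.one_lt_card_iff_nontrivial]
  constructor
  · rintro ⟨a, b, hab⟩
    induction a using ConnectedComponent.ind with | _ a => ?_
    induction b using ConnectedComponent.ind with | _ b => ?_
    refine ⟨a, b, a.2, b.2, fun h => hab ?_⟩
    exact ConnectedComponent.sound ((linked_iff_reachable_induce a b).1 h)
  · rintro ⟨a, b, ha, hb, h⟩
    refine ⟨(G.induce {w}ᶜ).connectedComponentMk ⟨a, ha⟩,
      (G.induce {w}ᶜ).connectedComponentMk ⟨b, hb⟩, fun e => h ?_⟩
    exact (linked_iff_reachable_induce ⟨a, ha⟩ ⟨b, hb⟩).2 (ConnectedComponent.exact e)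

/-- Neighbours of a vertex `w` that are connected in `G - w` are adjacent. -/
def EarClosed (G : SimpleGraph V) : Prop :=
  ∀ ⦃w u v⦄, G.Adj w u → G.Adj w v → u ≠ v → G.Linked {w}ᶜ u v → G.Adj u v

/-- A vertex with two nonadjacent neighbours. -/
def Branching (G : SimpleGraph V) (w : V) : Prop :=
  ∃ u v, G.Adj w u ∧ G.Adj w v ∧ u ≠ v ∧ ¬ G.Adj u v

theorem Linked.subgraph {S T : Set V} {a b : V} (h : G.Linked T a b) (hTS : T ⊆ S)
    (ha : a ∈ S) (hb : b ∈ S) :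
    ((⊤ : G.Subgraph).induce S).coe.Linked (fun x => x.1 ∈ T) ⟨a, ha⟩ ⟨b, hb⟩ := by
  have haT : a ∈ T := by
    obtain ⟨p, hp⟩ := h
    exact hp _ p.start_mem_support
  have := h.induction (P := fun y => ∀ hy : y ∈ S,
    ((⊤ : G.Subgraph).induce S).coe.Linked (fun x => x.1 ∈ T) ⟨a, ha⟩ ⟨y, hy⟩)
    (fun _ => .refl haT) (fun x y hx hy hxy ih h' => (ih (hTS hx)).trans (Adj.linked
      (by simpa [hTS hx, h'] using hxy) hx hy))
  exact this hb

/-- A vertex set that stays connected after the deletion of any vertex lies in a block. -/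
theorem exists_isBlock [Finite V] {S : Set V} (hS : S.Nonempty)
    (hc : ∀ a ∈ S, ∀ b ∈ S, G.Linked S a b)
    (h2 : ∀ x ∈ S, ∀ a ∈ S, ∀ b ∈ S, a ≠ x → b ≠ x → G.Linked (S \ {x}) a b) :
    ∃ B : G.Subgraph, G.IsBlock B ∧ S ⊆ B.verts := by
  have hconn : ((⊤ : G.Subgraph).induce S).Connected := by
    rw [Subgraph.connected_iff']
    have : Nonempty ((⊤ : G.Subgraph).induce S).verts := ⟨⟨hS.some, hS.some_mem⟩⟩
    refine ⟨fun a b => ?_⟩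
    obtain ⟨p, -⟩ := (hc a a.2 b b.2).subgraph subset_rfl a.2 b.2
    exact ⟨p⟩
  obtain ⟨B, hB, hmax⟩ := (Set.toFinite {H : G.Subgraph | H.Connected ∧
    ∀ v : H.verts, ¬ H.coe.IsCutVertex v}).exists_le_maximal
      (a := (⊤ : G.Subgraph).induce S) ⟨hconn, fun v => by
        rw [(Subgraph.connected_iff'.1 hconn).isCutVertex_iff]
        rintro ⟨a, b, ha, hb, h⟩
        refine h (((h2 v v.2 a a.2 b b.2 (fun e => ha (Subtype.ext e))
          (fun e => hb (Subtype.ext e))).subgraph Set.sdiff_subset a.2 b.2).mono ?_)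
        intro x hx e
        exact hx.2 (congrArg Subtype.val e)⟩
  exact ⟨B, hmax, hB.1⟩

theorem IsClique.exists_isBlock [Finite V] {S : Set V} (hS : S.Nonempty) (h : G.IsClique S) :
    ∃ B : G.Subgraph, G.IsBlock B ∧ S ⊆ B.verts := by
  have key : ∀ T ⊆ S, ∀ a ∈ T, ∀ b ∈ T, G.Linked T a b := by
    intro T hT a ha b hb
    by_cases hab : a = b
    · exact hab ▸ .refl ha
    · exact (h (hT ha) (hT hb) hab).linked ha hb
  exact SimpleGraph.exists_isBlock hS (key S subset_rfl)
    fun x _ a ha b hb hax hbx => key _ Set.sdiff_subset a ⟨ha, hax⟩ b ⟨hb, hbx⟩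

/-- A path from `u` to `v` avoiding `w` closes up to a cycle through `w`. A cycle stays connected
after the deletion of a vertex, so it lies in a block, which is a clique. Conversely, let `x`, `z`,
`z'` be consecutive on a walk in a block. The block has no cut vertex, so `x` and `z'` are linked
around `z`, hence equal or adjacent; thus adjacency to `x` spreads over the whole block. -/
theorem isBlockGraph_iff [Finite V] : G.IsBlockGraph ↔ G.EarClosed := by
  classical
  constructor
  · rintro h w u v hu hv huv ⟨p, hp⟩
    set q := p.toPath with hq
    have hqw : w ∉ q.1.support := fun hw => hp w (p.support_toPath_subset_support hw) rfl
    set S : Set V := {x | x = w ∨ x ∈ q.1.support} with hS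
    have hw : ∀ T : Set V, w ∈ T → ∀ b, (∃ r : G.Walk b u, ∀ x ∈ r.support, x ∈ T) ∨
        (∃ r : G.Walk b v, ∀ x ∈ r.support, x ∈ T) → G.Linked T w b := by
      rintro T hT b (⟨r, hr⟩ | ⟨r, hr⟩)
      · exact (hu.linked hT (hr u r.end_mem_support)).trans (Linked.symm ⟨r, hr⟩)
      · exact (hv.linked hT (hr v r.end_mem_support)).trans (Linked.symm ⟨r, hr⟩)
    obtain ⟨B, hB, hSB⟩ : ∃ B : G.Subgraph, G.IsBlock B ∧ S ⊆ B.verts := by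
      have hL : ∀ b ∈ S, G.Linked S w b := by
        rintro b (rfl | hb)
        · exact .refl (.inl rfl)
        · exact hw S (.inl rfl) b (.inr ⟨q.1.dropUntil b hb, fun x hx =>
            .inr (q.1.support_dropUntil_subset_support hb hx)⟩)
      refine SimpleGraph.exists_isBlock ⟨w, .inl rfl⟩
        (fun a ha b hb => (hL a ha).symm.trans (hL b hb)) ?_
      rintro x (rfl | hx)
      · rintro a (rfl | ha) b (rfl | hb) hax hbx
        · exact absurd rfl hax
        · exact absurd rfl hax
        · exact absurd rfl hbx
        · have hq' : ∀ y ∈ q.1.support, y ∈ S \ {x} :=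
            fun y hy => Set.mem_sdiff_singleton.2 ⟨.inr hy, fun e => hqw (e ▸ hy)⟩
          have : ∀ c (hc : c ∈ q.1.support), G.Linked (S \ {x}) u c := fun c hc =>
            ⟨q.1.takeUntil c hc, fun y hy => hq' _ (q.1.support_takeUntil_subset_support hc hy)⟩
          exact (this a ha).symm.trans (this b hb)
      · have hL' : ∀ b ∈ S, b ≠ x → G.Linked (S \ {x}) w b := by
          rintro b (rfl | hb) hbx
          · exact .refl ⟨.inl rfl, fun e => hbx e⟩
          · refine hw (S \ {x}) ⟨.inl rfl, fun e => hqw (e ▸ hx)⟩ b ?_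
            -- The deleted vertex `x` lies on only one side of `b` on the path, so `b` still reaches
            -- `u` or `v`, both neighbours of `w`.
            by_cases hx' : x ∈ (q.1.takeUntil b hb).support
            · right
              refine ⟨q.1.dropUntil b hb, fun y hy =>
                ⟨.inr (q.1.support_dropUntil_subset_support hb hy), ?_⟩⟩
              rintro rfl
              have := q.2.support_nodup
              rw [← q.1.take_spec hb, Walk.support_append] at this
              have hd := List.disjoint_of_nodup_append this hx'
              refine hd ?_
              rw [← Walk.cons_tail_support, List.mem_cons] at hy
              exact hy.resolve_left fun e => hbx e.symm
            · left
              refine ⟨(q.1.takeUntil b hb).reverse, fun y hy => ?_⟩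
              rw [Walk.support_reverse, List.mem_reverse] at hy
              exact ⟨.inr (q.1.support_takeUntil_subset_support hb hy), fun e => hx' (e ▸ hy)⟩
        exact fun a ha b hb hax hbx => (hL' a ha hax).symm.trans (hL' b hb hbx)
    exact h B hB (hSB (.inr q.1.start_mem_support)) (hSB (.inr q.1.end_mem_support)) huv
  · rintro h B ⟨⟨hconn, hcut⟩, -⟩ x hx y hy hxy
    have hconn' := Subgraph.connected_iff'.1 hconn
    obtain ⟨p⟩ := hconn'.preconnected ⟨x, hx⟩ ⟨y, hy⟩
    have hp : B.coe.Linked Set.univ ⟨x, hx⟩ ⟨y, hy⟩ := ⟨p, fun _ _ => trivial⟩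
    have := hp.induction (P := fun z => z.1 = x ∨ G.Adj x z.1) (.inl rfl) ?_
    · exact this.resolve_left hxy.symm
    · intro z z' _ _ hzz hz
      have hzz' : G.Adj z z' := B.adj_sub (by simpa using hzz)
      by_cases hxz' : z'.1 = x
      · exact .inl hxz'
      right
      rcases hz with hz | hz
      · exact hz ▸ hzz'
      · refine h hz.symm hzz' (Ne.symm hxz') ?_
        have := hcut z
        rw [hconn'.isCutVertex_iff] at this
        push Not at this
        refine ((this ⟨x, hx⟩ z' (fun e => hz.ne (congrArg Subtype.val e))
          (fun e => hzz'.ne (congrArg Subtype.val e).symm)).map B.hom).mono ?_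
        rintro _ ⟨w, hw, rfl⟩
        exact fun e => hw (Subtype.ext e)

theorem Connected.exists_adj_linked (hG : G.Connected) {a w : V} (h : a ≠ w) :
    ∃ u, G.Adj w u ∧ G.Linked {w}ᶜ u a := by
  classical
  obtain ⟨p⟩ := hG.preconnected w a
  obtain ⟨p, hp⟩ := p.toPath
  cases p with
  | nil => exact absurd rfl h
  | cons hu q =>
    rw [Walk.cons_isPath_iff] at hp
    exact ⟨_, hu, q, fun x hx e => hp.2 (e ▸ hx)⟩

/-- Every vertex other than `w` is linked to a neighbour of `w` without passing through `w`. So if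
the neighbours are pairwise adjacent, nothing is separated, while nonadjacent neighbours are
separated by ear-closedness. -/
theorem EarClosed.isCutVertex_iff (h : G.EarClosed) (hG : G.Connected) (w : V) :
    G.IsCutVertex w ↔ G.Branching w := by
  rw [hG.isCutVertex_iff]
  constructor
  · rintro ⟨a, b, ha, hb, hab⟩
    by_contra hw
    simp only [Branching, not_exists, not_and, not_not] at hw
    obtain ⟨u, hu, hua⟩ := hG.exists_adj_linked ha
    obtain ⟨v, hv, hvb⟩ := hG.exists_adj_linked hb
    refine hab (hua.symm.trans (Linked.trans ?_ hvb))
    by_cases huv : u = v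
    · exact huv ▸ .refl hu.ne'
    · exact (hw u v hu hv huv).linked hu.ne' hv.ne'
  · rintro ⟨u, v, hu, hv, huv, hn⟩
    exact ⟨u, v, hu.ne', hv.ne', fun hl => hn (h hu hv huv hl)⟩

/-- Cliques lie in blocks and blocks are cliques, so three cut vertices in one block are the same as
a triangle of branching vertices. This form mentions no subgraphs and is easy to transport to a
contraction. -/
theorem isCliquePath_iff [Finite V] : G.IsCliquePath ↔ G.Connected ∧ G.EarClosed ∧
    ∀ x y z, G.Adj x y → G.Adj y z → G.Adj x z →
      ¬ (G.Branching x ∧ G.Branching y ∧ G.Branching z) := by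
  rw [IsCliquePath, isBlockGraph_iff]
  refine and_congr_right fun hG => and_congr_right fun h => ?_
  constructor
  · rintro hB x y z hxy hyz hxz ⟨hx, hy, hz⟩
    have hcl : G.IsClique ({x, y, z} : Set V) := by
      rw [isClique_insert]
      refine ⟨?_, by simp [hxy, hxz]⟩
      rw [isClique_insert]
      exact ⟨by simp, by simp [hyz]⟩
    obtain ⟨B, hBl, hsub⟩ := hcl.exists_isBlock ⟨x, by simp⟩
    have h3 : ({x, y, z} : Set V) ⊆ {v ∈ B.verts | G.IsCutVertex v} := by
      intro v hv
      refine ⟨hsub hv, ?_⟩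
      rw [h.isCutVertex_iff hG]
      rcases hv with rfl | rfl | rfl <;> assumption
    have h4 := (Set.encard_le_encard h3).trans (hB B hBl)
    rw [Set.encard_eq_three.2 ⟨x, y, z, hxy.ne, hxz.ne, hyz.ne, rfl⟩] at h4
    exact absurd h4 (by decide)
  · intro ht B hB
    by_contra hlt
    rw [not_le] at hlt
    rw [← (Set.toFinite _).cast_ncard_eq, Nat.ofNat_lt_cast, Set.two_lt_ncard_iff] at hlt
    obtain ⟨x, y, z, hx, hy, hz, hxy, hxz, hyz⟩ := hlt
    have hcl := isBlockGraph_iff.2 h B hB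
    refine ht x y z (hcl hx.1 hy.1 hxy) (hcl hy.1 hz.1 hyz) (hcl hx.1 hz.1 hxz) ?_
    simp only [← h.isCutVertex_iff hG]
    exact ⟨hx.2, hy.2, hz.2⟩

end SimpleGraph

/-! ### Blocks, gates, and contractions -/

namespace SimpleGraph

variable {V : Type*} {G : SimpleGraph V}

theorem Reachable.induction {a b : V} (h : G.Reachable a b) {P : V → Prop} (ha : P a)
    (step : ∀ x y, G.Adj x y → P x → P y) : P b := by
  obtain ⟨p⟩ := h
  exact Linked.induction (T := Set.univ) ⟨p, by simp⟩ ha fun x y _ _ => step x y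

theorem Connected.exists_adj_dist (hG : G.Connected) {p x : V} (h : p ≠ x) :
    ∃ w, G.Adj p w ∧ G.dist w x + 1 = G.dist p x := by
  obtain ⟨q, hq⟩ := hG.exists_walk_length_eq_dist p x
  cases q with
  | nil => exact absurd rfl h
  | @cons _ w _ hw q =>
    refine ⟨w, hw, ?_⟩
    have h1 := dist_le q
    have h2 := hG.dist_triangle (u := p) (v := w) (w := x)
    rw [dist_eq_one_iff_adj.2 hw] at h2
    rw [Walk.length_cons] at hq
    omega

/-- All vertices of a geodesic after the start are strictly closer to `x`. This is how walks are
shown to avoid a given vertex: by comparing distances. -/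
theorem Connected.linked_geodesic (hG : G.Connected) (p x : V) :
    G.Linked {y | y = p ∨ G.dist y x < G.dist p x} p x := by
  induction hd : G.dist p x generalizing p with
  | zero =>
    rw [hG.dist_eq_zero_iff] at hd
    exact hd ▸ .refl (.inl rfl)
  | succ d ih =>
    obtain ⟨w, hw, hwd⟩ := hG.exists_adj_dist (p := p) (x := x) (by rintro rfl; simp at hd)
    have hwd' : G.dist w x = d := by omega
    refine (hw.linked (.inl rfl) (.inr (by omega))).trans ((ih w hwd').mono ?_)
    rintro y (rfl | hy)
    · exact .inr (by omega)
    · exact .inr (by omega)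

open Classical in
/-- A vertex of `B` at minimum distance from `x`. -/
noncomputable def gate (G : SimpleGraph V) (B : Finset V) (x : V) : V :=
  if h : B.Nonempty then (B.exists_min_image (fun p => G.dist p x) h).choose else x

theorem gate_spec {B : Finset V} (h : B.Nonempty) (x : V) :
    G.gate B x ∈ B ∧ ∀ q ∈ B, G.dist (G.gate B x) x ≤ G.dist q x := by
  rw [gate, dif_pos h]
  exact (B.exists_min_image (fun p => G.dist p x) h).choose_spec

/-! ### Blocks spanned by an edge, and their gates -/

section

variable [Fintype V]

open Classical in
/-- The vertices that are equal or adjacent to both ends of an edge; in a block graph, the vertices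
of the block that contains the edge. -/
noncomputable def edgeBlock (G : SimpleGraph V) (u v : V) : Finset V :=
  Finset.univ.filter fun w => (w = u ∨ G.Adj w u) ∧ (w = v ∨ G.Adj w v)

theorem mem_edgeBlock {u v w : V} :
    w ∈ G.edgeBlock u v ↔ (w = u ∨ G.Adj w u) ∧ (w = v ∨ G.Adj w v) := by
  simp [edgeBlock]

theorem edgeBlock_comm (u v : V) : G.edgeBlock u v = G.edgeBlock v u := by
  ext w; simp only [mem_edgeBlock]; tauto

theorem Adj.left_mem_edgeBlock {u v : V} (h : G.Adj u v) : u ∈ G.edgeBlock u v :=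
  mem_edgeBlock.2 ⟨.inl rfl, .inr h⟩

theorem Adj.right_mem_edgeBlock {u v : V} (h : G.Adj u v) : v ∈ G.edgeBlock u v :=
  mem_edgeBlock.2 ⟨.inr h.symm, .inl rfl⟩

/-- If `a` and `b` differ from `u`, both are neighbours of `u` and are linked through `v` without
meeting `u`. -/
theorem EarClosed.adj_of_mem (h : G.EarClosed) {u v a b : V} (huv : G.Adj u v)
    (ha : a ∈ G.edgeBlock u v) (hb : b ∈ G.edgeBlock u v) (hab : a ≠ b) : G.Adj a b := by
  rw [mem_edgeBlock] at ha hb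
  rcases ha with ⟨rfl | ha, ha'⟩
  · exact hb.1.resolve_left hab.symm |>.symm
  rcases hb with ⟨rfl | hb, hb'⟩
  · exact ha
  refine h ha.symm hb.symm hab ?_
  have hv : v ∈ ({u}ᶜ : Set V) := huv.ne'
  have h1 : G.Linked {u}ᶜ a v := by
    rcases ha' with rfl | ha'
    · exact .refl hv
    · exact ha'.linked ha.ne hv
  have h2 : G.Linked {u}ᶜ b v := by
    rcases hb' with rfl | hb'
    · exact .refl hv
    · exact hb'.linked hb.ne hv
  exact h1.trans h2.symm

theorem EarClosed.edgeBlock_eq (h : G.EarClosed) {u v a b : V} (huv : G.Adj u v)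
    (ha : a ∈ G.edgeBlock u v) (hb : b ∈ G.edgeBlock u v) (hab : a ≠ b) :
    G.edgeBlock a b = G.edgeBlock u v := by
  have key : ∀ {u v a b : V}, G.Adj u v → a ∈ G.edgeBlock u v → b ∈ G.edgeBlock u v →
      G.edgeBlock u v ⊆ G.edgeBlock a b := by
    intro u v a b huv ha hb z hz
    refine mem_edgeBlock.2 ⟨?_, ?_⟩
    · exact or_iff_not_imp_left.2 fun hne => h.adj_of_mem huv hz ha hne
    · exact or_iff_not_imp_left.2 fun hne => h.adj_of_mem huv hz hb hne
  have hsub := key huv ha hb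
  exact (key (h.adj_of_mem huv ha hb hab) (hsub huv.left_mem_edgeBlock)
    (hsub huv.right_mem_edgeBlock)).antisymm hsub

/-- The vertex sets of the blocks of a block graph, given by their edges. -/
def IsEdgeBlock (G : SimpleGraph V) (B : Finset V) : Prop :=
  ∃ u v, G.Adj u v ∧ B = G.edgeBlock u v

theorem Adj.isEdgeBlock {u v : V} (h : G.Adj u v) : G.IsEdgeBlock (G.edgeBlock u v) :=
  ⟨u, v, h, rfl⟩

theorem IsEdgeBlock.nonempty {B : Finset V} (hB : G.IsEdgeBlock B) : B.Nonempty := by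
  obtain ⟨u, v, h, rfl⟩ := hB
  exact ⟨u, h.left_mem_edgeBlock⟩

theorem IsEdgeBlock.adj {B : Finset V} (hB : G.IsEdgeBlock B) (h : G.EarClosed) {a b : V}
    (ha : a ∈ B) (hb : b ∈ B) (hab : a ≠ b) : G.Adj a b := by
  obtain ⟨u, v, huv, rfl⟩ := hB
  exact h.adj_of_mem huv ha hb hab

theorem IsEdgeBlock.eq {B : Finset V} (hB : G.IsEdgeBlock B) (h : G.EarClosed) {a b : V}
    (ha : a ∈ B) (hb : b ∈ B) (hab : a ≠ b) : B = G.edgeBlock a b := by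
  obtain ⟨u, v, huv, rfl⟩ := hB
  exact (h.edgeBlock_eq huv ha hb hab).symm

theorem IsEdgeBlock.gate_mem {B : Finset V} (hB : G.IsEdgeBlock B) (x : V) : G.gate B x ∈ B :=
  (gate_spec hB.nonempty x).1

/-- Let `w` follow `u` on a geodesic to `x`. Then `w` and `v` are neighbours of `u` linked through
`x`, and all vertices on the way other than `v` are closer to `x` than `u`. So `w` is adjacent to
`v` and lies in the block. This makes gates unique. -/
theorem EarClosed.exists_closer (h : G.EarClosed) (hG : G.Connected) {u v x : V} (huv : G.Adj u v)
    (hd : G.dist u x = G.dist v x) : ∃ w ∈ G.edgeBlock u v, G.dist w x < G.dist u x := by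
  have hux : u ≠ x := by
    rintro rfl
    rw [dist_self, eq_comm, hG.dist_eq_zero_iff] at hd
    exact huv.ne' hd
  obtain ⟨w, hw, hwd⟩ := hG.exists_adj_dist hux
  refine ⟨w, mem_edgeBlock.2 ⟨.inr hw.symm, .inr ?_⟩, by omega⟩
  refine h hw huv (by rintro rfl; omega) ?_
  refine ((hG.linked_geodesic w x).mono ?_).trans ((hG.linked_geodesic v x).mono ?_).symm
  · rintro y (rfl | hy) rfl
    · exact hw.ne rfl
    · omega
  · rintro y (rfl | hy) rfl
    · exact huv.ne rfl
    · omega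

theorem IsEdgeBlock.gate_lt {B : Finset V} (hB : G.IsEdgeBlock B) (h : G.EarClosed)
    (hG : G.Connected) {x q : V} (hq : q ∈ B) (hne : q ≠ G.gate B x) :
    G.dist (G.gate B x) x < G.dist q x := by
  have hle := (gate_spec (G := G) hB.nonempty x).2
  refine lt_of_le_of_ne (hle q hq) fun e => ?_
  obtain ⟨w, hw, hlt⟩ := h.exists_closer hG (hB.adj h (hB.gate_mem x) hq hne.symm) e
  rw [← hB.eq h (hB.gate_mem x) hq hne.symm] at hw
  exact absurd (hle w hw) (by omega)

/-- Distances from a clique to `x` differ by at most one and only the gate attains the minimum, so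
one other vertex `q` suffices as reference. This justifies the comparison of two distances in
`demand`. -/
theorem IsEdgeBlock.gate_eq_iff {B : Finset V} (hB : G.IsEdgeBlock B) (h : G.EarClosed)
    (hG : G.Connected) {x p q : V} (hp : p ∈ B) (hq : q ∈ B) (hpq : p ≠ q) :
    G.gate B x = p ↔ G.dist p x < G.dist q x := by
  constructor
  · rintro rfl
    exact hB.gate_lt h hG hq hpq.symm
  · intro hlt
    by_contra hne
    have h1 := hB.gate_lt h hG hp (Ne.symm hne)
    by_cases hq' : q = G.gate B x
    · rw [← hq'] at h1; omega
    · have h2 := hG.dist_triangle (u := q) (v := G.gate B x) (w := x)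
      rw [dist_eq_one_iff_adj.2 (hB.adj h hq (hB.gate_mem x) hq')] at h2
      omega

theorem IsEdgeBlock.gate_self {B : Finset V} (hB : G.IsEdgeBlock B) (hG : G.Connected) {x : V}
    (hx : x ∈ B) : G.gate B x = x := by
  have := (gate_spec (G := G) hB.nonempty x).2 x hx
  rwa [dist_self, Nat.le_zero, hG.dist_eq_zero_iff] at this

/-- Suppose the gates `p` of `x` and `p'` of `y` differ. The neighbour `w` of `p` towards `x` is
linked to `p'` via `x` and `y` without meeting `p`, so `w` is adjacent to `p'` and lies in `B`. It
is closer to `x` than the gate `p`, a contradiction. -/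
theorem IsEdgeBlock.gate_eq_of_adj {B : Finset V} (hB : G.IsEdgeBlock B) (h : G.EarClosed)
    (hG : G.Connected) {x y : V} (hxy : G.Adj x y) (hn : ¬ (x ∈ B ∧ y ∈ B)) :
    G.gate B x = G.gate B y := by
  wlog hx : x ∉ B generalizing x y
  · exact (this hxy.symm (by tauto) (by tauto)).symm
  by_contra hne
  have hp := hB.gate_mem x
  have hp' := hB.gate_mem y
  have hyp : y ≠ G.gate B x :=
    fun e => hne (e.symm.trans (hB.gate_self hG (e ▸ hp)).symm)
  have hlt := hB.gate_lt h hG hp' (Ne.symm hne)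
  have hlt' := hB.gate_lt h hG hp hne
  have hmin := (gate_spec (G := G) hB.nonempty x).2
  generalize G.gate B x = p at *
  generalize G.gate B y = p' at *
  have hxp : x ≠ p := fun e => hx (e ▸ hp)
  obtain ⟨w, hw, hwd⟩ := hG.exists_adj_dist hxp.symm
  have hwp' : G.Adj w p' := by
    refine h hw (hB.adj h hp hp' hne) (by rintro rfl; omega) ?_
    refine ((hG.linked_geodesic w x).mono ?_).trans ((hxy.linked hxp hyp).trans
      ((hG.linked_geodesic p' y).mono ?_).symm)
    · rintro z (rfl | hz) e
      · exact hw.ne e.symm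
      · rw [Set.mem_singleton_iff.1 e] at hz; omega
    · rintro z (rfl | hz) e
      · exact hne e.symm
      · rw [Set.mem_singleton_iff.1 e] at hz; omega
  have hwB : w ∈ B := by
    rw [hB.eq h hp hp' hne]
    exact mem_edgeBlock.2 ⟨.inr hw.symm, .inr hwp'⟩
  have := hmin w hwB
  omega

/-! ### Routing and contraction -/

/-- The pairs `(s i, t i)` can be connected by edge-disjoint subgraphs. -/
def Routable {ι V : Type*} (G : SimpleGraph V) (s t : ι → V) : Prop :=
  ∃ F : ι → SimpleGraph V, (∀ i, F i ≤ G) ∧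
    (∀ i j x y, (F i).Adj x y → (F j).Adj x y → i = j) ∧ ∀ i, (F i).Reachable (s i) (t i)

/-- The gates of the pairs `(s i, t i)` can be connected by edge-disjoint graphs on `B`. -/
def RoutableIn {ι : Type*} (G : SimpleGraph V) (B : Finset V) (s t : ι → V) : Prop :=
  ∃ F : ι → SimpleGraph V, (∀ i x y, (F i).Adj x y → x ∈ B ∧ y ∈ B) ∧
    (∀ i j x y, (F i).Adj x y → (F j).Adj x y → i = j) ∧
    ∀ i, (F i).Reachable (G.gate B (s i)) (G.gate B (t i))

/-- The edges in the blocks of a family. -/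
def blockEdges (G : SimpleGraph V) (res : Finset V → Prop) : SimpleGraph V where
  Adj x y := G.Adj x y ∧ res (G.edgeBlock x y)
  symm := ⟨fun x y h => ⟨h.1.symm, edgeBlock_comm x y ▸ h.2⟩⟩
  loopless := ⟨fun _ h => h.1.ne rfl⟩

/-- `H` is obtained from `G` by contracting the blocks of a family. -/
structure IsContraction {W : Type*} (G : SimpleGraph V) (res : Finset V → Prop) (φ : V → W)
    (H : SimpleGraph W) : Prop where
  surjective : Function.Surjective φ
  eq_iff : ∀ x y, φ x = φ y ↔ (G.blockEdges res).Reachable x y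
  adj_iff : ∀ a b, H.Adj a b ↔ a ≠ b ∧ ∃ x y, G.Adj x y ∧ φ x = a ∧ φ y = b

namespace IsContraction

variable {W : Type*} {res : Finset V → Prop} {φ : V → W} {H : SimpleGraph W}

/-- With nothing contracted, `routable_iff` splits the routing of `G` itself into its blocks. -/
theorem refl (G : SimpleGraph V) : G.IsContraction (fun _ => False) id G where
  surjective := Function.surjective_id
  eq_iff x y := by
    have : G.blockEdges (fun _ => False) = ⊥ := by
      ext; simp [blockEdges]
    rw [this, reachable_bot]; rfl
  adj_iff a b := by
    constructor
    · exact fun h => ⟨h.ne, a, b, h, rfl, rfl⟩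
    · rintro ⟨-, x, y, h, rfl, rfl⟩; exact h

theorem map_eq (hφ : G.IsContraction res φ H)
    {x y : V} (hxy : G.Adj x y) (hr : res (G.edgeBlock x y)) : φ x = φ y :=
  (hφ.eq_iff x y).2 (Adj.reachable ⟨hxy, hr⟩)

/-- A fibre is connected by edges of contracted blocks. None of them lies in `B`, so the gate is
constant on the fibre. -/
theorem gate_eq (hφ : G.IsContraction res φ H) (h : G.EarClosed) (hG : G.Connected)
    {B : Finset V} (hB : G.IsEdgeBlock B) (hr : ¬ res B) {x y : V}
    (hxy : φ x = φ y) : G.gate B x = G.gate B y := by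
  refine ((hφ.eq_iff x y).1 hxy).induction (P := fun y => G.gate B x = G.gate B y) rfl ?_
  intro z w hzw ih
  refine ih.trans (hB.gate_eq_of_adj h hG hzw.1 fun hm => hr ?_)
  rw [hB.eq h hm.1 hm.2 hzw.1.ne]
  exact hzw.2

theorem map_ne (hφ : G.IsContraction res φ H) (h : G.EarClosed) (hG : G.Connected)
    {x y : V} (hxy : G.Adj x y) (hr : ¬ res (G.edgeBlock x y)) : φ x ≠ φ y := by
  intro e
  have := hφ.gate_eq h hG hxy.isEdgeBlock hr e
  rw [hxy.isEdgeBlock.gate_self hG hxy.left_mem_edgeBlock,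
    hxy.isEdgeBlock.gate_self hG hxy.right_mem_edgeBlock] at this
  exact hxy.ne this

/-- The ends of the lifted edge are recovered as the gates, in its block, of any vertices of the
same fibres. So edge-disjointness is not lost under contraction. -/
theorem lift_unique (hφ : G.IsContraction res φ H) (h : G.EarClosed) (hG : G.Connected)
    {x y x' y' : V} (hxy : G.Adj x y) (hxy' : G.Adj x' y') (hx : φ x = φ x')
    (hy : φ y = φ y') (hne : φ x ≠ φ y) : x = x' ∧ y = y' := by
  have hr : ¬ res (G.edgeBlock x y) := fun hr => hne (hφ.map_eq hxy hr)
  have hB := hxy.isEdgeBlock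
  have e1 := hφ.gate_eq h hG hB hr hx
  have e2 := hφ.gate_eq h hG hB hr hy
  rw [hB.gate_self hG hxy.left_mem_edgeBlock] at e1
  rw [hB.gate_self hG hxy.right_mem_edgeBlock] at e2
  by_cases hm : x' ∈ G.edgeBlock x y ∧ y' ∈ G.edgeBlock x y
  · rw [hB.gate_self hG hm.1] at e1
    rw [hB.gate_self hG hm.2] at e2
    exact ⟨e1, e2⟩
  · have := hB.gate_eq_of_adj h hG hxy' hm
    exact absurd (e1.trans (this.trans e2.symm)) hxy.ne

/-- Routing in a contraction is the same as routing in every block that is not contracted. -/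
theorem routable_iff (hφ : G.IsContraction res φ H) (h : G.EarClosed) (hG : G.Connected)
    {ι : Type*} (s t : ι → V) : H.Routable (φ ∘ s) (φ ∘ t) ↔
    ∀ B, G.IsEdgeBlock B → ¬ res B → G.RoutableIn B s t := by
  constructor
  · rintro ⟨F, hFH, hF, hst⟩ B hB hr
    -- The pullback of `F i`, restricted to `B`. Along a walk in `H` the gate in `B` moves only when
    -- the lifted edge lies in `B`, and then along that edge.
    let F' : ι → SimpleGraph V := fun i =>
      { Adj := fun x y => x ∈ B ∧ y ∈ B ∧ (F i).Adj (φ x) (φ y)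
        symm := ⟨fun x y h => ⟨h.2.1, h.1, h.2.2.symm⟩⟩
        loopless := ⟨fun x h => h.2.2.ne rfl⟩ }
    refine ⟨F', fun i x y h => ⟨h.1, h.2.1⟩, fun i j x y h h' => hF i j _ _ h.2.2 h'.2.2,
      fun i => ?_⟩
    refine (hst i).induction (P := fun a => ∀ x, φ x = a →
      (F' i).Reachable (G.gate B (s i)) (G.gate B x)) ?_ ?_ (t i) rfl
    · intro x hx
      rw [hφ.gate_eq h hG hB hr hx]
    · rintro a b hab ih y' hy'
      obtain ⟨-, x, y, hxy, rfl, rfl⟩ := (hφ.adj_iff a b).1 (hFH i hab)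
      rw [hφ.gate_eq h hG hB hr hy']
      refine (ih x rfl).trans ?_
      by_cases hm : x ∈ B ∧ y ∈ B
      · rw [hB.gate_self hG hm.1, hB.gate_self hG hm.2]
        exact Adj.reachable ⟨hm.1, hm.2, hab⟩
      · rw [hB.gate_eq_of_adj h hG hxy hm]
  · intro hB
    choose! F hFB hF hst using hB
    -- The routings of the surviving blocks are glued: an edge of `H` belongs to the route that uses
    -- its unique lift.
    let F' : ι → SimpleGraph W := fun i =>
      { Adj := fun a b => ∃ x y, G.Adj x y ∧ ¬ res (G.edgeBlock x y) ∧ φ x = a ∧ φ y = b ∧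
          (F (G.edgeBlock x y) i).Adj x y
        symm := ⟨fun a b ⟨x, y, h1, h2, h3, h4, h5⟩ =>
          ⟨y, x, h1.symm, edgeBlock_comm x y ▸ h2, h4, h3, edgeBlock_comm x y ▸ h5.symm⟩⟩
        loopless := ⟨fun a ⟨x, y, h1, h2, h3, h4, h5⟩ =>
          hφ.map_ne h hG h1 h2 (h3.trans h4.symm)⟩ }
    refine ⟨F', ?_, ?_, ?_⟩
    · rintro i a b ⟨x, y, h1, h2, h3, h4, h5⟩
      refine (hφ.adj_iff a b).2 ⟨?_, x, y, h1, h3, h4⟩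
      rw [← h3, ← h4]
      exact hφ.map_ne h hG h1 h2
    · rintro i j a b ⟨x, y, h1, h2, rfl, rfl, h5⟩ ⟨x', y', h1', h2', h3', h4', h5'⟩
      obtain ⟨rfl, rfl⟩ := hφ.lift_unique h hG h1 h1' h3'.symm h4'.symm (hφ.map_ne h hG h1 h2)
      exact hF _ h1.isEdgeBlock h2 i j x y h5 h5'
    · intro i
      -- The route follows a geodesic from `s i` to `t i`. In the block of a geodesic edge, the
      -- gates of `s i` and `t i` are the two ends of that edge, so the routing of the block
      -- connects them.
      suffices key : ∀ d x, G.dist x (s i) = d →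
          G.dist x (s i) + G.dist x (t i) = G.dist (s i) (t i) →
          (F' i).Reachable (φ (s i)) (φ x) from
        key _ (t i) rfl (by rw [dist_self, add_zero, dist_comm])
      intro d
      induction d with
      | zero =>
        intro x hx _
        rw [hG.dist_eq_zero_iff] at hx
        rw [hx]
      | succ d ih =>
        intro x hx hgeo
        obtain ⟨w, hw, hwd⟩ := hG.exists_adj_dist (p := x) (x := s i) (by rintro rfl; simp at hx)
        have h1 := hG.dist_triangle (u := s i) (v := w) (w := t i)
        have h2 := hG.dist_triangle (u := w) (v := x) (w := t i)
        rw [dist_eq_one_iff_adj.2 hw.symm] at h2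
        rw [dist_comm (u := s i) (v := w)] at h1
        refine (ih w (by omega) (by omega)).trans ?_
        by_cases hr : res (G.edgeBlock w x)
        · rw [hφ.map_eq hw.symm hr]
        have hB := hw.symm.isEdgeBlock
        have := hst _ hB hr i
        rw [(hB.gate_eq_iff h hG hw.symm.left_mem_edgeBlock hw.symm.right_mem_edgeBlock
          hw.ne').2 (by omega), (hB.gate_eq_iff h hG hw.symm.right_mem_edgeBlock
          hw.symm.left_mem_edgeBlock hw.ne).2 (by omega)] at this
        refine this.induction (P := fun z => (F' i).Reachable (φ w) (φ z)) (.refl _) ?_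
        intro a b hab ih
        have hm := hFB _ hB hr i a b hab
        refine ih.trans (Adj.reachable ⟨a, b, hB.adj h hm.1 hm.2 hab.ne, ?_, rfl, rfl, ?_⟩)
        · rwa [← hB.eq h hm.1 hm.2 hab.ne]
        · rwa [← hB.eq h hm.1 hm.2 hab.ne]

end IsContraction

end

end SimpleGraph

/-! ### Contracting the blocks that can always be routed -/

namespace SimpleGraph

variable {V : Type*} [Fintype V] {G : SimpleGraph V}

open Finset

open Classical in
/-- The common neighbours of two vertices. -/
noncomputable def commonNbrs (G : SimpleGraph V) (u v : V) : Finset V :=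
  univ.filter fun w => G.Adj u w ∧ G.Adj v w

theorem mem_commonNbrs {u v w : V} : w ∈ G.commonNbrs u v ↔ G.Adj u w ∧ G.Adj v w := by
  simp [commonNbrs]

theorem Adj.mem_edgeBlock_iff {u v : V} (h : G.Adj u v) (w : V) :
    w ∈ G.edgeBlock u v ↔ w = u ∨ w = v ∨ w ∈ G.commonNbrs u v := by
  rw [mem_edgeBlock, mem_commonNbrs]
  constructor
  · rintro ⟨h1 | h1, h2 | h2⟩
    · exact .inl h1
    · exact .inl h1
    · exact .inr (.inl h2)
    · exact .inr (.inr ⟨h1.symm, h2.symm⟩)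
  · rintro (rfl | rfl | ⟨h1, h2⟩)
    · exact ⟨.inl rfl, .inr h⟩
    · exact ⟨.inr h.symm, .inl rfl⟩
    · exact ⟨.inr h1.symm, .inr h2.symm⟩

theorem Adj.card_edgeBlock {u v : V} (h : G.Adj u v) :
    (G.edgeBlock u v).card = (G.commonNbrs u v).card + 2 := by
  classical
  have : G.edgeBlock u v = insert u (insert v (G.commonNbrs u v)) := by
    ext w; simp [h.mem_edgeBlock_iff]
  rw [this, card_insert_of_notMem, card_insert_of_notMem]
  · simp [mem_commonNbrs]
  · simp [mem_commonNbrs, h.ne]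

/-! ### Demands and resolved blocks -/

variable {ι : Type*} [Fintype ι]

open Classical in
/-- The number of pairs that have to use an edge at `u` of the block of the edge `uv`. -/
noncomputable def demand (G : SimpleGraph V) (s t : ι → V) (u v : V) : ℕ :=
  (univ.filter fun i => ¬ (G.dist u (s i) < G.dist v (s i) ↔
    G.dist u (t i) < G.dist v (t i))).card

/-- The block of the edge `uv` has few terminals other than `u` and `v`. -/
def Sparse (G : SimpleGraph V) (s t : ι → V) (u v : V) : Prop :=
  G.Adj u v ∧ ∑ w ∈ G.commonNbrs u v, G.demand s t w u ≤ (G.commonNbrs u v).card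

/-- A block that can be routed unless one of its vertices is overloaded. -/
def Resolved (G : SimpleGraph V) (s t : ι → V) (B : Finset V) : Prop :=
  ∃ u ∈ B, ∃ v ∈ B, G.Sparse s t u v

/-- Some vertex has too small a degree in some block. -/
def Overloaded (G : SimpleGraph V) (s t : ι → V) : Prop :=
  ∃ u v, G.Adj u v ∧ (G.commonNbrs u v).card + 1 < G.demand s t u v

variable {s t : ι → V}

-- Within a block the demand at `u` does not depend on the reference vertex `v`.
open Classical in
theorem IsEdgeBlock.demand_eq {B : Finset V} (hB : G.IsEdgeBlock B) (h : G.EarClosed)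
    (hG : G.Connected) {u v : V} (hu : u ∈ B) (hv : v ∈ B) (huv : u ≠ v) :
    G.demand s t u v =
      (univ.filter fun i => ¬ (G.gate B (s i) = u ↔ G.gate B (t i) = u)).card := by
  rw [demand]
  congr 1
  ext i
  simp only [mem_filter, hB.gate_eq_iff h hG hu hv huv]

/-- `exists_clique_routing` is applied with `Q` the common neighbours of `c` and `c'`. The slots at
a vertex of `Q` number at most its demand, so sparsity bounds them in total; the absence of overload
gives the conditions at `c` and `c'`. -/
theorem Resolved.routableIn {B : Finset V} (hr : G.Resolved s t B) (hB : G.IsEdgeBlock B)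
    (h : G.EarClosed) (hG : G.Connected) (ho : ¬ G.Overloaded s t) : G.RoutableIn B s t := by
  classical
  obtain ⟨c, hc, c', hc', hcc, hsum⟩ := hr
  have hBe := hB.eq h hc hc' hcc.ne
  have hmem : ∀ w, w ∈ B ↔ w = c ∨ w = c' ∨ w ∈ G.commonNbrs c c' := by
    rw [hBe]; exact hcc.mem_edgeBlock_iff
  simp only [Overloaded, not_exists, not_and, not_lt] at ho
  have hcomm : G.commonNbrs c' c = G.commonNbrs c c' := by
    ext; simp only [mem_commonNbrs]; tauto
  have h1 := ho c c' hcc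
  have h2 := ho c' c hcc.symm
  rw [hcomm] at h2
  rw [hB.demand_eq h hG hc hc' hcc.ne] at h1
  rw [hB.demand_eq h hG hc' hc hcc.ne'] at h2
  let g : ι → Bool → V := fun i b => G.gate B (if b then t i else s i)
  have hQ : (univ.filter fun σ : ι × Bool => g σ.1 σ.2 ∈ G.commonNbrs c c' ∧
      g σ.1 σ.2 ≠ g σ.1 (!σ.2)).card ≤ (G.commonNbrs c c').card := by
    refine le_trans ?_ hsum
    rw [card_eq_sum_card_fiberwise (f := fun σ : ι × Bool => g σ.1 σ.2)
      (t := G.commonNbrs c c') (fun σ hσ => (mem_filter.1 hσ).2.1)]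
    refine sum_le_sum fun w hw => ?_
    rw [hB.demand_eq h hG ((hmem w).2 (.inr (.inr hw))) hc (mem_commonNbrs.1 hw).1.ne']
    refine card_le_card_of_injOn Prod.fst ?_ ?_
    · rintro ⟨i, b⟩ hσ
      simp only [coe_filter, mem_filter, mem_univ, true_and, Set.mem_ofPred_eq, g] at hσ ⊢
      cases b <;> grind
    · rintro ⟨i, b⟩ hσ ⟨j, b'⟩ hτ e
      obtain rfl : i = j := e
      simp only [coe_filter, mem_filter, mem_univ, true_and, Set.mem_ofPred_eq, g] at hσ hτ
      cases b <;> cases b' <;> grind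
  obtain ⟨F, hFB, hF, hst⟩ := exists_clique_routing (G.commonNbrs c c') c c' hcc.ne
    (by simp [mem_commonNbrs]) (by simp [mem_commonNbrs]) g
    (fun i b => (hmem _).1 (hB.gate_mem _)) hQ (by simpa [g] using h1) (by simpa [g] using h2)
  refine ⟨F, fun i x y hxy => ?_, hF, fun i => by simpa [g] using hst i⟩
  simpa [hmem] using hFB i x y hxy

/-- Each pair with exactly one gate at `u` needs an edge of its own at `u` inside the block, and
there are only `(commonNbrs u v).card + 1` such edges. -/
theorem Overloaded.not_routable (ho : G.Overloaded s t) (h : G.EarClosed) (hG : G.Connected) :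
    ¬ G.Routable s t := by
  classical
  intro hR
  obtain ⟨u, v, huv, hlt⟩ := ho
  have hB := huv.isEdgeBlock
  obtain ⟨F, hFB, hF, hst⟩ :=
    ((IsContraction.refl G).routable_iff h hG s t).1 hR _ hB not_false
  rw [hB.demand_eq h hG huv.left_mem_edgeBlock huv.right_mem_edgeBlock huv.ne] at hlt
  have key : ∀ {x : V} {K : SimpleGraph V}, K.Reachable u x → x ≠ u → ∃ y, K.Adj u y := by
    rintro x K ⟨p⟩ hx
    cases p with
    | nil => exact absurd rfl hx
    | cons h _ => exact ⟨_, h⟩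
  have hex : ∀ i, ∃ y, ¬ (G.gate (G.edgeBlock u v) (s i) = u ↔
      G.gate (G.edgeBlock u v) (t i) = u) → (F i).Adj u y := by
    intro i
    by_cases hi : G.gate (G.edgeBlock u v) (s i) = u ↔ G.gate (G.edgeBlock u v) (t i) = u
    · exact ⟨u, fun hn => absurd hi hn⟩
    · have hr := hst i
      by_cases hs : G.gate (G.edgeBlock u v) (s i) = u
      · rw [hs] at hr
        obtain ⟨y, hy⟩ := key hr (by tauto)
        exact ⟨y, fun _ => hy⟩
      · have ht : G.gate (G.edgeBlock u v) (t i) = u := by tauto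
        rw [ht] at hr
        obtain ⟨y, hy⟩ := key hr.symm hs
        exact ⟨y, fun _ => hy⟩
  choose y hy using hex
  have hle := card_le_card_of_injOn (s := univ.filter fun i =>
      ¬ (G.gate (G.edgeBlock u v) (s i) = u ↔ G.gate (G.edgeBlock u v) (t i) = u))
      (t := (G.edgeBlock u v).erase u) y
    (fun i hi => by
      have := hy i (by simpa using hi)
      simpa [this.ne'] using (hFB i _ _ this).2)
    (fun i hi j hj e => by
      have h1 := hy i (by simpa using hi)
      have h2 := hy j (by simpa using hj)
      rw [← e] at h2
      exact hF i j _ _ h1 h2)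
  rw [card_erase_of_mem huv.left_mem_edgeBlock, huv.card_edgeBlock] at hle
  omega

/-! ### Contractions of clique paths -/

section Contraction

variable {W : Type*} {φ : V → W} {H : SimpleGraph W}

theorem IsContraction.routable_resolved_iff (hφ : G.IsContraction (G.Resolved s t) φ H)
    (h : G.EarClosed) (hG : G.Connected) (ho : ¬ G.Overloaded s t) :
    G.Routable s t ↔ H.Routable (φ ∘ s) (φ ∘ t) := by
  rw [hφ.routable_iff h hG]
  have := (IsContraction.refl G).routable_iff h hG s t
  rw [Function.id_comp, Function.id_comp] at this
  rw [this]
  constructor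
  · exact fun hB B hBe _ => hB B hBe not_false
  · intro hB B hBe _
    by_cases hr : G.Resolved s t B
    · exact hr.routableIn hBe h hG ho
    · exact hB B hBe hr

theorem IsContraction.connected {res : Finset V → Prop} (hφ : G.IsContraction res φ H)
    (hG : G.Connected) : H.Connected := by
  have := hG.nonempty.map φ
  refine ⟨fun a b => ?_⟩
  obtain ⟨x, rfl⟩ := hφ.surjective a
  obtain ⟨y, rfl⟩ := hφ.surjective b
  refine (hG.preconnected x y).induction (P := fun y => H.Reachable (φ x) (φ y)) (.refl _) ?_
  intro z w hzw ih
  by_cases e : φ z = φ w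
  · rwa [← e]
  · exact ih.trans (Adj.reachable ((hφ.adj_iff _ _).2 ⟨e, z, w, hzw, rfl, rfl⟩))

/-- The two edges at `c` lift to edges `yx` and `y'x'` of `G`. Along a walk avoiding `c = φ y`, the
gate in the block of `yx` never becomes `y`. If `y'x'` lay outside that block, the gate of `x'`
would equal that of `y'`, which is `y`. So both lifts lie in one block and `x`, `x'` are adjacent.
-/
theorem IsContraction.earClosed {res : Finset V → Prop} (hφ : G.IsContraction res φ H)
    (h : G.EarClosed) (hG : G.Connected) : H.EarClosed := by
  intro c a b hca hcb hab hl
  obtain ⟨-, y, x, hyx, rfl, rfl⟩ := (hφ.adj_iff _ _).1 hca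
  obtain ⟨-, y', x', hyx', hy', rfl⟩ := (hφ.adj_iff _ _).1 hcb
  have hB := hyx.isEdgeBlock
  have hr : ¬ res (G.edgeBlock y x) := fun hr => hca.ne (hφ.map_eq hyx hr)
  have hP := hl.induction (P := fun d => ∀ z, φ z = d → G.gate (G.edgeBlock y x) z ≠ y) ?_ ?_ x' rfl
  · have e : G.gate (G.edgeBlock y x) y' = y := by
      rw [hφ.gate_eq h hG hB hr hy', hB.gate_self hG hyx.left_mem_edgeBlock]
    have hm : y' ∈ G.edgeBlock y x ∧ x' ∈ G.edgeBlock y x := by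
      by_contra hm
      exact hP ((hB.gate_eq_of_adj h hG hyx' hm).symm.trans e)
    refine (hφ.adj_iff _ _).2 ⟨hab, x, x', hB.adj h hyx.right_mem_edgeBlock hm.2 ?_, rfl, rfl⟩
    rintro rfl
    exact hab rfl
  · intro z hz
    rw [hφ.gate_eq h hG hB hr hz, hB.gate_self hG hyx.right_mem_edgeBlock]
    exact hyx.ne'
  · intro d e hd he hde ih z hz
    obtain ⟨-, p, q, hpq, rfl, rfl⟩ := (hφ.adj_iff _ _).1 hde
    rw [hφ.gate_eq h hG hB hr hz]
    by_cases hm : p ∈ G.edgeBlock y x ∧ q ∈ G.edgeBlock y x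
    · rw [hB.gate_self hG hm.2]
      rintro rfl
      exact he rfl
    · rw [← hB.gate_eq_of_adj h hG hpq hm]
      exact ih p rfl

/-- If the neighbours of `x` are pairwise adjacent, all edges at `x` lie in the surviving block of
`xy`. Then the fibre of `x` is a single vertex, and its neighbours stay equal or adjacent after
contraction. -/
theorem IsContraction.branching {res : Finset V → Prop} (hφ : G.IsContraction res φ H)
    (h : G.EarClosed) {x y : V} (hxy : G.Adj x y) (hr : ¬ res (G.edgeBlock x y))
    (hb : H.Branching (φ x)) : G.Branching x := by
  by_contra hx
  simp only [Branching, not_exists, not_and, not_not] at hx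
  have fib : ∀ z, φ z = φ x → z = x := by
    intro z hz
    by_contra hne
    obtain ⟨p⟩ := (hφ.eq_iff x z).1 hz.symm
    cases p with
    | nil => exact hne rfl
    | @cons _ x' _ hx' _ =>
      have hne' : x' ≠ y := by
        rintro rfl
        exact hr hx'.2
      have hm : x' ∈ G.edgeBlock x y :=
        mem_edgeBlock.2 ⟨.inr hx'.1.symm, .inr (hx x' y hx'.1 hxy hne')⟩
      refine hr ?_
      rw [← h.edgeBlock_eq hxy hxy.left_mem_edgeBlock hm hx'.1.ne]
      exact hx'.2
  obtain ⟨a, b, ha, hb, hab, hn⟩ := hb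
  obtain ⟨-, x₁, p, hp, h1, rfl⟩ := (hφ.adj_iff _ _).1 ha
  obtain ⟨-, x₂, q, hq, h2, rfl⟩ := (hφ.adj_iff _ _).1 hb
  rw [fib _ h1] at hp
  rw [fib _ h2] at hq
  refine hn ((hφ.adj_iff _ _).2 ⟨hab, p, q, hx p q hp hq ?_, rfl, rfl⟩)
  rintro rfl
  exact hab rfl

/-- Comparing gates shows that a triangle of the contraction lifts to a triangle in one surviving
block, and its branching vertices lift to branching vertices. -/
theorem IsContraction.isCliquePath [Finite W] {res : Finset V → Prop}
    (hφ : G.IsContraction res φ H) (hG : G.IsCliquePath) : H.IsCliquePath := by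
  rw [isCliquePath_iff] at hG ⊢
  obtain ⟨hG, h, ht⟩ := hG
  refine ⟨hφ.connected hG, hφ.earClosed h hG, ?_⟩
  rintro a b c hab hbc hac ⟨ha, hb, hc⟩
  obtain ⟨-, x, y, hxy, rfl, rfl⟩ := (hφ.adj_iff _ _).1 hab
  obtain ⟨-, y', z, hyz, hy', rfl⟩ := (hφ.adj_iff _ _).1 hbc
  obtain ⟨-, x', z', hxz, hx', hz'⟩ := (hφ.adj_iff _ _).1 hac
  have hB := hxy.isEdgeBlock
  have hr : ¬ res (G.edgeBlock x y) := fun hr => hab.ne (hφ.map_eq hxy hr)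
  have hz : z ∈ G.edgeBlock x y := by
    by_contra hz
    have e1 := hB.gate_eq_of_adj h hG hyz (fun hm => hz hm.2)
    rw [hφ.gate_eq h hG hB hr hy', hB.gate_self hG hxy.right_mem_edgeBlock] at e1
    have hm : x' ∈ G.edgeBlock x y ∧ z' ∈ G.edgeBlock x y := by
      by_contra hm
      have e2 := hB.gate_eq_of_adj h hG hxz hm
      rw [hφ.gate_eq h hG hB hr hx', hφ.gate_eq h hG hB hr hz', ← e1,
        hB.gate_self hG hxy.left_mem_edgeBlock] at e2
      exact hxy.ne e2
    have e3 := hφ.gate_eq h hG hB hr hz'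
    rw [hB.gate_self hG hm.2, ← e1] at e3
    rw [e3] at hz'
    exact hbc.ne hz'
  have hxz' : G.Adj x z := hB.adj h hxy.left_mem_edgeBlock hz (by rintro rfl; exact hac.ne rfl)
  have hyz' : G.Adj y z := hB.adj h hxy.right_mem_edgeBlock hz (by rintro rfl; exact hbc.ne rfl)
  refine ht x y z hxy hyz' hxz' ⟨hφ.branching h hxy hr ha,
    hφ.branching h hxy.symm (edgeBlock_comm x y ▸ hr) hb, hφ.branching h hxz'.symm ?_ hc⟩
  rwa [← hB.eq h hz hxy.left_mem_edgeBlock hxz'.ne']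

end Contraction

/-! ### Size of the contraction -/

/-- All neighbours of `w` lie in `B`. So a geodesic from `w` to another vertex `x` continues inside
`B`, and `w` is not nearest to `x`. -/
theorem IsEdgeBlock.gate_eq_iff_of_not_branching {B : Finset V} (hB : G.IsEdgeBlock B)
    (h : G.EarClosed) (hG : G.Connected) {w x : V} (hw : w ∈ B) (hb : ¬ G.Branching w) :
    G.gate B x = w ↔ x = w := by
  constructor
  · intro e
    by_contra hx
    obtain ⟨y, hy, hyd⟩ := hG.exists_adj_dist (Ne.symm hx)
    have hmin := (gate_spec (G := G) hB.nonempty x).2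
    rw [e] at hmin
    obtain ⟨q, hq, hqw⟩ : ∃ q ∈ B, w ≠ q := by
      obtain ⟨u, v, huv, rfl⟩ := hB
      by_cases hu : w = u
      · exact ⟨v, huv.right_mem_edgeBlock, hu ▸ huv.ne⟩
      · exact ⟨u, huv.left_mem_edgeBlock, hu⟩
    have hyq : y ≠ q := by
      rintro rfl
      have := hmin _ hq
      omega
    simp only [Branching, not_exists, not_and, not_not] at hb
    have hyB : y ∈ B := by
      rw [hB.eq h hw hq hqw]
      exact mem_edgeBlock.2 ⟨.inr hy.symm, .inr (hb y q hy (hB.adj h hw hq hqw) hyq)⟩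
    have := hmin _ hyB
    omega
  · rintro rfl
    exact hB.gate_self hG hw

/-- The neighbours of `w` are pairwise adjacent, so all edges at `w` span the same block. This lets
each terminal be charged to one block only. -/
theorem IsEdgeBlock.eq_of_not_branching {B B' : Finset V} (hB : G.IsEdgeBlock B)
    (hB' : G.IsEdgeBlock B') (h : G.EarClosed) {w : V} (hw : w ∈ B) (hw' : w ∈ B')
    (hb : ¬ G.Branching w) : B = B' := by
  have other : ∀ {B : Finset V}, G.IsEdgeBlock B → ∃ q ∈ B, w ≠ q := by
    rintro _ ⟨u, v, huv, rfl⟩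
    by_cases hu : w = u
    · exact ⟨v, huv.right_mem_edgeBlock, hu ▸ huv.ne⟩
    · exact ⟨u, huv.left_mem_edgeBlock, hu⟩
  simp only [Branching, not_exists, not_and, not_not] at hb
  obtain ⟨q, hq, hwq⟩ := other hB
  obtain ⟨q', hq', hwq'⟩ := other hB'
  have a := hB.adj h hw hq hwq
  have a' := hB'.adj h hw' hq' hwq'
  have hm : q' ∈ B := by
    rw [hB.eq h hw hq hwq, mem_edgeBlock]
    exact ⟨.inr a'.symm, or_iff_not_imp_left.2 fun hne => hb q' q a' a hne⟩
  rw [hB.eq h hw hm hwq', hB'.eq h hw' hq' hwq']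

open Classical in
/-- In a block that is not resolved, the vertices that are not cut vertices carry many terminals. -/
theorem IsEdgeBlock.card_le_of_not_resolved {B : Finset V} (hB : G.IsEdgeBlock B)
    (hG : G.IsCliquePath) (hr : ¬ G.Resolved s t B) :
    B.card - 1 ≤ (univ.filter fun σ : ι × Bool => (if σ.2 then t σ.1 else s σ.1) ∈ B ∧
      ¬ G.Branching (if σ.2 then t σ.1 else s σ.1)).card := by
  obtain ⟨hG, h, ht⟩ := isCliquePath_iff.1 hG
  -- No triangle consists of branching vertices, so `c` and `c'` can be chosen to include every
  -- branching vertex of `B`.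
  obtain ⟨c, hc, c', hc', hcc, hnb⟩ : ∃ c ∈ B, ∃ c' ∈ B, G.Adj c c' ∧
      ∀ w ∈ G.commonNbrs c c', ¬ G.Branching w := by
    have two : ∀ a ∈ B, ∃ b ∈ B, a ≠ b := by
      intro a _
      obtain ⟨u, v, huv, rfl⟩ := hB
      by_cases hu : a = u
      · exact ⟨v, huv.right_mem_edgeBlock, hu ▸ huv.ne⟩
      · exact ⟨u, huv.left_mem_edgeBlock, hu⟩
    have hcn : ∀ {a b w : V}, a ∈ B → b ∈ B → G.Adj a b → w ∈ G.commonNbrs a b → w ∈ B := by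
      intro a b w ha hb hab hw
      rw [hB.eq h ha hb hab.ne, hab.mem_edgeBlock_iff]
      exact .inr (.inr hw)
    by_cases h1 : ∃ c ∈ B, G.Branching c
    · obtain ⟨c, hc, hcb⟩ := h1
      by_cases h2 : ∃ c' ∈ B, c ≠ c' ∧ G.Branching c'
      · obtain ⟨c', hc', hne, hcb'⟩ := h2
        refine ⟨c, hc, c', hc', hB.adj h hc hc' hne, fun w hw hwb => ?_⟩
        rw [mem_commonNbrs] at hw
        exact ht c c' w (hB.adj h hc hc' hne) hw.2 hw.1 ⟨hcb, hcb', hwb⟩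
      · obtain ⟨c', hc', hne⟩ := two c hc
        refine ⟨c, hc, c', hc', hB.adj h hc hc' hne, fun w hw hwb => h2 ⟨w, ?_, ?_, hwb⟩⟩
        · exact hcn hc hc' (hB.adj h hc hc' hne) hw
        · exact (mem_commonNbrs.1 hw).1.ne
    · obtain ⟨c, hc⟩ := hB.nonempty
      obtain ⟨c', hc', hne⟩ := two c hc
      exact ⟨c, hc, c', hc', hB.adj h hc hc' hne, fun w hw hwb =>
        h1 ⟨w, hcn hc hc' (hB.adj h hc hc' hne) hw, hwb⟩⟩
  have hlt : (G.commonNbrs c c').card < ∑ w ∈ G.commonNbrs c c', G.demand s t w c := by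
    by_contra hle
    exact hr ⟨c, hc, c', hc', hcc, not_lt.1 hle⟩
  have hcard : B.card = (G.commonNbrs c c').card + 2 := by
    rw [hB.eq h hc hc' hcc.ne, hcc.card_edgeBlock]
  have hmem : ∀ w ∈ G.commonNbrs c c', w ∈ B := by
    intro w hw
    rw [hB.eq h hc hc' hcc.ne, hcc.mem_edgeBlock_iff]
    exact .inr (.inr hw)
  -- `B.card - 1` is the number of common neighbours plus one, and `B` is not resolved, so the sum
  -- of the demands exceeds that number.
  refine le_trans (by omega : B.card - 1 ≤ ∑ w ∈ G.commonNbrs c c', G.demand s t w c) ?_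
  calc ∑ w ∈ G.commonNbrs c c', G.demand s t w c
      ≤ ∑ w ∈ G.commonNbrs c c', ((univ.filter fun σ : ι × Bool =>
          (if σ.2 then t σ.1 else s σ.1) ∈ G.commonNbrs c c').filter
            fun σ => (if σ.2 then t σ.1 else s σ.1) = w).card := by
        refine sum_le_sum fun w hw => ?_
        rw [hB.demand_eq h hG (hmem w hw) hc (mem_commonNbrs.1 hw).1.ne']
        simp only [hB.gate_eq_iff_of_not_branching h hG (hmem w hw) (hnb w hw)]
        -- The Boolean points to the end of the pair that lies at `w`.
        refine card_le_card_of_injOn (fun i => (i, decide (t i = w))) ?_ ?_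
        · intro i hi
          simp only [coe_filter, mem_filter, mem_univ, true_and, Set.mem_ofPred_eq,
            decide_eq_true_eq] at hi ⊢
          by_cases h1 : t i = w
          · simp [h1, hw]
          · have : s i = w := by tauto
            simp [h1, this, hw]
        · intro i _ j _ e
          exact congrArg Prod.fst e
    _ = (univ.filter fun σ : ι × Bool =>
          (if σ.2 then t σ.1 else s σ.1) ∈ G.commonNbrs c c').card :=
        (card_eq_sum_card_fiberwise fun σ hσ => (mem_filter.1 hσ).2).symm
    _ ≤ _ := by
        refine card_le_card fun σ hσ => ?_
        rw [mem_filter] at hσ ⊢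
        exact ⟨hσ.1, hmem _ hσ.2, hnb _ hσ.2⟩

/-- The contraction of all resolved blocks is small. -/
theorem IsContraction.card_le {W : Type*} [Fintype W] {φ : V → W} {H : SimpleGraph W}
    (hφ : G.IsContraction (G.Resolved s t) φ H) (hG : G.IsCliquePath) :
    Fintype.card W ≤ 2 * Fintype.card ι + 1 := by
  classical
  obtain ⟨hGc, h, -⟩ := isCliquePath_iff.1 hG
  obtain ⟨r⟩ := hGc.nonempty
  set U : Finset (Finset V) := univ.filter fun B => G.IsEdgeBlock B ∧ ¬ G.Resolved s t B with hU
  -- For the root `r`, a class without `r` is charged to its vertex `v` nearest to `r`, in the block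
  -- of the first edge of a geodesic from `v` to `r`. That edge leaves the class, so the block
  -- survives, and `v` is not the gate of `r`. The class of `r` gets the dummy block `∅`.
  have hex : ∀ a : W, ∃ p : (_ : Finset V) × V, φ p.2 = a ∧ (a ≠ φ r →
      p ∈ U.sigma fun B => B.erase (G.gate B r)) := by
    intro a
    obtain ⟨v, hv, hmin⟩ := exists_min_image (univ.filter fun v => φ v = a)
      (fun v => G.dist v r) (by
        obtain ⟨v, hv⟩ := hφ.surjective a
        exact ⟨v, by simpa using hv⟩)
    simp only [mem_filter, mem_univ, true_and] at hv hmin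
    by_cases ha : a = φ r
    · exact ⟨⟨∅, v⟩, hv, fun h => absurd ha h⟩
    have hvr : v ≠ r := by
      rintro rfl
      exact ha hv.symm
    obtain ⟨w, hw, hwd⟩ := hGc.exists_adj_dist hvr
    refine ⟨⟨G.edgeBlock v w, v⟩, hv, fun _ => ?_⟩
    have hB := hw.isEdgeBlock
    rw [mem_sigma, hU, mem_filter, mem_erase]
    refine ⟨⟨mem_univ _, hB, fun hr => ?_⟩, ?_, hw.left_mem_edgeBlock⟩
    · have := hmin w ((hφ.map_eq hw hr).symm.trans hv)
      omega
    · rw [(hB.gate_eq_iff h hGc hw.right_mem_edgeBlock hw.left_mem_edgeBlock hw.ne').2 (by omega)]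
      exact hw.ne
  choose p hp hpU using hex
  have h1 : ((univ : Finset W).erase (φ r)).card ≤ (U.sigma fun B => B.erase (G.gate B r)).card := by
    refine card_le_card_of_injOn p (fun a ha => hpU a (ne_of_mem_erase ha)) fun a _ b _ e => ?_
    rw [← hp a, ← hp b, e]
  have h2 : (U.sigma fun B => B.erase (G.gate B r)).card ≤ (U.sigma fun B =>
      univ.filter fun σ : ι × Bool => (if σ.2 then t σ.1 else s σ.1) ∈ B ∧
        ¬ G.Branching (if σ.2 then t σ.1 else s σ.1)).card := by
    rw [card_sigma, card_sigma]
    refine sum_le_sum fun B hB => ?_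
    rw [hU, mem_filter] at hB
    rw [card_erase_of_mem (hB.2.1.gate_mem r)]
    exact hB.2.1.card_le_of_not_resolved hG hB.2.2
  -- A terminal at a vertex that is not branching lies in only one block, so no terminal is counted
  -- twice.
  have h3 : (U.sigma fun B =>
      univ.filter fun σ : ι × Bool => (if σ.2 then t σ.1 else s σ.1) ∈ B ∧
        ¬ G.Branching (if σ.2 then t σ.1 else s σ.1)).card ≤ Fintype.card (ι × Bool) := by
    refine card_le_card_of_injOn (t := univ) Sigma.snd (fun _ _ => mem_univ _) ?_
    rintro ⟨B, σ⟩ hx ⟨B', σ'⟩ hy e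
    obtain rfl : σ = σ' := e
    rw [mem_coe, mem_sigma, hU, mem_filter, mem_filter] at hx hy
    obtain rfl : B = B' := hx.1.2.1.eq_of_not_branching hy.1.2.1 h hx.2.2.1 hy.2.2.1 hx.2.2.2
    rfl
  rw [card_erase_of_mem (mem_univ _), card_univ] at h1
  rw [Fintype.card_prod, Fintype.card_bool] at h3
  omega

end SimpleGraph

/-! ### Instances, words, and ranks -/

namespace SimpleGraph

/-- An edge `xy` on a geodesic from `u` to `v` separates their gates in its block, so a walk of
contracted edges requires that block to be contracted; conversely, a geodesic is itself such a walk.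
Reachability thus becomes a condition on the distance table. -/
theorem blockEdges_reachable_iff {V : Type*} [Fintype V] {G : SimpleGraph V} (h : G.EarClosed)
    (hG : G.Connected) (res : Finset V → Prop) (u v : V) :
    (G.blockEdges res).Reachable u v ↔ ∀ x y, G.Adj x y →
      G.dist u x + 1 + G.dist y v = G.dist u v → res (G.edgeBlock x y) := by
  constructor
  · intro hr x y hxy hd
    by_contra hn
    have hB := hxy.isEdgeBlock
    have e : G.gate (G.edgeBlock x y) u = G.gate (G.edgeBlock x y) v := by
      refine hr.induction (P := fun v => G.gate (G.edgeBlock x y) u = G.gate _ v) rfl ?_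
      intro z w hzw ih
      refine ih.trans (hB.gate_eq_of_adj h hG hzw.1 fun hm => hn ?_)
      rw [hB.eq h hm.1 hm.2 hzw.1.ne]
      exact hzw.2
    have h1 := hG.dist_triangle (u := u) (v := y) (w := v)
    have h2 := hG.dist_triangle (u := u) (v := x) (w := v)
    have e1 : G.gate (G.edgeBlock x y) u = x := by
      rw [hB.gate_eq_iff h hG hxy.left_mem_edgeBlock hxy.right_mem_edgeBlock hxy.ne,
        dist_comm, dist_comm (u := y)]
      omega
    have e2 : G.gate (G.edgeBlock x y) v = y := by
      rw [hB.gate_eq_iff h hG hxy.right_mem_edgeBlock hxy.left_mem_edgeBlock hxy.ne']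
      omega
    exact hxy.ne (e1.symm.trans (e.trans e2))
  · intro hres
    suffices key : ∀ d x, G.dist x u = d → G.dist u x + G.dist x v = G.dist u v →
        (G.blockEdges res).Reachable u x from key _ v rfl (by rw [dist_self, add_zero])
    intro d
    induction d with
    | zero =>
      intro x hx _
      rw [hG.dist_eq_zero_iff] at hx
      rw [hx]
    | succ d ih =>
      intro x hx hgeo
      obtain ⟨w, hw, hwd⟩ := hG.exists_adj_dist (p := x) (x := u) (by rintro rfl; simp at hx)
      have h1 := hG.dist_triangle (u := u) (v := w) (w := v)
      have h2 := hG.dist_triangle (u := w) (v := x) (w := v)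
      rw [dist_eq_one_iff_adj.2 hw.symm] at h2
      rw [dist_comm (u := u) (v := w)] at h1
      rw [dist_comm (u := u) (v := x)] at hgeo
      refine (ih w (by omega) (by rw [dist_comm (u := u) (v := w)]; omega)).trans
        (Adj.reachable ⟨hw.symm, hres w x hw.symm ?_⟩)
      rw [dist_comm (u := u) (v := w)]
      omega

/-- Pairs with coinciding ends receive the empty graph and may be dropped. -/
theorem routable_comp_iff {V ι κ : Type*} {G : SimpleGraph V} {s t : ι → V} {e : κ → ι}
    (he : Function.Injective e) (h : ∀ i, s i ≠ t i → i ∈ Set.range e) :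
    G.Routable (s ∘ e) (t ∘ e) ↔ G.Routable s t := by
  classical
  constructor
  · rintro ⟨F, hFG, hF, hst⟩
    refine ⟨fun i => if hi : i ∈ Set.range e then F hi.choose else ⊥, fun i => ?_, ?_, fun i => ?_⟩
    · beta_reduce
      split_ifs
      · exact hFG _
      · exact bot_le
    · intro i j x y hi hj
      beta_reduce at hi hj
      split_ifs at hi hj with h1 h2
      · rw [← h1.choose_spec, ← h2.choose_spec, hF _ _ x y hi hj]
      all_goals simp at hi hj
    · beta_reduce
      split_ifs with hi
      · have := hst hi.choose
        rwa [Function.comp, Function.comp, hi.choose_spec] at this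
      · by_cases hne : s i = t i
        · rw [hne]
        · exact absurd (h i hne) hi
  · rintro ⟨F, hFG, hF, hst⟩
    exact ⟨F ∘ e, fun i => hFG _, fun i j x y hi hj => he (hF _ _ x y hi hj), fun i => hst _⟩

theorem Connected.dist_lt_card {V : Type*} [Fintype V] {G : SimpleGraph V} (hG : G.Connected)
    (u v : V) : G.dist u v < Fintype.card V := by
  obtain ⟨p, hp, hd⟩ := hG.exists_path_of_dist u v
  exact hd ▸ hp.length_lt

end SimpleGraph

namespace EDPInstance

open SimpleGraph

/-- A path may be replaced by the graph of its edges, and a connecting subgraph by a path inside it.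
Subgraphs are easier to pull back and glue. -/
theorem isYes_iff (I : EDPInstance) : I.IsYes ↔ I.G.Routable I.s I.t := by
  classical
  constructor
  · rintro ⟨P, -, hP⟩
    refine ⟨fun i => fromEdgeSet {e | e ∈ (P i).edges}, fun i x y h => ?_, ?_, fun i => ?_⟩
    · exact (P i).adj_of_mem_edges ((fromEdgeSet_adj _).1 h).1
    · intro i j x y hi hj
      by_contra hij
      exact hP i j hij ((fromEdgeSet_adj _).1 hi).1 ((fromEdgeSet_adj _).1 hj).1
    · refine ⟨(P i).transfer _ fun e he => ?_⟩
      rw [edgeSet_fromEdgeSet]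
      exact ⟨he, fun hd => I.G.not_isDiag_of_mem_edgeSet ((P i).edges_subset_edgeSet he) hd⟩
  · rintro ⟨F, hFG, hF, hst⟩
    have hw : ∀ i, ∃ p : (F i).Walk (I.s i) (I.t i), p.IsPath := fun i => by
      obtain ⟨p⟩ := hst i
      exact ⟨p.toPath.1, p.toPath.2⟩
    choose p hp using hw
    refine ⟨fun i => (p i).mapLe (hFG i), fun i => (hp i).mapLe _, fun i j hij e hi hj => hij ?_⟩
    rw [Walk.edges_mapLe_eq_edges] at hi hj
    have hi' := (p i).edges_subset_edgeSet hi
    have hj' := (p j).edges_subset_edgeSet hj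
    induction e with | _ x y => exact hF i j x y hi' hj'

end EDPInstance

theorem List.getElem?_flatMap_of_length {α β : Type*} (l : List α) (f : α → List β) (L : ℕ)
    (h : ∀ a, (f a).length = L) (u v : ℕ) (hv : v < L) :
    (l.flatMap f)[u * L + v]? = l[u]?.bind fun a => (f a)[v]? := by
  induction l generalizing u with
  | nil => simp
  | cons a l ih =>
    rw [List.flatMap_cons]
    cases u with
    | zero => rw [Nat.zero_mul, Nat.zero_add, List.getElem?_append_left (by rw [h]; exact hv)]; simp
    | succ u =>
      rw [List.getElem?_append_right (by rw [h]; nlinarith), h]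
      have : (u + 1) * L + v - L = u * L + v := by
        rw [Nat.succ_mul]; omega
      rw [this, ih]; simp

namespace EDPInstance

open Classical in
theorem length_word_matrix (I : EDPInstance) : ((List.finRange I.n).flatMap (fun u =>
    (List.finRange I.n).map fun v => if I.G.Adj u v then 1 else 0)).length = I.n * I.n := by
  simp [List.length_flatMap, List.map_const']

theorem length_word (I : EDPInstance) : I.word.length = 2 + I.n * I.n + 2 * I.k := by
  rw [word, List.length_append, List.length_append, length_word_matrix]
  simp [List.length_flatMap, List.map_const', mul_comm]

theorem word_getElem?_zero (I : EDPInstance) : I.word[0]? = some I.n := by simp [word]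

theorem word_getElem?_one (I : EDPInstance) : I.word[1]? = some I.k := by simp [word]

open Classical in
theorem word_getElem?_adj (I : EDPInstance) (u v : Fin I.n) :
    I.word[2 + (I.n * u + v)]? = some (if I.G.Adj u v then 1 else 0) := by
  have hlt : I.n * u + v < I.n * I.n := by
    have h1 : I.n * (u + 1) ≤ I.n * I.n := Nat.mul_le_mul_left _ u.2
    rw [Nat.mul_add, Nat.mul_one] at h1
    have h2 := v.2
    omega
  rw [word, List.getElem?_append_left (by
    rw [List.length_append, length_word_matrix]; simp; omega),
    List.getElem?_append_right (by simp)]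
  have : 2 + (I.n * u + v) - [I.n, I.k].length = u * I.n + v := by
    rw [mul_comm]; simp
  rw [this, List.getElem?_flatMap_of_length _ _ I.n (by simp) _ _ v.2]
  simp

theorem word_getElem?_pair (I : EDPInstance) (i : Fin I.k) (b : ℕ) (hb : b < 2) :
    I.word[2 + I.n * I.n + (i + i) + b]? = some (if b = 0 then (I.s i : ℕ) else I.t i) := by
  rw [word, List.getElem?_append_right (by
    rw [List.length_append, length_word_matrix]; simp; omega), List.length_append,
    length_word_matrix]
  have : 2 + I.n * I.n + (i + i) + b - ([I.n, I.k].length + I.n * I.n) = i * 2 + b := by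
    simp; omega
  rw [this, List.getElem?_flatMap_of_length _ _ 2 (by simp) _ _ hb]
  interval_cases b <;> simp

open Classical in
/-- A sequence that starts with the word of an instance. -/
theorem word_eq_of (I : EDPInstance) (m : ℕ → ℕ) (h0 : m 0 = I.n) (h1 : m 1 = I.k)
    (hadj : ∀ u v : Fin I.n, m (2 + (I.n * u + v)) = if I.G.Adj u v then 1 else 0)
    (hs : ∀ i : Fin I.k, m (2 + I.n * I.n + (i + i)) = I.s i)
    (ht : ∀ i : Fin I.k, m (2 + I.n * I.n + (i + i) + 1) = I.t i) (i : ℕ)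
    (hi : i < I.word.length) : m i = I.word[i] := by
  have hi' := hi
  rw [length_word] at hi'
  suffices I.word[i]? = some (m i) by
    rw [List.getElem?_eq_getElem hi] at this
    exact (Option.some.inj this).symm
  by_cases c0 : i = 0
  · subst c0; rw [h0]; exact I.word_getElem?_zero
  by_cases c1 : i = 1
  · subst c1; rw [h1]; exact I.word_getElem?_one
  by_cases c2 : i < 2 + I.n * I.n
  · have hn : 0 < I.n := by
      by_contra hn
      rw [Nat.eq_zero_of_not_pos hn] at c2
      omega
    have e : i = 2 + (I.n * ((i - 2) / I.n) + (i - 2) % I.n) := by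
      rw [Nat.div_add_mod]; omega
    have hu : (i - 2) / I.n < I.n := Nat.div_lt_of_lt_mul (by omega)
    have := I.word_getElem?_adj ⟨_, hu⟩ ⟨_, Nat.mod_lt (i - 2) hn⟩
    rw [← hadj] at this
    simp only at this
    rwa [← e] at this
  · obtain ⟨j, b, hb, hj, e⟩ : ∃ j b, b < 2 ∧ j < I.k ∧ i = 2 + I.n * I.n + (j + j) + b :=
      ⟨(i - (2 + I.n * I.n)) / 2, (i - (2 + I.n * I.n)) % 2, by omega, by omega, by omega⟩
    have := I.word_getElem?_pair ⟨j, hj⟩ b hb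
    simp only at this
    rw [e, this]
    interval_cases b
    · simpa using (hs ⟨j, hj⟩).symm
    · simpa using (ht ⟨j, hj⟩).symm

end EDPInstance

open Finset in
/-- Ranks of the elements of a set of numbers. -/
theorem rank_bijective {n : ℕ} (p : Fin n → Prop) [DecidablePred p] :
    (∀ i, p i → (univ.filter fun j => j < i ∧ p j).card < (univ.filter p).card) ∧
    (∀ i j, p i → p j → (univ.filter fun l => l < i ∧ p l).card =
      (univ.filter fun l => l < j ∧ p l).card → i = j) ∧
    ∀ a < (univ.filter p).card, ∃ i, p i ∧ (univ.filter fun j => j < i ∧ p j).card = a := by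
  have h1 : ∀ i, p i → (univ.filter fun j => j < i ∧ p j).card < (univ.filter p).card := by
    intro i hi
    refine card_lt_card ⟨fun j hj => ?_, fun hsub => ?_⟩
    · rw [mem_filter] at hj ⊢
      exact ⟨hj.1, hj.2.2⟩
    · have := hsub (mem_filter.2 ⟨mem_univ i, hi⟩)
      simp at this
  have hlt : ∀ i j, p i → i < j → (univ.filter fun l => l < i ∧ p l).card <
      (univ.filter fun l => l < j ∧ p l).card := by
    intro i j hi hij
    refine card_lt_card ⟨fun l hl => ?_, fun hsub => ?_⟩
    · rw [mem_filter] at hl ⊢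
      exact ⟨hl.1, hl.2.1.trans hij, hl.2.2⟩
    · have := hsub (mem_filter.2 ⟨mem_univ i, hij, hi⟩)
      simp at this
  have h2 : ∀ i j, p i → p j → (univ.filter fun l => l < i ∧ p l).card =
      (univ.filter fun l => l < j ∧ p l).card → i = j := by
    intro i j hi hj e
    rcases lt_trichotomy i j with h | h | h
    · have := hlt i j hi h; omega
    · exact h
    · have := hlt j i hj h; omega
  refine ⟨h1, h2, fun a ha => ?_⟩
  have := surjOn_of_injOn_of_card_le (s := univ.filter p) (t := range (univ.filter p).card)
    (fun i => (univ.filter fun j => j < i ∧ p j).card)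
    (fun i hi => by
      have := h1 i (by simpa using hi)
      simpa using this)
    (fun i hi j hj e => h2 i j (by simpa using hi) (by simpa using hj) e) (by simp)
  obtain ⟨i, hi, e⟩ := this (by simpa using ha : a ∈ _)
  exact ⟨i, by simpa using hi, e⟩

/-! ### Labels of equivalence classes and the kernel -/

section Labels

open Finset

variable {n : ℕ}

/-- The least element of its class. -/
def IsLeastInClass (S : Fin n → Fin n → Prop) (v : Fin n) : Prop := ∀ w, w < v → ¬ S w v

open Classical in
/-- The number of least elements of classes below `v`. -/
noncomputable def leastRank (S : Fin n → Fin n → Prop) (v : Fin n) : ℕ :=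
  (univ.filter fun w => w < v ∧ IsLeastInClass S w).card

open Classical in
/-- The number of classes. -/
noncomputable def classCount (S : Fin n → Fin n → Prop) : ℕ :=
  (univ.filter fun w => IsLeastInClass S w).card

open Classical in
/-- The label of the class of `v`: the rank of its least element. -/
noncomputable def classLabel (S : Fin n → Fin n → Prop) (v : Fin n) : ℕ :=
  ∑ w, if S w v ∧ IsLeastInClass S w then leastRank S w else 0

variable {S : Fin n → Fin n → Prop}

/-- Each class has exactly one least element, so the sum in `classLabel` has only one term that can
be nonzero. The sum form is what the program evaluates. -/
theorem exists_leastInClass (hS : Equivalence S) (v : Fin n) :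
    ∃ w, S w v ∧ IsLeastInClass S w ∧ classLabel S v = leastRank S w := by
  classical
  obtain ⟨w, hw, hmin⟩ := exists_min_image (univ.filter fun w => S w v) id
    ⟨v, by simpa using hS.refl v⟩
  simp only [mem_filter, mem_univ, true_and, id] at hw hmin
  have hleast : IsLeastInClass S w := fun x hx hxw =>
    absurd (hmin x (hS.trans hxw hw)) (not_le.2 hx)
  refine ⟨w, hw, hleast, ?_⟩
  rw [classLabel, sum_eq_single w, if_pos ⟨hw, hleast⟩]
  · intro x _ hxw
    rw [if_neg]
    rintro ⟨hx, hxl⟩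
    rcases lt_trichotomy x w with h | h | h
    · exact hleast x h (hS.trans hx (hS.symm hw))
    · exact hxw h
    · exact hxl w h (hS.trans hw (hS.symm hx))
  · simp

theorem classLabel_lt (hS : Equivalence S) (v : Fin n) : classLabel S v < classCount S := by
  classical
  obtain ⟨w, -, hw, e⟩ := exists_leastInClass hS v
  rw [e]
  exact (rank_bijective (IsLeastInClass S)).1 w hw

theorem classLabel_eq_iff (hS : Equivalence S) (u v : Fin n) :
    classLabel S u = classLabel S v ↔ S u v := by
  classical
  obtain ⟨x, hx, hxl, ex⟩ := exists_leastInClass hS u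
  obtain ⟨y, hy, hyl, ey⟩ := exists_leastInClass hS v
  constructor
  · intro e
    rw [ex, ey] at e
    obtain rfl := (rank_bijective (IsLeastInClass S)).2.1 x y hxl hyl e
    exact hS.trans (hS.symm hx) hy
  · intro huv
    rw [ex, ey]
    have hxy : S x y := hS.trans hx (hS.trans huv (hS.symm hy))
    rcases lt_trichotomy x y with h | h | h
    · exact absurd hxy (hyl x h)
    · rw [h]
    · exact absurd (hS.symm hxy) (hxl y h)

theorem exists_classLabel_eq (hS : Equivalence S) {a : ℕ} (ha : a < classCount S) :
    ∃ v, classLabel S v = a := by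
  classical
  obtain ⟨w, hw, e⟩ := (rank_bijective (IsLeastInClass S)).2.2 a ha
  refine ⟨w, ?_⟩
  obtain ⟨x, hx, hxl, ex⟩ := exists_leastInClass hS w
  rw [ex, ← e]
  rcases lt_trichotomy x w with h | h | h
  · exact absurd hx (hw x h)
  · rw [h]; rfl
  · exact absurd (hS.symm hx) (hxl w h)

end Labels

/-! ### The kernel as an instance -/

namespace EDPInstance

open SimpleGraph Finset

/-- Connected by edges in resolved blocks. -/
def Merged (I : EDPInstance) : Fin I.n → Fin I.n → Prop :=
  (I.G.blockEdges (I.G.Resolved I.s I.t)).Reachable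

theorem merged_equivalence (I : EDPInstance) : Equivalence I.Merged :=
  ⟨.refl, .symm, .trans⟩

/-- The label of a vertex in the kernel. -/
noncomputable def label (I : EDPInstance) (v : Fin I.n) : ℕ := classLabel I.Merged v

/-- The pairs that survive in the kernel. -/
def Survives (I : EDPInstance) (i : Fin I.k) : Prop := I.label (I.s i) ≠ I.label (I.t i)

open Classical in
/-- The number of surviving pairs before the pair `i`. -/
noncomputable def pairRank (I : EDPInstance) (i : Fin I.k) : ℕ :=
  (univ.filter fun j => j < i ∧ I.Survives j).card

open Classical in
/-- The number of surviving pairs. -/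
noncomputable def pairCount (I : EDPInstance) : ℕ := (univ.filter fun i => I.Survives i).card

/-- The vertices with labels `a` and `b` are adjacent in the kernel. -/
def LabelAdj (I : EDPInstance) (a b : ℕ) : Prop :=
  a ≠ b ∧ ∃ x y, I.G.Adj x y ∧ I.label x = a ∧ I.label y = b

/-- The contraction of the resolved blocks, with vertices named by labels and surviving pairs by
ranks. The last clauses fix the instance explicitly enough to compare it with the output of the
program. -/
theorem exists_kernel (I : EDPInstance) (hI : I.G.IsCliquePath)
    (ho : ¬ I.G.Overloaded I.s I.t) : ∃ J : EDPInstance, J.G.IsCliquePath ∧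
      (I.IsYes ↔ J.IsYes) ∧ J.n ≤ 2 * I.k + 1 ∧ J.k ≤ I.k ∧ J.n = classCount I.Merged ∧
      J.k = I.pairCount ∧ (∀ a b : Fin J.n, J.G.Adj a b ↔ I.LabelAdj a b) ∧
      ∀ j : Fin J.k, ∃ i, I.Survives i ∧ I.pairRank i = j ∧ (J.s j : ℕ) = I.label (I.s i) ∧
        (J.t j : ℕ) = I.label (I.t i) := by
  classical
  obtain ⟨hG, h, -⟩ := isCliquePath_iff.1 hI
  have hS := I.merged_equivalence
  obtain ⟨-, rinj, rsurj⟩ := rank_bijective I.Survives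
  let φ : Fin I.n → Fin (classCount I.Merged) := fun v => ⟨I.label v, classLabel_lt hS v⟩
  let H : SimpleGraph (Fin (classCount I.Merged)) :=
    { Adj := fun a b => I.LabelAdj a b
      symm := ⟨fun a b ⟨h, x, y, h1, h2, h3⟩ => ⟨h.symm, y, x, h1.symm, h3, h2⟩⟩
      loopless := ⟨fun a h => h.1 rfl⟩ }
  have hφ : I.G.IsContraction (I.G.Resolved I.s I.t) φ H :=
    { surjective := fun a => by
        obtain ⟨v, hv⟩ := exists_classLabel_eq hS a.2
        exact ⟨v, Fin.ext hv⟩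
      eq_iff := fun x y => by
        rw [Fin.ext_iff]
        exact classLabel_eq_iff hS x y
      adj_iff := fun a b => by
        simp only [H, LabelAdj, Fin.ext_iff, φ, ne_eq] }
  -- `e` lists the surviving pairs by rank.
  choose e he her using fun j : Fin I.pairCount => rsurj j j.2
  have einj : Function.Injective e := fun j j' hj => Fin.ext (by rw [← her j, ← her j', hj])
  have erange : ∀ i, I.Survives i → i ∈ Set.range e := by
    intro i hi
    have hlt := (rank_bijective I.Survives).1 i hi
    refine ⟨⟨_, hlt⟩, rinj _ _ (he _) hi (her _)⟩
  refine ⟨⟨_, H, I.pairCount, φ ∘ I.s ∘ e, φ ∘ I.t ∘ e, fun j hj => he j (congrArg Fin.val hj)⟩,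
    hφ.isCliquePath hI, ?_, ?_, ?_, rfl, rfl, fun a b => Iff.rfl, fun j => ⟨e j, he j, her j, rfl, rfl⟩⟩
  · rw [isYes_iff, isYes_iff, hφ.routable_resolved_iff h hG ho]
    refine (routable_comp_iff (s := φ ∘ I.s) (t := φ ∘ I.t) einj fun i hi => erange i fun hn => ?_).symm
    exact hi (Fin.ext hn)
  · simpa using hφ.card_le hI
  · simpa [pairCount] using Finset.card_filter_le (univ : Finset (Fin I.k)) I.Survives

/-- A trivial No-instance. -/
def trivialNo : EDPInstance where
  n := 2
  G := ⊤
  k := 2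
  s _ := 0
  t _ := 1
  s_ne_t _ := by decide

/-- Both pairs need the only edge. -/
theorem not_routable_top_two :
    ¬ (⊤ : SimpleGraph (Fin 2)).Routable (fun _ : Fin 2 => 0) fun _ => 1 := by
  rintro ⟨F, -, hF, hst⟩
  have key : ∀ i, (F i).Adj 0 1 := by
    intro i
    obtain ⟨p⟩ := hst i
    cases p with
    | @cons _ w _ h _ =>
      have : w = 1 := Fin.eq_one_of_ne_zero w h.ne'
      exact this ▸ h
  exact absurd (hF 0 1 _ _ (key 0) (key 1)) (by decide)

theorem trivialNo_not_isYes : ¬ trivialNo.IsYes := by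
  rw [isYes_iff]
  exact not_routable_top_two

theorem trivialNo_isCliquePath : trivialNo.G.IsCliquePath := by
  rw [isCliquePath_iff]
  refine ⟨connected_top (V := Fin 2), fun w u v _ _ huv _ => huv, ?_⟩
  rintro x y z - - - ⟨⟨u, v, -, -, huv, hn⟩, -⟩
  exact hn huv

end EDPInstance

/-! ### Verification of commands -/

namespace RAM

/-- A term that does not read array `A`. -/
def Term.Avoids (A : ℕ) : Term → Prop
  | .const _ => True
  | .var _ => True
  | .input i => i.Avoids A
  | .read a i => a + 6 ≠ A ∧ i.Avoids A
  | .add s t => s.Avoids A ∧ t.Avoids A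
  | .sub s t => s.Avoids A ∧ t.Avoids A
  | .eq s t => s.Avoids A ∧ t.Avoids A
  | .lt s t => s.Avoids A ∧ t.Avoids A
  | .ite c s t => c.Avoids A ∧ s.Avoids A ∧ t.Avoids A
  | .sum _ _ t => t.Avoids A

/-- Two memories that agree except on array `A`. -/
def EqOff (A : ℕ) (m m' : Memory) : Prop := ∀ b, b ≠ A → m' b = m b

theorem EqOff.trans {A : ℕ} {m₁ m₂ m₃ : Memory} (h : EqOff A m₁ m₂) (h' : EqOff A m₂ m₃) :
    EqOff A m₁ m₃ := fun b hb => (h' b hb).trans (h b hb)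

theorem Term.Avoids.eval_eq {A : ℕ} (hA : A ≠ 0) {m m' : Memory} (h : EqOff A m m') {t : Term}
    (ht : t.Avoids A) (v : ℕ → ℕ) : t.eval m' v = t.eval m v := by
  induction t generalizing v <;> simp_all [Term.eval, Term.Avoids, h 0 (Ne.symm hA), EqOff]

/-- Array `A` is overwritten by some of the assignments `R`, and every cell that `R` assigns to is
overwritten. -/
def Overwrites (A : ℕ) (R : ℕ → ℕ → Prop) (m m' : Memory) : Prop :=
  EqOff A m m' ∧ ∀ c, (m' A c = m A c ∧ ∀ w, ¬ R c w) ∨ R c (m' A c)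

/-- A cell may be assigned several times in an order that `R` forgets; its content is determined
when all assigned values agree. -/
theorem Overwrites.eq {A : ℕ} {R : ℕ → ℕ → Prop} {m m' : Memory} (h : Overwrites A R m m')
    {c w : ℕ} (hw : R c w) (hu : ∀ w', R c w' → w' = w) : m' A c = w := by
  rcases h.2 c with h | h
  · exact absurd hw (h.2 w)
  · exact hu _ h

theorem Overwrites.trans {A : ℕ} {R R' : ℕ → ℕ → Prop} {m₁ m₂ m₃ : Memory}
    (h : Overwrites A R m₁ m₂) (h' : Overwrites A R' m₂ m₃) :
    Overwrites A (fun c w => R c w ∨ R' c w) m₁ m₃ := by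
  refine ⟨h.1.trans h'.1, fun c => ?_⟩
  rcases h'.2 c with ⟨e', n'⟩ | e'
  · rcases h.2 c with ⟨e, n⟩ | e
    · exact .inl ⟨e'.trans e, fun w hw => hw.elim (n w) (n' w)⟩
    · exact .inr (.inl (e'.symm ▸ e))
  · exact .inr (.inr e')

theorem Overwrites.congr {A : ℕ} {R R' : ℕ → ℕ → Prop} {m m' : Memory} (h : Overwrites A R m m')
    (hR : ∀ c w, R c w ↔ R' c w) : Overwrites A R' m m' := by
  have : R = R' := funext fun c => funext fun w => propext (hR c w)
  exact this ▸ h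

/-- On every memory that agrees with `m` except on array `A`, the command performs the assignments
`R` to array `A`. -/
def Command.Assigns (p : Command) (A : ℕ) (v : ℕ → ℕ) (m : Memory) (R : ℕ → ℕ → Prop) : Prop :=
  ∀ m', EqOff A m m' → Overwrites A R m' (p.run v m')

theorem overwrites_set (m : Memory) (A c w : ℕ) :
    Overwrites A (fun c' w' => c' = c ∧ w' = w) m (m.set A c w) := by
  refine ⟨fun b hb => funext fun j => by simp [Memory.set, hb], fun c' => ?_⟩
  by_cases h : c' = c
  · right; simp [Memory.set, h]
  · left; simp [Memory.set, h]

theorem Command.assigns_output {i e : Term} {v : ℕ → ℕ} {m : Memory} (hi : i.Avoids 1)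
    (he : e.Avoids 1) :
    (Command.output i e).Assigns 1 v m fun c w => c = i.eval m v ∧ w = e.eval m v := by
  intro m' h
  rw [← hi.eval_eq one_ne_zero h, ← he.eval_eq one_ne_zero h]
  exact overwrites_set _ _ _ _

theorem Command.assigns_write {a : ℕ} {i e : Term} {v : ℕ → ℕ} {m : Memory}
    (hi : i.Avoids (a + 6)) (he : e.Avoids (a + 6)) :
    (Command.write a i e).Assigns (a + 6) v m fun c w => c = i.eval m v ∧ w = e.eval m v := by
  intro m' h
  rw [← hi.eval_eq (by omega) h, ← he.eval_eq (by omega) h]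
  exact overwrites_set _ _ _ _

theorem Command.Assigns.seq {p q : Command} {A : ℕ} {v : ℕ → ℕ} {m : Memory}
    {R R' : ℕ → ℕ → Prop} (hp : p.Assigns A v m R) (hq : q.Assigns A v m R') :
    (Command.seq p q).Assigns A v m fun c w => R c w ∨ R' c w := by
  intro m' h
  have h1 := hp m' h
  exact h1.trans (hq _ (h.trans h1.1))

theorem Command.Assigns.ite {c : Term} {p q : Command} {A : ℕ} {v : ℕ → ℕ} {m : Memory}
    {R R' : ℕ → ℕ → Prop} (hA : A ≠ 0) (hc : c.Avoids A) (hp : p.Assigns A v m R)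
    (hq : q.Assigns A v m R') :
    (Command.ite c p q).Assigns A v m fun i w =>
      c.eval m v ≠ 0 ∧ R i w ∨ c.eval m v = 0 ∧ R' i w := by
  intro m' h
  simp only [Command.run, hc.eval_eq hA h]
  split_ifs with h0
  · exact (hp m' h).congr (by simp [h0])
  · rw [ne_eq, not_not] at h0
    exact (hq m' h).congr (by simp [h0])

/-- Every round performs its assignments on any memory that differs from `m` only in array `A`, so
earlier rounds do not influence later ones and the union is taken. -/
theorem Command.Assigns.loop {x : ℕ} {r : Range} {p : Command} {A : ℕ} {v : ℕ → ℕ} {m : Memory}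
    {R : ℕ → ℕ → ℕ → Prop} (hA : A ≠ 0)
    (hp : ∀ j < m 0 r.cell, p.Assigns A (Function.update v x j) m (R j)) :
    (Command.loop x r p).Assigns A v m fun c w => ∃ j < m 0 r.cell, R j c w := by
  intro m' h
  rw [Command.run, h 0 hA.symm]
  have := foldl_range_induction (fun m j => p.run (Function.update v x j) m) (m 0 r.cell)
    (fun B m'' => B ≤ m 0 r.cell → Overwrites A (fun c w => ∃ j < B, R j c w) m' m'') (m := m')
    (fun _ => ⟨fun _ _ => rfl, fun c => .inl ⟨rfl, by simp⟩⟩) (fun j hj m'' ih hj' => by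
      have h1 := ih (by omega)
      refine (h1.trans (hp j hj m'' (h.trans h1.1))).congr fun c w => ?_
      simp only [Nat.lt_succ_iff_lt_or_eq]
      constructor
      · rintro (⟨i, hi, h⟩ | h)
        exacts [⟨i, .inl hi, h⟩, ⟨j, .inr rfl, h⟩]
      · rintro ⟨i, hi | rfl, h⟩
        exacts [.inl ⟨i, hi, h⟩, .inr h])
  exact this le_rfl

/-! ### Terms as formulas -/

namespace Term

/-- A term holds if its value is nonzero. -/
def Holds (t : Term) (m : Memory) (v : ℕ → ℕ) : Prop := t.eval m v ≠ 0

/-- Negation. -/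
def not (t : Term) : Term := .eq t (.const 0)

/-- Conjunction. -/
def and (s t : Term) : Term := .not (.add s.not t.not)

/-- Implication. -/
def imp (s t : Term) : Term := .add s.not t

/-- Equivalence. -/
def iff (s t : Term) : Term := .eq s.not t.not

/-- Bounded universal quantification. -/
def all (x : ℕ) (r : Range) (t : Term) : Term := .not (.sum x r t.not)

/-- Counting. -/
def count (x : ℕ) (r : Range) (t : Term) : Term := .sum x r (.ite t (.const 1) (.const 0))

/-- The index of the entry `(s, t)` of a matrix. The term `s` must not use variable `20`. -/
def entry (s t : Term) : Term := .add (.sum 20 .vertices s) t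

variable {m : Memory} {v : ℕ → ℕ} {s t c : Term} {n k : ℕ}

theorem eval_const (c : ℕ) : (const c).eval m v = c := rfl
theorem eval_var (x : ℕ) : (var x).eval m v = v x := rfl
theorem eval_input : (input t).eval m v = m 0 (t.eval m v) := rfl
theorem eval_read (a : ℕ) : (read a t).eval m v = m (a + 6) (t.eval m v) := rfl
theorem eval_add : (add s t).eval m v = s.eval m v + t.eval m v := rfl

open Classical in
theorem eval_ite : (ite c s t).eval m v = if c.Holds m v then s.eval m v else t.eval m v := by
  by_cases h : c.Holds m v
  · rw [if_pos h]; exact if_pos h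
  · rw [if_neg h]; exact if_neg h

theorem eval_sum_vertices (hn : m 0 0 = n) (x : ℕ) :
    (sum x .vertices t).eval m v = ∑ j : Fin n, t.eval m (Function.update v x j) := by
  rw [eval, Range.cell, hn, Finset.sum_range]

theorem eval_sum_pairs (hk : m 0 1 = k) (x : ℕ) :
    (sum x .pairs t).eval m v = ∑ j : Fin k, t.eval m (Function.update v x j) := by
  rw [eval, Range.cell, hk, Finset.sum_range]

theorem holds_read (a : ℕ) : (read a t).Holds m v ↔ m (a + 6) (t.eval m v) ≠ 0 := Iff.rfl

theorem holds_eq : (eq s t).Holds m v ↔ s.eval m v = t.eval m v := by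
  simp [Holds, eval]

theorem holds_lt : (lt s t).Holds m v ↔ s.eval m v < t.eval m v := by
  simp [Holds, eval]

theorem holds_not : t.not.Holds m v ↔ ¬ t.Holds m v := by
  rw [not, holds_eq, Holds, not_not]; rfl

/-- A sum of natural numbers is nonzero exactly if a summand is. So addition acts as disjunction,
and a bounded sum as an existential quantifier. -/
theorem holds_add : (add s t).Holds m v ↔ s.Holds m v ∨ t.Holds m v := by
  simp only [Holds, eval]; omega

theorem holds_and : (and s t).Holds m v ↔ s.Holds m v ∧ t.Holds m v := by
  rw [and, holds_not, holds_add, holds_not, holds_not]; tauto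

theorem holds_imp : (imp s t).Holds m v ↔ (s.Holds m v → t.Holds m v) := by
  rw [imp, holds_add, holds_not]; tauto

theorem holds_iff : (iff s t).Holds m v ↔ (s.Holds m v ↔ t.Holds m v) := by
  simp only [iff, Holds, not, eval]
  by_cases h : s.eval m v = 0 <;> by_cases h' : t.eval m v = 0 <;> simp [h, h']

theorem holds_sum_vertices (hn : m 0 0 = n) (x : ℕ) :
    (sum x .vertices t).Holds m v ↔ ∃ j : Fin n, t.Holds m (Function.update v x j) := by
  rw [Holds, eval_sum_vertices hn, ne_eq, Finset.sum_eq_zero_iff]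
  simp [Holds]

theorem holds_all_vertices (hn : m 0 0 = n) (x : ℕ) :
    (all x .vertices t).Holds m v ↔ ∀ j : Fin n, t.Holds m (Function.update v x j) := by
  rw [all, holds_not, holds_sum_vertices hn]
  simp [holds_not]

open Classical in
theorem eval_count_vertices (hn : m 0 0 = n) (x : ℕ) : (count x .vertices t).eval m v =
    (Finset.univ.filter fun j : Fin n => t.Holds m (Function.update v x j)).card := by
  rw [count, eval_sum_vertices hn, Finset.card_filter]
  simp [eval_ite, eval_const]

open Classical in
theorem eval_count_pairs (hk : m 0 1 = k) (x : ℕ) : (count x .pairs t).eval m v =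
    (Finset.univ.filter fun j : Fin k => t.Holds m (Function.update v x j)).card := by
  rw [count, eval_sum_pairs hk, Finset.card_filter]
  simp [eval_ite, eval_const]

/-- Multiplication is not an operation, so `n * s` is the sum of `n` copies of `s`; the hypothesis
says that the summand ignores the summation variable `20`. -/
theorem eval_entry (hn : m 0 0 = n) (hs : ∀ j, s.eval m (Function.update v 20 j) = s.eval m v) :
    (entry s t).eval m v = n * s.eval m v + t.eval m v := by
  rw [entry, eval_add, eval_sum_vertices hn]
  simp [hs]

theorem eval_eq_ite {P : Prop} [Decidable P] (h : t.Holds m v ↔ P) (h1 : t.eval m v ≤ 1) :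
    t.eval m v = if P then 1 else 0 := by
  by_cases hP : P
  · rw [if_pos hP]
    have := h.2 hP
    rw [Holds] at this
    omega
  · rw [if_neg hP]
    by_contra hne
    exact hP (h.1 hne)

theorem eval_eq_le : (eq s t).eval m v ≤ 1 := by
  rw [eval]; split_ifs <;> omega

theorem eval_and_le : (and s t).eval m v ≤ 1 := eval_eq_le

theorem eval_all_le {x : ℕ} {r : Range} : (all x r t).eval m v ≤ 1 := eval_eq_le

end Term

theorem entry_injective {n a b a' b' : ℕ} (hb : b < n) (hb' : b' < n)
    (h : n * a + b = n * a' + b') : a = a' ∧ b = b' := by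
  have h1 : (n * a + b) / n = a := by
    rw [Nat.mul_add_div (by omega), Nat.div_eq_of_lt hb, add_zero]
  have h2 : (n * a' + b') / n = a' := by
    rw [Nat.mul_add_div (by omega), Nat.div_eq_of_lt hb', add_zero]
  have : a = a' := by rw [← h1, ← h2, h]
  subst this
  exact ⟨rfl, by omega⟩

/-- Fill a matrix with the values of a term in the variables `0` and `1`. -/
def Command.fill (a : ℕ) (t : Term) : Command :=
  .loop 0 .vertices (.loop 1 .vertices (.write a (.entry (.var 0) (.var 1)) t))

/-- Distinct index pairs address distinct cells, so no cell of the matrix receives two values; and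
`t` does not read the array being filled. -/
theorem Command.fill_spec {a n : ℕ} {t : Term} (ht : t.Avoids (a + 6)) {v : ℕ → ℕ} {m : Memory}
    (hn : m 0 0 = n) : EqOff (a + 6) m ((Command.fill a t).run v m) ∧
      ∀ x y : Fin n, (Command.fill a t).run v m (a + 6) (n * x + y) =
        t.eval m (Function.update (Function.update v 0 x) 1 y) := by
  have h := Command.Assigns.loop (x := 0) (r := .vertices) (v := v) (m := m) (A := a + 6)
    (by omega) fun x _ =>
      Command.Assigns.loop (x := 1) (r := .vertices) (v := Function.update v 0 x) (m := m)
        (A := a + 6) (by omega) fun y _ =>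
        Command.assigns_write (a := a) (i := .entry (.var 0) (.var 1)) (e := t)
          (v := Function.update (Function.update v 0 x) 1 y) (m := m)
          (by simp [Term.entry, Term.Avoids]) ht
  have h' := h m fun _ _ => rfl
  refine ⟨h'.1, fun x y => h'.eq ?_ ?_⟩
  · refine ⟨x, by simp [Range.cell, hn], y, by simp [Range.cell, hn], ?_, rfl⟩
    rw [Term.eval_entry hn (by simp [Term.eval])]
    simp [Term.eval]
  · rintro w ⟨x', hx', y', hy', hc, rfl⟩
    rw [Term.eval_entry hn (by simp [Term.eval])] at hc
    simp only [Range.cell, hn] at hx' hy'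
    simp [Term.eval] at hc
    obtain ⟨h1, h2⟩ := entry_injective y.2 hy' hc
    rw [h1, h2]

end RAM

/-! ### The program -/

namespace SimpleGraph

/-- The distance exceeds `j` exactly if `u ≠ v` and every neighbour of `u` is at distance at least
`j` from `v`. Only the distances truncated at `j` are needed for this test, so iteration yields all
distances. -/
theorem Connected.min_succ_dist {V : Type*} {G : SimpleGraph V} (hG : G.Connected) (j : ℕ)
    (u v : V) [Decidable (u ≠ v ∧ ∀ w, G.Adj u w → j ≤ min j (G.dist w v))] :
    min j (G.dist u v) + (if u ≠ v ∧ ∀ w, G.Adj u w → j ≤ min j (G.dist w v) then 1 else 0) =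
      min (j + 1) (G.dist u v) := by
  by_cases huv : u = v
  · subst huv; simp
  obtain ⟨x, hx, hd⟩ := hG.exists_adj_dist huv
  split_ifs with h
  · have := h.2 x hx
    omega
  · have : ¬ ∀ w, G.Adj u w → j ≤ min j (G.dist w v) := fun h' => h ⟨huv, h'⟩
    push Not at this
    obtain ⟨w, hw, hlt⟩ := this
    have h1 := hG.dist_triangle (u := u) (v := w) (w := v)
    rw [dist_eq_one_iff_adj.2 hw] at h1
    omega

end SimpleGraph

namespace RAM

open SimpleGraph Finset

open Classical in
/-- Array `0` contains the instance `I`. -/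
structure IsInput (I : EDPInstance) (m : Memory) : Prop where
  n_eq : m 0 0 = I.n
  k_eq : m 0 1 = I.k
  adj_eq (u v : Fin I.n) : m 0 (2 + (I.n * u + v)) = if I.G.Adj u v then 1 else 0
  source_eq (i : Fin I.k) : m 0 (2 + I.n * I.n + (i + i)) = I.s i
  sink_eq (i : Fin I.k) : m 0 (2 + I.n * I.n + (i + i) + 1) = I.t i

theorem isInput_input (I : EDPInstance) : IsInput I (input I.word) := by
  constructor <;> intros <;> simp only [input, if_true, List.getD_eq_getElem?_getD]
  · rw [I.word_getElem?_zero, Option.getD_some]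
  · rw [I.word_getElem?_one, Option.getD_some]
  · rw [I.word_getElem?_adj, Option.getD_some]
  · rw [← add_zero (2 + _ + _), I.word_getElem?_pair _ 0 (by omega)]; simp
  · rw [I.word_getElem?_pair _ 1 (by omega)]; simp

namespace Term

/-- Adjacency of two vertices. -/
def adj (x y : ℕ) : Term := .input (.add (.const 2) (.entry (.var x) (.var y)))

/-- The entry of a matrix. -/
def table (a x y : ℕ) : Term := .read a (.entry (.var x) (.var y))

/-- The position of a pair in the input. -/
def position (i : ℕ) : Term :=
  .add (.add (.const 2) (.sum 21 .vertices (.sum 22 .vertices (.const 1)))) (.add (.var i) (.var i))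

/-- The first terminal of a pair. -/
def source (i : ℕ) : Term := .input (position i)

/-- The second terminal of a pair. -/
def sink (i : ℕ) : Term := .input (.add (position i) (.const 1))

/-- The vertex `z` is a common neighbour of `x` and `y`. -/
def common (x y z : ℕ) : Term := .and (adj x z) (adj y z)

/-- The vertex `z` is in the block of the edge between the variables `0` and `1`. -/
def inBlock (z : ℕ) : Term :=
  .and (.add (.eq (.var z) (.var 0)) (adj z 0)) (.add (.eq (.var z) (.var 1)) (adj z 1))

/-- The distance, truncated at `j + 1`, from that truncated at `j`, in variable `2`. -/
def distance : Term :=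
  .add (table 0 0 1) (.ite (.and (.not (.eq (.var 0) (.var 1)))
    (.all 3 .vertices (.imp (adj 0 3) (.not (.lt (table 0 3 1) (.var 2)))))) (.const 1) (.const 0))

/-- The number of pairs separated by an edge. -/
def demand : Term :=
  .count 3 .pairs (.not (.iff
    (.lt (.read 0 (.entry (.var 0) (source 3))) (.read 0 (.entry (.var 1) (source 3))))
    (.lt (.read 0 (.entry (.var 0) (sink 3))) (.read 0 (.entry (.var 1) (sink 3))))))

/-- Sparse edges. -/
def sparse : Term :=
  .and (adj 0 1) (.not (.lt (.count 3 .vertices (common 0 1 3))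
    (.sum 3 .vertices (.ite (common 0 1 3) (table 1 3 0) (.const 0)))))

/-- Edges in resolved blocks. -/
def resolved : Term :=
  .and (adj 0 1) (.sum 3 .vertices (.and (inBlock 3)
    (.sum 4 .vertices (.and (inBlock 4) (table 2 3 4)))))

/-- Vertices connected by edges in resolved blocks. -/
def merged : Term :=
  .all 3 .vertices (.all 4 .vertices (.imp (.and (adj 3 4)
    (.eq (.add (.add (table 0 0 3) (.const 1)) (table 0 4 1)) (table 0 0 1))) (table 3 3 4)))

/-- The least element of its class. -/
def least : Term := .all 3 .vertices (.imp (.lt (.var 3) (.var 1)) (.not (table 4 3 1)))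

/-- The label of a vertex. -/
def label : Term :=
  .sum 3 .vertices (.ite (.and (table 4 3 1) (.read 5 (.var 3)))
    (.count 4 .vertices (.and (.lt (.var 4) (.var 3)) (.read 5 (.var 4)))) (.const 0))

/-- Some block has a vertex of too small degree. -/
def overloaded : Term :=
  .sum 0 .vertices (.sum 1 .vertices (.and (adj 0 1)
    (.lt (.add (.count 3 .vertices (common 0 1 3)) (.const 1)) (table 1 0 1))))

variable {I : EDPInstance} {m : Memory} {v : ℕ → ℕ}

theorem eval_adj (hm : IsInput I m) {x y : ℕ} (hx : x ≠ 20) :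
    (adj x y).eval m v = m 0 (2 + (I.n * v x + v y)) := by
  rw [adj, eval_input, eval_add, eval_entry hm.n_eq]
  · rfl
  · simp [eval_var, Function.update_of_ne hx]

theorem holds_adj (hm : IsInput I m) {x y : ℕ} (hx : x ≠ 20) :
    (adj x y).Holds m v ↔ m 0 (2 + (I.n * v x + v y)) ≠ 0 := by
  rw [Holds, eval_adj hm hx]

theorem eval_table (hm : IsInput I m) {a x y : ℕ} (hx : x ≠ 20) :
    (table a x y).eval m v = m (a + 6) (I.n * v x + v y) := by
  rw [table, eval_read, eval_entry hm.n_eq]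
  · rfl
  · simp [eval_var, Function.update_of_ne hx]

theorem holds_table (hm : IsInput I m) {a x y : ℕ} (hx : x ≠ 20) :
    (table a x y).Holds m v ↔ m (a + 6) (I.n * v x + v y) ≠ 0 := by
  rw [Holds, eval_table hm hx]

theorem eval_entry_var (hm : IsInput I m) {x : ℕ} {t : Term} (hx : x ≠ 20) :
    (entry (.var x) t).eval m v = I.n * v x + t.eval m v := by
  rw [eval_entry hm.n_eq]
  · rfl
  · simp [eval_var, Function.update_of_ne hx]

theorem eval_position (hm : IsInput I m) (i : ℕ) :
    (position i).eval m v = 2 + I.n * I.n + (v i + v i) := by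
  simp [position, eval_add, eval_sum_vertices hm.n_eq, eval_const, eval_var]

theorem eval_source (hm : IsInput I m) {i : ℕ} {j : Fin I.k} (hj : v i = j) :
    (source i).eval m v = I.s j := by
  rw [source, eval_input, eval_position hm, hj, hm.source_eq]

theorem eval_sink (hm : IsInput I m) {i : ℕ} {j : Fin I.k} (hj : v i = j) :
    (sink i).eval m v = I.t j := by
  rw [sink, eval_input, eval_add, eval_position hm, hj, eval_const, hm.sink_eq]

/-- Array `A` contains the matrix `f`. -/
def _root_.RAM.IsTable (I : EDPInstance) (m : Memory) (A : ℕ) (f : Fin I.n → Fin I.n → ℕ) : Prop :=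
  ∀ x y : Fin I.n, m A (I.n * x + y) = f x y

theorem eval_distance (hm : IsInput I m) (hG : I.G.Connected) {j : ℕ}
    (h : IsTable I m 6 fun x y => min j (I.G.dist x y)) (hv : v 2 = j) (x y : Fin I.n) :
    distance.eval m (Function.update (Function.update v 0 x) 1 y) =
      min (j + 1) (I.G.dist x y) := by
  classical
  unfold IsTable at h
  rw [← hG.min_succ_dist]
  simp [distance, eval_add, eval_ite, eval_const, eval_var, holds_and, holds_not, holds_eq,
    holds_lt, holds_imp, holds_all_vertices hm.n_eq, eval_table hm, holds_adj hm, h, hm.adj_eq, hv,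
    Fin.ext_iff]

theorem eval_demand (hm : IsInput I m) (h0 : IsTable I m 6 I.G.dist) (x y : Fin I.n) :
    demand.eval m (Function.update (Function.update v 0 x) 1 y) = I.G.demand I.s I.t x y := by
  classical
  unfold IsTable at h0
  rw [demand, eval_count_pairs hm.k_eq, SimpleGraph.demand]
  congr 1
  ext i
  rw [mem_filter, mem_filter, holds_not, holds_iff, holds_lt, holds_lt]
  have hi : Function.update (Function.update (Function.update v 0 (x : ℕ)) 1 y) 3 (i : ℕ) 3 = i :=
    Function.update_self ..
  simp [eval_read, eval_entry_var hm, eval_source hm hi, eval_sink hm hi, h0]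

theorem eval_sparse (hm : IsInput I m) (h1 : IsTable I m 7 (I.G.demand I.s I.t)) (x y : Fin I.n)
    [Decidable (I.G.Sparse I.s I.t x y)] :
    sparse.eval m (Function.update (Function.update v 0 x) 1 y) =
      if I.G.Sparse I.s I.t x y then 1 else 0 := by
  classical
  unfold IsTable at h1
  refine eval_eq_ite ?_ eval_and_le
  rw [sparse, holds_and, holds_not, holds_lt, SimpleGraph.Sparse, commonNbrs, sum_filter]
  simp [eval_count_vertices hm.n_eq, eval_sum_vertices hm.n_eq, common, holds_and, eval_ite,
    holds_adj hm, eval_table hm, h1, hm.adj_eq, eval_const]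

theorem holds_inBlock (hm : IsInput I m) {z : ℕ} {w x y : Fin I.n} (hz : z ≠ 20) (hw : v z = w)
    (hx : v 0 = x) (hy : v 1 = y) : (inBlock z).Holds m v ↔ w ∈ I.G.edgeBlock x y := by
  rw [mem_edgeBlock]
  simp [inBlock, holds_and, holds_add, holds_eq, eval_var, holds_adj hm hz, hw, hx, hy, hm.adj_eq,
    Fin.ext_iff]

theorem eval_resolved (hm : IsInput I m) [∀ x y, Decidable (I.G.Sparse I.s I.t x y)]
    (h2 : IsTable I m 8 fun x y => if I.G.Sparse I.s I.t x y then 1 else 0) (x y : Fin I.n)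
    [Decidable (I.G.Adj x y ∧ I.G.Resolved I.s I.t (I.G.edgeBlock x y))] :
    resolved.eval m (Function.update (Function.update v 0 x) 1 y) =
      if I.G.Adj x y ∧ I.G.Resolved I.s I.t (I.G.edgeBlock x y) then 1 else 0 := by
  unfold IsTable at h2
  refine eval_eq_ite ?_ eval_and_le
  rw [resolved, holds_and, holds_adj hm (by decide), holds_sum_vertices hm.n_eq, SimpleGraph.Resolved]
  refine and_congr (by simp [hm.adj_eq]) (exists_congr fun a => ?_)
  rw [holds_and, holds_inBlock hm (w := a) (x := x) (y := y) (by decide) (by simp) (by simp)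
    (by simp), holds_sum_vertices hm.n_eq]
  refine and_congr_right fun _ => exists_congr fun b => ?_
  rw [holds_and, holds_inBlock hm (w := b) (x := x) (y := y) (by decide) (by simp) (by simp)
    (by simp), holds_table hm (by decide)]
  simp [h2]

/-- By `blockEdges_reachable_iff`, a test of all edges on geodesics between `x` and `y` replaces a
search for a walk. -/
theorem eval_merged (hm : IsInput I m) (h0 : IsTable I m 6 I.G.dist) (hG : I.G.Connected)
    (h : I.G.EarClosed)
    [∀ x y, Decidable (I.G.Adj x y ∧ I.G.Resolved I.s I.t (I.G.edgeBlock x y))]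
    (h3 : IsTable I m 9 fun x y =>
      if I.G.Adj x y ∧ I.G.Resolved I.s I.t (I.G.edgeBlock x y) then 1 else 0)
    (x y : Fin I.n) [Decidable (I.Merged x y)] :
    merged.eval m (Function.update (Function.update v 0 x) 1 y) =
      if I.Merged x y then 1 else 0 := by
  unfold IsTable at h0 h3
  refine eval_eq_ite ?_ eval_all_le
  refine Iff.trans ?_ (blockEdges_reachable_iff h hG _ x y).symm
  rw [merged, holds_all_vertices hm.n_eq]
  refine forall_congr' fun a => ?_
  rw [holds_all_vertices hm.n_eq]
  refine forall_congr' fun b => ?_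
  simp [holds_imp, holds_and, holds_adj hm, holds_eq, eval_add, eval_table hm, holds_table hm,
    eval_const, h0, h3, hm.adj_eq]
  tauto

theorem eval_least (hm : IsInput I m) [∀ x y, Decidable (I.Merged x y)]
    (h4 : IsTable I m 10 fun x y => if I.Merged x y then 1 else 0) (x y : Fin I.n)
    [Decidable (IsLeastInClass I.Merged y)] :
    least.eval m (Function.update (Function.update v 0 x) 1 y) =
      if IsLeastInClass I.Merged y then 1 else 0 := by
  unfold IsTable at h4
  refine eval_eq_ite ?_ eval_all_le
  rw [least, holds_all_vertices hm.n_eq]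
  refine forall_congr' fun w => ?_
  simp [holds_imp, holds_lt, holds_not, eval_var, holds_table hm, h4]

theorem eval_label (hm : IsInput I m) [∀ x y, Decidable (I.Merged x y)]
    (h4 : IsTable I m 10 fun x y => if I.Merged x y then 1 else 0)
    [∀ y, Decidable (IsLeastInClass I.Merged y)]
    (h5 : ∀ y : Fin I.n, m 11 y = if IsLeastInClass I.Merged y then 1 else 0) (x y : Fin I.n) :
    label.eval m (Function.update (Function.update v 0 x) 1 y) = I.label y := by
  unfold IsTable at h4
  rw [label, eval_sum_vertices hm.n_eq, EDPInstance.label, classLabel]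
  refine sum_congr rfl fun w _ => ?_
  simp [eval_ite, holds_and, holds_table hm, holds_read, eval_var, eval_const, h4, h5,
    eval_count_vertices hm.n_eq, holds_lt, leastRank]
  congr

theorem holds_overloaded (hm : IsInput I m) (h1 : IsTable I m 7 (I.G.demand I.s I.t)) :
    overloaded.Holds m v ↔ I.G.Overloaded I.s I.t := by
  classical
  unfold IsTable at h1
  rw [overloaded, holds_sum_vertices hm.n_eq, SimpleGraph.Overloaded]
  refine exists_congr fun a => ?_
  rw [holds_sum_vertices hm.n_eq]
  refine exists_congr fun b => ?_
  simp [holds_and, holds_adj hm, holds_lt, eval_add, eval_const, eval_count_vertices hm.n_eq,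
    common, eval_table hm, h1, hm.adj_eq, commonNbrs]

end Term

end RAM

/-! ### Preparing the tables, writing the kernel, and correctness -/

namespace RAM

open SimpleGraph Finset

open Classical in
/-- The memory contains the instance `I` and the tables from which its kernel is read off. -/
structure IsPrepared (I : EDPInstance) (m : Memory) : Prop extends IsInput I m where
  demand_eq : IsTable I m 7 (I.G.demand I.s I.t)
  least_eq (y : Fin I.n) : m 11 y = if IsLeastInClass I.Merged y then 1 else 0
  label_eq (y : Fin I.n) : m 12 y = I.label y

namespace Command

/-- Compute the distances. -/
def distances : Command :=
  .loop 2 .vertices (.seq (.fill 1 .distance) (.fill 0 (.table 1 0 1)))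

/-- Compute the tables from which the kernel is read off. -/
def prepare : Command :=
  .seq distances <| .seq (.fill 1 .demand) <| .seq (.fill 2 .sparse) <| .seq (.fill 3 .resolved) <|
    .seq (.fill 4 .merged) <| .seq (.fill 5 .least) (.fill 6 .label)

end Command

variable {I : EDPInstance} {m : Memory} {v : ℕ → ℕ}

theorem IsInput.of_eq {m' : Memory} (hm : IsInput I m) (h : m' 0 = m 0) : IsInput I m' := by
  constructor <;> rw [h]
  exacts [hm.n_eq, hm.k_eq, hm.adj_eq, hm.source_eq, hm.sink_eq]

theorem IsTable.of_eq {m' : Memory} {A : ℕ} {f : Fin I.n → Fin I.n → ℕ} (hf : IsTable I m A f)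
    (h : m' A = m A) : IsTable I m' A f := by
  rw [IsTable, h]
  exact hf

theorem fill_isTable {a : ℕ} {t : Term} {f : Fin I.n → Fin I.n → ℕ} (ht : t.Avoids (a + 6))
    (hm : IsInput I m)
    (h : ∀ x y : Fin I.n, t.eval m (Function.update (Function.update v 0 x) 1 y) = f x y) :
    EqOff (a + 6) m ((Command.fill a t).run v m) ∧
      IsTable I ((Command.fill a t).run v m) (a + 6) f :=
  ⟨(Command.fill_spec ht hm.n_eq).1, fun x y => ((Command.fill_spec ht hm.n_eq).2 x y).trans (h x y)⟩

/-- The initial zeros are the distances truncated at `0`, each round raises the truncation by one,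
and distances are below `n`. Table `1` is a buffer, because `fill` requires a term that does not
read the table being filled. -/
theorem distances_spec (hm : IsInput I m) (hG : I.G.Connected) (h0 : ∀ i, m 6 i = 0) :
    IsInput I (Command.distances.run v m) ∧
      IsTable I (Command.distances.run v m) 6 I.G.dist := by
  have key := foldl_range_induction
    (fun m j => Command.run (.seq (.fill 1 .distance) (.fill 0 (.table 1 0 1)))
      (Function.update v 2 j) m) (m 0 Range.vertices.cell)
    (fun j m' => IsInput I m' ∧ IsTable I m' 6 fun x y => min j (I.G.dist x y)) (m := m)
    ⟨hm, fun x y => by simp [h0]⟩ (fun j _ m' ih => by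
      obtain ⟨e1, f1⟩ := fill_isTable (a := 1) (t := .distance) (v := Function.update v 2 j)
        (f := fun x y => min (j + 1) (I.G.dist x y)) (by simp [Term.distance, Term.Avoids,
          Term.and, Term.not, Term.all, Term.imp, Term.adj, Term.table, Term.entry]) ih.1
        (Term.eval_distance ih.1 hG ih.2 (by simp))
      have hm1 := ih.1.of_eq (e1 0 (by decide))
      obtain ⟨e2, f2⟩ := fill_isTable (a := 0) (t := .table 1 0 1) (v := Function.update v 2 j)
        (f := fun x y => min (j + 1) (I.G.dist x y)) (by simp [Term.Avoids, Term.table, Term.entry])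
        hm1 (fun x y => by
          rw [Term.eval_table hm1 (by decide)]
          simpa using f1 x y)
      exact ⟨hm1.of_eq (e2 0 (by decide)), f2⟩)
  refine ⟨key.1, fun x y => (key.2 x y).trans (min_eq_right ?_)⟩
  have := hG.dist_lt_card x y
  rw [Fintype.card_fin] at this
  rw [Range.cell, hm.n_eq]
  exact this.le

/-- Each table depends only on the input and earlier tables. Table `1`, the buffer of the distance
computation, is reused for the demands. -/
theorem prepare_spec (hm : IsInput I m) (hI : I.G.IsCliquePath) (h0 : ∀ i, m 6 i = 0) :
    IsPrepared I (Command.prepare.run v m) := by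
  classical
  obtain ⟨hG, h, -⟩ := isCliquePath_iff.1 hI
  obtain ⟨i0, d0⟩ := distances_spec (v := v) hm hG h0
  simp only [Command.prepare, Command.run]
  generalize Command.distances.run v m = m0 at *
  obtain ⟨e1, d1⟩ := fill_isTable (a := 1) (t := .demand) (v := v) (by simp [Term.demand,
    Term.Avoids, Term.not, Term.iff, Term.count, Term.source, Term.sink, Term.position,
    Term.entry]) i0 (Term.eval_demand i0 d0)
  generalize Command.run _ v m0 = m1 at *
  have i1 := i0.of_eq (e1 0 (by decide))
  obtain ⟨e2, d2⟩ := fill_isTable (a := 2) (t := .sparse) (v := v) (by simp [Term.sparse,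
    Term.Avoids, Term.not, Term.and, Term.count, Term.common, Term.adj, Term.table,
    Term.entry]) i1 fun x y =>
      Term.eval_sparse i1 d1 x y
  generalize Command.run _ v m1 = m2 at *
  have i2 := i1.of_eq (e2 0 (by decide))
  obtain ⟨e3, d3⟩ := fill_isTable (a := 3) (t := .resolved) (v := v) (by simp [Term.resolved,
    Term.Avoids, Term.not, Term.and, Term.inBlock, Term.adj, Term.table,
    Term.entry]) i2 fun x y =>
      Term.eval_resolved i2 d2 x y
  generalize Command.run _ v m2 = m3 at *
  have i3 := i2.of_eq (e3 0 (by decide))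
  obtain ⟨e4, d4⟩ := fill_isTable (a := 4) (t := .merged) (v := v) (by simp [Term.merged,
    Term.Avoids, Term.not, Term.and, Term.imp, Term.all, Term.adj, Term.table,
    Term.entry]) i3 fun x y =>
      Term.eval_merged i3 (d0.of_eq (by
        rw [e3 6 (by decide), e2 6 (by decide), e1 6 (by decide)])) hG h d3 x y
  generalize Command.run _ v m3 = m4 at *
  have i4 := i3.of_eq (e4 0 (by decide))
  obtain ⟨e5, d5⟩ := fill_isTable (a := 5) (t := .least) (v := v) (by simp [Term.least,
    Term.Avoids, Term.not, Term.imp, Term.all, Term.table, Term.entry]) i4 fun x y =>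
      Term.eval_least i4 d4 x y
  generalize Command.run _ v m4 = m5 at *
  have i5 := i4.of_eq (e5 0 (by decide))
  -- The term does not depend on the row, so row `0` of the matrix serves as a one-dimensional
  -- table. The same holds for the labels below.
  have d5' : ∀ y : Fin I.n, m5 11 y = if IsLeastInClass I.Merged y then 1 else 0 := fun y => by
    simpa using d5 ⟨0, y.pos⟩ y
  obtain ⟨e6, d6⟩ := fill_isTable (a := 6) (t := .label) (v := v) (by simp [Term.label,
    Term.Avoids, Term.not, Term.and, Term.count, Term.table, Term.entry]) i5
    (Term.eval_label i5 (d4.of_eq (e5 10 (by decide))) d5')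
  generalize Command.run _ v m5 = m6 at *
  refine ⟨i5.of_eq (e6 0 (by decide)), d1.of_eq ?_, fun y => ?_, fun y => ?_⟩
  · rw [e6 7 (by decide), e5 7 (by decide), e4 7 (by decide), e3 7 (by decide), e2 7 (by decide)]
  · rw [e6 11 (by decide)]
    convert d5' y
  · simpa using d6 ⟨0, y.pos⟩ y

namespace Term

/-- The number of vertices of the kernel. -/
def order : Term := .count 3 .vertices (.read 5 (.var 3))

/-- The pair `i` survives in the kernel. -/
def survives (i : ℕ) : Term := .not (.eq (.read 6 (source i)) (.read 6 (sink i)))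

/-- The number of surviving pairs. -/
def size : Term := .count 3 .pairs (survives 3)

/-- The cell of the adjacency matrix of the kernel for the labels of the variables `0`, `1`. -/
def adjCell : Term :=
  .add (.const 2) (.add (.sum 3 .vertices (.ite (.read 5 (.var 3)) (.read 6 (.var 0)) (.const 0)))
    (.read 6 (.var 1)))

/-- Adjacency of the labels of the variables `0`, `1`. -/
def labelAdj : Term :=
  .and (.not (.eq (.read 6 (.var 0)) (.read 6 (.var 1))))
    (.sum 3 .vertices (.sum 4 .vertices (.and (adj 3 4) (.and
      (.eq (.read 6 (.var 3)) (.read 6 (.var 0))) (.eq (.read 6 (.var 4)) (.read 6 (.var 1)))))))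

/-- The number of surviving pairs before the pair in variable `0`. -/
def rank : Term := .count 4 .pairs (.and (.lt (.var 4) (.var 0)) (survives 4))

/-- The cell for the first terminal of a surviving pair. -/
def pairCell : Term :=
  .add (.add (.const 2) (.sum 4 .vertices (.ite (.read 5 (.var 4)) order (.const 0))))
    (.add rank rank)

theorem eval_order (hm : IsPrepared I m) : order.eval m v = classCount I.Merged := by
  rw [order, eval_count_vertices hm.n_eq, classCount]
  congr 1
  ext w
  simp [holds_read, eval_var, hm.least_eq]

theorem holds_survives (hm : IsPrepared I m) {i : ℕ} {j : Fin I.k} (hj : v i = j) :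
    (survives i).Holds m v ↔ I.Survives j := by
  simp [survives, holds_not, holds_eq, eval_read, eval_source hm.toIsInput hj,
    eval_sink hm.toIsInput hj, hm.label_eq, EDPInstance.Survives]

theorem eval_size (hm : IsPrepared I m) : size.eval m v = I.pairCount := by
  classical
  rw [size, eval_count_pairs hm.k_eq, EDPInstance.pairCount]
  congr 1
  ext j
  rw [mem_filter, mem_filter, holds_survives hm (Function.update_self ..)]

/-- Again a product without multiplication: one copy of `c` for each class, represented by its least
element. -/
theorem sum_ite_least (c : ℕ) [∀ w, Decidable (IsLeastInClass I.Merged w)] :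
    ∑ w, (if IsLeastInClass I.Merged w then c else 0) = classCount I.Merged * c := by
  rw [← sum_filter, sum_const, smul_eq_mul, classCount]
  congr!

theorem eval_adjCell (hm : IsPrepared I m) {x y : Fin I.n} (hx : v 0 = x) (hy : v 1 = y) :
    adjCell.eval m v = 2 + (classCount I.Merged * I.label x + I.label y) := by
  classical
  rw [← sum_ite_least]
  simp [adjCell, eval_add, eval_const, eval_sum_vertices hm.n_eq, eval_ite, holds_read, eval_read,
    eval_var, hm.least_eq, hm.label_eq, hx, hy]

theorem eval_labelAdj (hm : IsPrepared I m) {x y : Fin I.n} (hx : v 0 = x) (hy : v 1 = y)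
    [Decidable (I.LabelAdj (I.label x) (I.label y))] :
    labelAdj.eval m v = if I.LabelAdj (I.label x) (I.label y) then 1 else 0 := by
  refine eval_eq_ite ?_ eval_and_le
  simp [labelAdj, holds_and, holds_not, holds_eq, holds_sum_vertices hm.n_eq, eval_read, eval_var,
    holds_adj hm.toIsInput, hm.adj_eq, hm.label_eq, hx, hy, EDPInstance.LabelAdj]

theorem eval_rank (hm : IsPrepared I m) {i : Fin I.k} (hi : v 0 = i) :
    rank.eval m v = I.pairRank i := by
  classical
  rw [rank, eval_count_pairs hm.k_eq, EDPInstance.pairRank]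
  congr 1
  ext j
  rw [mem_filter, mem_filter, holds_and, holds_survives hm (Function.update_self ..), holds_lt]
  simp [eval_var, hi]

theorem eval_pairCell (hm : IsPrepared I m) {i : Fin I.k} (hi : v 0 = i) : pairCell.eval m v =
    2 + classCount I.Merged * classCount I.Merged + (I.pairRank i + I.pairRank i) := by
  classical
  rw [← sum_ite_least (I := I) (classCount I.Merged)]
  simp [pairCell, eval_add, eval_const, eval_sum_vertices hm.n_eq, eval_ite, holds_read,
    eval_var, hm.least_eq, eval_order hm, eval_rank hm hi]

end Term

namespace Command

/-- Write the kernel to the output. -/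
def outputKernel : Command :=
  .seq (.output (.const 0) .order) <| .seq (.output (.const 1) .size) <|
  .seq (.loop 0 .vertices (.loop 1 .vertices (.output .adjCell .labelAdj)))
    (.loop 0 .pairs (.ite (.survives 0)
      (.seq (.output .pairCell (.read 6 (.source 0)))
        (.output (.add .pairCell (.const 1)) (.read 6 (.sink 0))))
      -- Commands have no `skip`; rewriting cell `0` with its own value takes its place.
      (.output (.const 0) .order)))

/-- Write an instance without solution to the output. -/
def outputTrivialNo : Command :=
  .seq (.output (.const 0) (.const 2)) <| .seq (.output (.const 1) (.const 2)) <|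
  .seq (.output (.const 2) (.const 0)) <| .seq (.output (.const 3) (.const 1)) <|
  .seq (.output (.const 4) (.const 1)) <| .seq (.output (.const 5) (.const 0)) <|
  .seq (.output (.const 6) (.const 0)) <| .seq (.output (.const 7) (.const 1)) <|
  .seq (.output (.const 8) (.const 0)) (.output (.const 9) (.const 1))

/-- The kernelization. -/
def kernelize : Command := .seq prepare (.ite .overloaded outputTrivialNo outputKernel)

end Command

theorem outputTrivialNo_spec (i : ℕ) (hi : i < EDPInstance.trivialNo.word.length) :
    Command.outputTrivialNo.run v m 1 i = EDPInstance.trivialNo.word[i] := by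
  refine EDPInstance.word_eq_of _ _ ?_ ?_ ?_ ?_ ?_ i hi
  · simp [Command.outputTrivialNo, Command.run, Memory.set, Term.eval, EDPInstance.trivialNo]
  · simp [Command.outputTrivialNo, Command.run, Memory.set, Term.eval, EDPInstance.trivialNo]
  · intro a b
    change Fin 2 at a b
    fin_cases a <;> fin_cases b <;>
      simp [Command.outputTrivialNo, Command.run, Memory.set, Term.eval, EDPInstance.trivialNo]
  · intro a
    change Fin 2 at a
    fin_cases a <;>
      simp [Command.outputTrivialNo, Command.run, Memory.set, Term.eval, EDPInstance.trivialNo]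
  · intro a
    change Fin 2 at a
    fin_cases a <;>
      simp [Command.outputTrivialNo, Command.run, Memory.set, Term.eval, EDPInstance.trivialNo]

/-- The assignments that write the kernel of `I`. -/
inductive KernelCell (I : EDPInstance) : ℕ → ℕ → Prop
  | order : KernelCell I 0 (classCount I.Merged)
  | size : KernelCell I 1 I.pairCount
  | adj (x y : Fin I.n) (w : ℕ) (hw : w ≤ 1)
      (h : w ≠ 0 ↔ I.LabelAdj (I.label x) (I.label y)) :
      KernelCell I (2 + (classCount I.Merged * I.label x + I.label y)) w
  | source (i : Fin I.k) (hi : I.Survives i) :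
      KernelCell I (2 + classCount I.Merged * classCount I.Merged + (I.pairRank i + I.pairRank i))
        (I.label (I.s i))
  | sink (i : Fin I.k) (hi : I.Survives i) : KernelCell I
      (2 + classCount I.Merged * classCount I.Merged + (I.pairRank i + I.pairRank i) + 1)
        (I.label (I.t i))

/-- No term here reads the output array, so all assignments can be evaluated in the prepared memory
`m`, whatever their order. -/
theorem outputKernel_overwrites (hm : IsPrepared I m) :
    Overwrites 1 (KernelCell I) m (Command.outputKernel.run v m) := by
  classical
  have h := ((Command.assigns_output (i := .const 0) (e := .order) (v := v) (m := m)
    (by simp [Term.Avoids]) (by simp [Term.Avoids, Term.order, Term.count])).seq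
    ((Command.assigns_output (i := .const 1) (e := .size) (v := v) (m := m)
      (by simp [Term.Avoids]) (by simp [Term.Avoids, Term.size, Term.count, Term.survives,
        Term.not, Term.source, Term.sink, Term.position])).seq
    ((Command.Assigns.loop (x := 0) (r := .vertices) (v := v) (m := m) one_ne_zero
      (fun x _ => Command.Assigns.loop (x := 1) (r := .vertices) one_ne_zero fun y _ =>
        Command.assigns_output (i := .adjCell) (e := .labelAdj)
          (by simp [Term.Avoids, Term.adjCell])
          (by simp [Term.Avoids, Term.labelAdj, Term.and, Term.not, Term.adj, Term.entry]))).seq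
    (Command.Assigns.loop (x := 0) (r := .pairs) (v := v) (m := m) one_ne_zero
      (fun i _ => Command.Assigns.ite (c := .survives 0) one_ne_zero
        (by simp [Term.Avoids, Term.survives, Term.not, Term.source, Term.sink, Term.position])
        ((Command.assigns_output (i := .pairCell) (e := .read 6 (.source 0))
          (by simp [Term.Avoids, Term.pairCell, Term.order, Term.count, Term.rank, Term.and,
            Term.survives, Term.not, Term.source, Term.sink, Term.position])
          (by simp [Term.Avoids, Term.source, Term.position])).seq
          (Command.assigns_output (i := .add .pairCell (.const 1)) (e := .read 6 (.sink 0))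
          (by simp [Term.Avoids, Term.pairCell, Term.order, Term.count, Term.rank, Term.and,
            Term.survives, Term.not, Term.source, Term.sink, Term.position])
          (by simp [Term.Avoids, Term.sink, Term.position])))
        (Command.assigns_output (i := .const 0) (e := .order)
          (by simp [Term.Avoids]) (by simp [Term.Avoids, Term.order, Term.count])))))))
    m fun _ _ => rfl
  refine h.congr fun c w => ?_
  constructor
  · rintro (⟨rfl, rfl⟩ | ⟨rfl, rfl⟩ | ⟨x, hx, y, hy, rfl, rfl⟩ |
      ⟨i, hi, ⟨hs, (⟨rfl, rfl⟩ | ⟨rfl, rfl⟩)⟩ | ⟨-, rfl, rfl⟩⟩)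
    · rw [Term.eval_order hm]; exact .order
    · rw [Term.eval_size hm]; exact .size
    · rw [Range.cell, hm.n_eq] at hx hy
      rw [Term.eval_adjCell hm (x := ⟨x, hx⟩) (y := ⟨y, hy⟩) (by simp) (by simp),
        Term.eval_labelAdj hm (x := ⟨x, hx⟩) (y := ⟨y, hy⟩) (by simp) (by simp)]
      refine .adj _ _ _ ?_ ?_ <;> split_ifs <;> simp_all
    · rw [Range.cell, hm.k_eq] at hi
      have hv : Function.update v 0 i 0 = (⟨i, hi⟩ : Fin I.k) := by simp
      rw [Term.eval_pairCell hm hv, Term.eval_read, Term.eval_source hm.toIsInput hv, hm.label_eq]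
      exact .source _ ((Term.holds_survives hm hv).1 hs)
    · rw [Range.cell, hm.k_eq] at hi
      have hv : Function.update v 0 i 0 = (⟨i, hi⟩ : Fin I.k) := by simp
      rw [Term.eval_add, Term.eval_pairCell hm hv, Term.eval_read, Term.eval_sink hm.toIsInput hv,
        hm.label_eq]
      exact .sink _ ((Term.holds_survives hm hv).1 hs)
    · rw [Term.eval_order hm]; exact .order
  · rintro (_ | _ | ⟨x, y, _, hw, hxy⟩ | ⟨i, hi⟩ | ⟨i, hi⟩)
    · exact .inl ⟨rfl, (Term.eval_order hm).symm⟩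
    · exact .inr (.inl ⟨rfl, (Term.eval_size hm).symm⟩)
    · refine .inr (.inr (.inl ⟨x, by simp [Range.cell, hm.n_eq], y,
        by simp [Range.cell, hm.n_eq], ?_, ?_⟩))
      · rw [Term.eval_adjCell hm (x := x) (y := y) (by simp) (by simp)]
      · rw [Term.eval_labelAdj hm (x := x) (y := y) (by simp) (by simp)]
        split_ifs with h
        · have := hxy.2 h
          omega
        · by_contra hne
          exact h (hxy.1 hne)
    · have hv : Function.update v 0 (i : ℕ) 0 = i := by simp
      refine .inr (.inr (.inr ⟨i, by simp [Range.cell, hm.k_eq],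
        .inl ⟨(Term.holds_survives hm hv).2 hi, .inl ⟨?_, ?_⟩⟩⟩))
      · rw [Term.eval_pairCell hm hv]
      · rw [Term.eval_read, Term.eval_source hm.toIsInput hv, hm.label_eq]
    · have hv : Function.update v 0 (i : ℕ) 0 = i := by simp
      refine .inr (.inr (.inr ⟨i, by simp [Range.cell, hm.k_eq],
        .inl ⟨(Term.holds_survives hm hv).2 hi, .inr ⟨?_, ?_⟩⟩⟩))
      · rw [Term.eval_add, Term.eval_pairCell hm hv]; rfl
      · rw [Term.eval_read, Term.eval_sink hm.toIsInput hv, hm.label_eq]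

/-- Many vertices share a label, so cells are assigned repeatedly, but every assignment agrees with
the word of `J`. Labels and ranks are onto, so no cell of the word is missed. -/
theorem outputKernel_spec (hm : IsPrepared I m) {J : EDPInstance} (hn : J.n = classCount I.Merged)
    (hk : J.k = I.pairCount) (hadj : ∀ a b : Fin J.n, J.G.Adj a b ↔ I.LabelAdj a b)
    (hst : ∀ j : Fin J.k, ∃ i, I.Survives i ∧ I.pairRank i = j ∧ (J.s j : ℕ) = I.label (I.s i) ∧
      (J.t j : ℕ) = I.label (I.t i)) (i : ℕ) (hi : i < J.word.length) :
    Command.outputKernel.run v m 1 i = J.word[i] := by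
  classical
  have hS := I.merged_equivalence
  obtain ⟨rlt, rinj, -⟩ := rank_bijective I.Survives
  have hlt : ∀ x, I.label x < J.n := fun x => hn ▸ classLabel_lt hS x
  have hpair : ∀ i, I.Survives i → ∃ j : Fin J.k, I.pairRank i = j ∧
      (J.s j : ℕ) = I.label (I.s i) ∧ (J.t j : ℕ) = I.label (I.t i) := by
    intro i hi
    have hr : I.pairRank i < J.k := hk ▸ by
      rw [EDPInstance.pairRank, EDPInstance.pairCount]
      convert rlt i hi
    obtain ⟨i', hi', hr', hs, ht⟩ := hst ⟨_, hr⟩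
    have : i' = i := rinj i' i hi' hi (by
      simp only [EDPInstance.pairRank] at hr'
      convert hr')
    subst this
    exact ⟨⟨_, hr⟩, rfl, hs, ht⟩
  have hword : ∀ c w, KernelCell I c w → J.word[c]? = some w := by
    rintro c w (_ | _ | ⟨x, y, _, hw, hxy⟩ | ⟨i, hi⟩ | ⟨i, hi⟩)
    · rw [← hn, J.word_getElem?_zero]
    · rw [← hk, J.word_getElem?_one]
    · rw [← hn, J.word_getElem?_adj ⟨_, hlt x⟩ ⟨_, hlt y⟩, hadj]
      congr 1
      split_ifs with h
      · have := hxy.2 h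
        omega
      · by_contra hne
        exact h (hxy.1 (Ne.symm hne))
    · obtain ⟨j, hr, hs, -⟩ := hpair i hi
      rw [← hn, hr, ← add_zero (2 + _ + _), J.word_getElem?_pair j 0 (by decide), if_pos rfl, hs]
    · obtain ⟨j, hr, -, ht⟩ := hpair i hi
      rw [← hn, hr, J.word_getElem?_pair j 1 (by decide), if_neg one_ne_zero, ht]
  have ho := outputKernel_overwrites (v := v) hm
  have key : ∀ {c w}, KernelCell I c w → Command.outputKernel.run v m 1 c = w := fun h =>
    ho.eq h fun w' hw' => Option.some.inj ((hword _ _ hw').symm.trans (hword _ _ h))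
  refine J.word_eq_of _ ((key .order).trans hn.symm) ((key .size).trans hk.symm) (fun a b => ?_)
    (fun j => ?_) (fun j => ?_) i hi
  · obtain ⟨x, hx⟩ : ∃ x, I.label x = a := exists_classLabel_eq hS (a.2.trans_eq hn)
    obtain ⟨y, hy⟩ : ∃ y, I.label y = b := exists_classLabel_eq hS (b.2.trans_eq hn)
    have := key (.adj x y (if J.G.Adj a b then 1 else 0) (by split_ifs <;> simp)
      (by rw [hadj, hx, hy]; simp))
    rw [hx, hy, ← hn] at this
    exact this
  · obtain ⟨i, hi, hr, hs, -⟩ := hst j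
    have := key (.source i hi)
    rw [hr, ← hs, ← hn] at this
    exact this
  · obtain ⟨i, hi, hr, -, ht⟩ := hst j
    have := key (.sink i hi)
    rw [hr, ← ht, ← hn] at this
    exact this

theorem kernelize_spec (hI : I.G.IsCliquePath) : ∃ J : EDPInstance, J.G.IsCliquePath ∧
    (I.IsYes ↔ J.IsYes) ∧ J.n ≤ 2 * I.k + 1 ∧ J.k ≤ I.k ∧
    ∀ i (hi : i < J.word.length), Command.kernelize.run v (input I.word) 1 i = J.word[i] := by
  obtain ⟨hG, h, -⟩ := isCliquePath_iff.1 hI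
  have hm := prepare_spec (v := v) (isInput_input I) hI fun _ => rfl
  have ho := Term.holds_overloaded (v := v) hm.toIsInput hm.demand_eq
  by_cases hov : I.G.Overloaded I.s I.t
  · have hk : 2 ≤ I.k := by
      obtain ⟨x, y, -, hlt⟩ := hov
      have : I.G.demand I.s I.t x y ≤ Fintype.card (Fin I.k) := card_le_univ _
      rw [Fintype.card_fin] at this
      omega
    refine ⟨.trivialNo, EDPInstance.trivialNo_isCliquePath,
      iff_of_false ?_ EDPInstance.trivialNo_not_isYes, ?_, hk, fun i hi => ?_⟩
    · rw [EDPInstance.isYes_iff]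
      exact hov.not_routable h hG
    · change 2 ≤ _
      omega
    · rw [Command.kernelize, Command.run, Command.run, if_pos (by exact ho.2 hov)]
      exact outputTrivialNo_spec i hi
  · obtain ⟨J, h1, h2, h3, h4, hn, hk, hadj, hst⟩ := I.exists_kernel hI hov
    refine ⟨J, h1, h2, h3, h4, fun i hi => ?_⟩
    rw [Command.kernelize, Command.run, Command.run, if_neg (by exact mt ho.1 hov)]
    exact outputKernel_spec hm hn hk hadj hst i hi

end RAM

theorem theorem5 :
    EDPAdmitsVertexKernel (fun _ G => G.IsCliquePath) (fun k => 2 * k + 1) := by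
  obtain ⟨A, P, hA⟩ := RAM.Command.kernelize.exists_program
  refine ⟨A, P, fun I hI => ?_⟩
  obtain ⟨J, h1, h2, h3, h4, h5⟩ := RAM.kernelize_spec (v := fun _ => 0) hI
  refine ⟨J, h1, h2, h3, h4, hA _ _ _ ?_ ?_ h5⟩
  -- The first loop bound is `n ≤ n * n`, which is at most the length of the word; the second is `k`
  -- itself.
  · rw [List.getD_eq_getElem?_getD, I.word_getElem?_zero, Option.getD_some, I.length_word]
    have := Nat.le_mul_self I.n
    omega
  · rw [List.getD_eq_getElem?_getD, I.word_getElem?_one, Option.getD_some]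
    omega
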